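/- **Setting.** Let $T\ge 2$, $d_0=1$, let $X\subseteq\mathbb R^{d_T}$ be closed and convex, and let $f_i:\mathbb R^{d_i}\to\mathbb R^{d_{i-1}}$ ($1\le i\le T$) be differentiable and Lipschitz with constant $L_{f_i}$, with derivatives Lipschitz with constant $L_{\nabla f_i}$. Put $F=f_1\circ\cdots\circ f_T$, assume $F\ge F^*>-\infty$ on $X$, and write $\nabla f_i(y)\in\mathbb R^{d_i\times d_{i-1}}$ for the transposed Jacobian. **Method.** Given step sizes $\tau_k\in(0,1]$ with $\tau_0=1$, $\beta>0$, batch sizes $b_k=\lceil \max_{i}L_{f_i}^2/\tau_k\rceil$ and deterministic $x^0\in X$, $z^0\in\mathbb R^{d_T}$, $w_i^0\in\mathbb R^{d_{i-1}}$, let, for $k\ge0$ and with $w_{T+1}^k\equiv x^k$, $$u^k=\operatorname*{argmin}_{y\in X}\{\langle z^k,y-x^k\rangle+\tfrac\beta2\|y-x^k\|^2\},\qquad x^{k+1}=(1-\tau_k)x^k+\tau_ku^k,$$ $$z^{k+1}=(1-\tau_k)z^k+\tau_k J_T^{k+1}J_{T-1}^{k+1}\cdots J_1^{k+1},\qquad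 w_i^{k+1}=(1-\tau_k)w_i^k+\frac{\tau_k}{b_k}\sum_{j=1}^{b_k}G_{i,j}^{k+1}\quad(1\le i\le T).$$ Let $\mathscr F_k$ be generated by $x^l,z^l,u^l,w_1^l,\dots,w_T^l$, $l\le k$. **Oracle.** For all $k$, $i$ and $j\le b_k$: $\mathbb E[J_i^{k+1}|\mathscr F_k]=\nabla f_i(w_{i+1}^k)$ and $\mathbb E[G_{i,j}^{k+1}|\mathscr F_k]=f_i(w_{i+1}^k)$; $\mathbb E[\|G_{i,j}^{k+1}-f_i(w_{i+1}^k)\|^2|\mathscr F_k]\le\sigma_{G_i}^2$, $\mathbb E[\|J_i^{k+1}-\nabla f_i(w_{i+1}^k)\|^2|\mathscr F_k]\le\hat\sigma_{J_i}^2$ and $\mathbb E[\|J_i^{k+1}\|^2|\mathscr F_k]\le\sigma_{J_i}^2$ (Frobenius norms; all these variables integrable). Given $\mathscr F_k$: $G_{i,j}^{k+1}$ and $J_i^{k+1}$ are independent for each $i,j$; the matrices $J_1^{k+1},\dots,J_T^{k+1}$ are independent; the vectors $G_{i,j}^{k+1}$ ($1\le i\le T$, $1\le j\le b_k$) are independent.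 Moreover $\|z^0\|^2\le\prod_{\ell=1}^T\sigma_{J_\ell}^2$. **Constants.** Let $R_j=L_{\nabla f_j}\prod_{l\ne j}L_{f_l}$ and $C_j=\sum_{r=1}^{j-1}R_r\prod_{l=r+1}^{j-1}L_{f_l}$ for $2\le j\le T$. Let $$L_{\nabla F}=\sum_{j=1}^TL_{\nabla f_j}\prod_{l<j}L_{f_l}\prod_{l>j}L_{f_l}^2,\qquad L_{\nabla\eta}=2\sqrt{(1+\beta)^2+(1+\tfrac1{2\beta})^2},\qquad L^2=\max\{L_{\nabla F}^2,\max_{2\le j\le T}C_j^2\}.$$ Let $\gamma_j=2^{j-1}(L_{f_1}\cdots L_{f_{j-1}})^2\sqrt T$ for $2\le j\le T$, $\gamma_1=\lambda$, and assume $$0<\lambda\le\tfrac12\min_{2\le i\le T}(\gamma_i-\gamma_{i-1}L_{f_{i-1}}^2),\qquad \beta\ge\lambda+\gamma_TL_{f_T}^2+\frac{T\max_{2\le j\le T}C_j^2}{4\lambda}.$$ Let $\eta(x,z)=\min_{y\in X}\{\langle z,y-x\rangle+\frac\beta2\|y-x\|^2\}$, $W_0=F(x^0)-F^*-\eta(x^0,z^0)+\sum_{i=1}^T\gamma_i\|f_i(w_{i+1}^0)-w_i^0\|^2$,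 and $$\sigma^2=\frac12\Big(\prod_{i=1}^T\sigma_{J_i}^2\Big)\frac{L_{\nabla F}+(1+4\beta^2)L_{\nabla\eta}}{\beta^2}+\sum_{i=1}^T\gamma_i\sigma_{G_i}^2+\sum_{i=1}^{T-1}\gamma_i\sigma_{G_{i+1}}^2 .$$ Let $V(x,z)=\|\bar u-x\|^2+\|z-\nabla F(x)\|^2$ with $\bar u=\operatorname{argmin}_{y\in X}\{\langle z,y-x\rangle+\frac12\|y-x\|^2\}$. For $N\ge1$ let $R$ be independent of the iterates with $\mathbb P[R=k]=\tau_k/\sum_{j=1}^N\tau_j$, $1\le k\le N$. Let $\Gamma_k=\prod_{i=1}^{k-1}(1-\tau_i)$ for $k\ge1$. **Theorem.** Suppose, for (a) and (b), that $c>0$ and $\sum_{i=k+1}^N\tau_i\Gamma_i\le c\,\Gamma_{k+1}$ for all $k\ge0$, $N\ge1$. Then all the expectations below are finite, and for every $N\ge1$: (a) $$\sum_{k=1}^N\tau_k\,\mathbb E\|\nabla F(x^k)-z^k\|^2\le\mathcal B_1:=\frac{4cL^2(T-1)}\lambda\Big[W_0+\sigma^2\sum_{k=0}^{N-1}\tau_k^2\Big]+c\prod_{\ell=1}^T\sigma_{J_\ell}^2\sum_{k=0}^{N-1}\tau_k^2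 .$$ (b) $$\mathbb E[V(x^R,z^R)]\le\frac1{\sum_{k=1}^N\tau_k}\Big\{\mathcal B_1+\frac{\max(1,\beta^2)}\lambda\Big[W_0+\sigma^2\sum_{k=0}^N\tau_k^2\Big]\Big\}.$$ (c) If $\tau_k=1/\sqrt N$ for $1\le k\le N$ (and $\tau_0=1$), then, with $\mathcal B_2=\frac{4L^2(T-1)[W_0+2\sigma^2]}\lambda+2\prod_{\ell=1}^T\sigma_{J_\ell}^2$, $$\mathbb E\|\nabla F(x^R)-z^R\|^2\le\frac{\mathcal B_2}{\sqrt N},\qquad \mathbb E[V(x^R,z^R)]\le\frac1{\sqrt N}\Big[\mathcal B_2+\frac{\max(1,\beta^2)}\lambda(W_0+2\sigma^2)\Big],$$ $$\mathbb E\|f_i(w_{i+1}^R)-w_i^R\|^2\le\frac{W_0+2\sigma^2}{\lambda\sqrt N}\qquad(1\le i\le T).$$ -/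

import Mathlib

open MeasureTheory ProbabilityTheory
open scoped NNReal

noncomputable section

namespace NASA

/-! ### Levels, composition, gradients

Levels are indexed from `0`: for `i < T`, `f i` is the function called `f_{i+1}` in the usual
`1`-based numbering, so that `F = f 0 ∘ f 1 ∘ ⋯ ∘ f (T-1)`, and every constant carrying the index
`i` belongs to that function. -/

/-- The dimension of the `i`-th space; the outermost function is real valued, so it is `1` at
`i = 0`. -/
def levelDim (d : ℕ → ℕ) : ℕ → ℕ
  | 0 => 1
  | i + 1 => d (i + 1)

/-- The Euclidean space in which level `i` takes its values. -/
abbrev LevelSpace (d : ℕ → ℕ) (i : ℕ) : Type := EuclideanSpace ℝ (Fin (levelDim d i))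

/-- Matrices of the shape of a gradient (transposed Jacobian) of `f i`. -/
abbrev LevelMatrix (d : ℕ → ℕ) (i : ℕ) : Type :=
  Matrix (Fin (levelDim d (i + 1))) (Fin (levelDim d i)) ℝ

/-- `composite f n = f 0 ∘ f 1 ∘ ⋯ ∘ f (n-1)`. -/
def composite {d : ℕ → ℕ} (f : ∀ i, LevelSpace d (i + 1) → LevelSpace d i) :
    (n : ℕ) → LevelSpace d n → LevelSpace d 0
  | 0, x => x
  | n + 1, x => composite f n (f n x)

/-- The real-valued objective `F = f 0 ∘ ⋯ ∘ f (T-1)`. -/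
def objective {d : ℕ → ℕ} (f : ∀ i, LevelSpace d (i + 1) → LevelSpace d i) (T : ℕ)
    (x : LevelSpace d T) : ℝ :=
  composite f T x (0 : Fin 1)

/-- The gradient matrix `∇f`, with entry `∂ f_b / ∂ y_a` in row `a` and column `b`. -/
def gradMatrix {m n : ℕ} (g : EuclideanSpace ℝ (Fin m) → EuclideanSpace ℝ (Fin n))
    (y : EuclideanSpace ℝ (Fin m)) : Matrix (Fin m) (Fin n) ℝ :=
  fun a b => fderiv ℝ g y (EuclideanSpace.single a 1) b

/-- Matrices carry the product σ-algebra. -/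
instance matrixMeasurableSpace (m n : ℕ) : MeasurableSpace (Matrix (Fin m) (Fin n) ℝ) :=
  inferInstanceAs (MeasurableSpace (Fin m → Fin n → ℝ))

/-- The square of the Frobenius norm of a matrix. -/
def frobSq {m n : ℕ} (M : Matrix (Fin m) (Fin n) ℝ) : ℝ := ∑ a, ∑ b, M a b ^ 2

/-- The product `M (n-1) * ⋯ * M 1 * M 0`. -/
def matrixProd {d : ℕ → ℕ} (M : ∀ i, LevelMatrix d i) :
    (n : ℕ) → Matrix (Fin (levelDim d n)) (Fin (levelDim d 0)) ℝ
  | 0 => 1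
  | n + 1 => M n * matrixProd M n

/-- The only column of `M (T-1) * ⋯ * M 1 * M 0`, as a vector. -/
def prodVec {d : ℕ → ℕ} (M : ∀ i, LevelMatrix d i) (T : ℕ) : LevelSpace d T :=
  WithLp.toLp 2 (fun a => matrixProd M T a (0 : Fin 1))

/-! ### The subproblem, the stationarity measure and the merit function -/

/-- The objective `y ↦ ⟨z, y - x⟩ + (β / 2) ‖y - x‖²` of the subproblem. -/
def subObjective {n : ℕ} (β : ℝ) (x z y : EuclideanSpace ℝ (Fin n)) : ℝ :=
  inner ℝ z (y - x) + β / 2 * ‖y - x‖ ^ 2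

/-- `u` minimizes the subproblem over `X`. -/
def IsSubSolution {n : ℕ} (X : Set (EuclideanSpace ℝ (Fin n))) (β : ℝ)
    (x z u : EuclideanSpace ℝ (Fin n)) : Prop :=
  u ∈ X ∧ IsMinOn (subObjective β x z) X u

/-- The minimizer of the subproblem (it exists and is unique when `X` is nonempty, closed and
convex and `β > 0`). -/
def subSolution {n : ℕ} (X : Set (EuclideanSpace ℝ (Fin n))) (β : ℝ)
    (x z : EuclideanSpace ℝ (Fin n)) : EuclideanSpace ℝ (Fin n) :=
  Classical.epsilon (IsSubSolution X β x z)

/-- `η(x, z)`, the minimal value of the subproblem. -/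
def eta {n : ℕ} (X : Set (EuclideanSpace ℝ (Fin n))) (β : ℝ)
    (x z : EuclideanSpace ℝ (Fin n)) : ℝ :=
  sInf (subObjective β x z '' X)

/-- `V(x, z) = ‖ū - x‖² + ‖z - ∇F(x)‖²`, where `ū` solves the subproblem with `β = 1`. -/
def stationarity {n : ℕ} (X : Set (EuclideanSpace ℝ (Fin n))) (F : EuclideanSpace ℝ (Fin n) → ℝ)
    (x z : EuclideanSpace ℝ (Fin n)) : ℝ :=
  ‖subSolution X 1 x z - x‖ ^ 2 + ‖z - gradient F x‖ ^ 2

/-- The merit function `W_γ(x, z, w)`; the family `w` is to have `w T = x`. -/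
def merit {d : ℕ → ℕ} (f : ∀ i, LevelSpace d (i + 1) → LevelSpace d i) (T : ℕ)
    (X : Set (LevelSpace d T)) (β Fstar : ℝ) (γ : ℕ → ℝ)
    (x z : LevelSpace d T) (w : ∀ i, LevelSpace d i) : ℝ :=
  objective f T x - Fstar - eta X β x z
    + ∑ i ∈ Finset.range T, γ i * ‖f i (w (i + 1)) - w i‖ ^ 2

/-! ### Constants

`Lf i` and `Lg i` are the Lipschitz constants of `f i` and of its derivative. -/

/-- The Lipschitz constant `L_{∇F}` of the gradient of `F`. -/
def lipGradF (T : ℕ) (Lf Lg : ℕ → ℝ≥0) : ℝ≥0 :=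
  ∑ j ∈ Finset.range T,
    Lg j * (∏ l ∈ Finset.range j, Lf l) * ∏ l ∈ Finset.Ico (j + 1) T, Lf l ^ 2

/-- The Lipschitz constant `L_{∇η}` of the gradient of `η`. -/
def lipGradEta (β : ℝ) : ℝ := 2 * Real.sqrt ((1 + β) ^ 2 + (1 + 1 / (2 * β)) ^ 2)

/-- `R_j`: the Lipschitz constant of `∇f j` times the Lipschitz constants of all other levels. -/
def constR (T : ℕ) (Lf Lg : ℕ → ℝ≥0) (j : ℕ) : ℝ≥0 :=
  Lg j * ∏ l ∈ (Finset.range T).erase j, Lf l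

/-- `C_j = ∑_{r < j} R_r ∏_{r < l < j} Lf l`, for `1 ≤ j < T`. -/
def constC (T : ℕ) (Lf Lg : ℕ → ℝ≥0) (j : ℕ) : ℝ≥0 :=
  ∑ r ∈ Finset.range j, constR T Lf Lg r * ∏ l ∈ Finset.Ioo r j, Lf l

/-- `max_{1 ≤ j < T} C_j ^ 2`. -/
def maxCSq (T : ℕ) (Lf Lg : ℕ → ℝ≥0) : ℝ≥0 :=
  (Finset.Ico 1 T).sup fun j => constC T Lf Lg j ^ 2

/-- `L² = max {L_{∇F}², max_j C_j²}`. -/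
def constLSq (T : ℕ) (Lf Lg : ℕ → ℝ≥0) : ℝ≥0 := max (lipGradF T Lf Lg ^ 2) (maxCSq T Lf Lg)

/-- `max_{i < T} (Lf i)²`. -/
def maxLfSq (T : ℕ) (Lf : ℕ → ℝ≥0) : ℝ≥0 := (Finset.range T).sup fun i => Lf i ^ 2

/-- The weights of the merit function: `lam` for the outermost level and
`2^i (Lf 0 ⋯ Lf (i-1))² √T` for level `i ≥ 1`. -/
def gammaWeight (T : ℕ) (Lf : ℕ → ℝ≥0) (lam : ℝ) (i : ℕ) : ℝ :=
  if i = 0 then lam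
  else 2 ^ i * ((∏ l ∈ Finset.range i, Lf l : ℝ≥0) : ℝ) ^ 2 * Real.sqrt T

/-- The conditions on the parameters `lam` and `β`. -/
structure ParameterRule (T : ℕ) (Lf Lg : ℕ → ℝ≥0) (lam β : ℝ) : Prop where
  lam_pos : 0 < lam
  lam_le : ∀ i, 1 ≤ i → i < T →
    lam ≤ 1 / 2 * (gammaWeight T Lf lam i - gammaWeight T Lf lam (i - 1) * (Lf (i - 1) : ℝ) ^ 2)
  beta_ge : lam + gammaWeight T Lf lam (T - 1) * (Lf (T - 1) : ℝ) ^ 2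
    + T * (maxCSq T Lf Lg : ℝ) / (4 * lam) ≤ β

/-- `∏_ℓ σ_{J_ℓ}²`. -/
def prodSigmaJ (T : ℕ) (σJ : ℕ → ℝ) : ℝ := ∏ i ∈ Finset.range T, σJ i ^ 2

/-- The variance constant `σ²`. -/
def sigmaSq (T : ℕ) (Lf Lg : ℕ → ℝ≥0) (lam β : ℝ) (σG σJ : ℕ → ℝ) : ℝ :=
  1 / 2 * prodSigmaJ T σJ
      * (((lipGradF T Lf Lg : ℝ) + (1 + 4 * β ^ 2) * lipGradEta β) / β ^ 2)
    + ∑ i ∈ Finset.range T, gammaWeight T Lf lam i * σG i ^ 2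
    + ∑ i ∈ Finset.range (T - 1), gammaWeight T Lf lam i * σG (i + 1) ^ 2

/-- The sequence `Γ_k`, `k ≥ 1`. -/
def Gam (τ : ℕ → ℝ) (k : ℕ) : ℝ :=
  (if τ 0 = 1 then 1 else 1 - τ 0) * ∏ i ∈ Finset.Ico 1 k, (1 - τ i)

/-- `∑_{i=k+1}^N τ_i Γ_i ≤ c Γ_{k+1}` for all `k ≥ 0` and `N ≥ 1`. -/
def GammaCondition (τ : ℕ → ℝ) (c : ℝ) : Prop :=
  ∀ k N : ℕ, 1 ≤ N → ∑ i ∈ Finset.Icc (k + 1) N, τ i * Gam τ i ≤ c * Gam τ (k + 1)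

/-- The bound `B₁(σ², N)`; `W0` stands for the initial value of the merit function. -/
def boundB1 (T : ℕ) (Lf Lg : ℕ → ℝ≥0) (lam c W0 σsq PJ : ℝ) (τ : ℕ → ℝ) (N : ℕ) : ℝ :=
  4 * c * (constLSq T Lf Lg : ℝ) * ((T : ℝ) - 1) / lam
      * (W0 + σsq * ∑ k ∈ Finset.range N, τ k ^ 2)
    + c * PJ * ∑ k ∈ Finset.range N, τ k ^ 2

/-- The bound `B₂(σ²)`. -/
def boundB2 (T : ℕ) (Lf Lg : ℕ → ℝ≥0) (lam W0 σsq PJ : ℝ) : ℝ :=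
  4 * (constLSq T Lf Lg : ℝ) * ((T : ℝ) - 1) * (W0 + 2 * σsq) / lam + 2 * PJ

/-! ### Conditional independence

Spelled out through conditional probabilities, for an arbitrary probability space. -/

/-- The random variables `Y i` are mutually independent given `m`. -/
def CondIndepFamily {Ω ι : Type*} (m : MeasurableSpace Ω) [MeasurableSpace Ω]
    (μ : Measure Ω) {E : ι → Type*} [∀ i, MeasurableSpace (E i)] (Y : ∀ i, Ω → E i) : Prop :=
  ∀ (S : Finset ι) (B : ∀ i, Set (E i)), (∀ i ∈ S, MeasurableSet (B i)) →
    μ⟦⋂ i ∈ S, Y i ⁻¹' B i | m⟧ =ᵐ[μ] ∏ i ∈ S, μ⟦Y i ⁻¹' B i | m⟧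

/-- The random variables `Y` and `Z` are independent given `m`. -/
def CondIndepPair {Ω : Type*} (m : MeasurableSpace Ω) [MeasurableSpace Ω]
    (μ : Measure Ω) {E E' : Type*} [MeasurableSpace E] [MeasurableSpace E']
    (Y : Ω → E) (Z : Ω → E') : Prop :=
  ∀ (A : Set E) (B : Set E'), MeasurableSet A → MeasurableSet B →
    μ⟦Y ⁻¹' A ∩ Z ⁻¹' B | m⟧ =ᵐ[μ] μ⟦Y ⁻¹' A | m⟧ * μ⟦Z ⁻¹' B | m⟧

/-! ### The algorithm and the stochastic oracle -/

/-- The random sequences of the method. At iteration `k` the iterates are `x k`, `z k`, `u k` and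
`w k i`, and the oracle returns `J k i` (one matrix for each level `i < T`) and the samples
`G k i j`, `j < b k`, which are the quantities with superscript `k + 1` in the usual notation. -/
structure Run (d : ℕ → ℕ) (T : ℕ) (Ω : Type*) where
  x : ℕ → Ω → LevelSpace d T
  z : ℕ → Ω → LevelSpace d T
  u : ℕ → Ω → LevelSpace d T
  w : ℕ → (i : ℕ) → Ω → LevelSpace d i
  J : ℕ → (i : ℕ) → Ω → LevelMatrix d i
  G : ℕ → (i : ℕ) → ℕ → Ω → LevelSpace d i

namespace Run

variable {d : ℕ → ℕ} {T : ℕ} {Ω : Type*}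

/-- The σ-algebra generated by `x`, `z`, `u` and all the `w`'s up to time `k`. -/
@[reducible] def history (P : Run d T Ω) (k : ℕ) : MeasurableSpace Ω :=
  ⨆ (j : ℕ) (_ : j ≤ k),
    MeasurableSpace.comap (P.x j) inferInstance ⊔ MeasurableSpace.comap (P.z j) inferInstance
      ⊔ MeasurableSpace.comap (P.u j) inferInstance
      ⊔ ⨆ (i : ℕ) (_ : i < T), MeasurableSpace.comap (P.w j i) inferInstance

/-- The run is generated by the method, started from `x0`, `z0`, `w0`. By the convention
`w_top`, the argument of `f i` in iteration `k` is `w k (i + 1)` for every `i < T`. -/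
structure GeneratedBy (P : Run d T Ω) (X : Set (LevelSpace d T)) (β : ℝ) (τ : ℕ → ℝ)
    (b : ℕ → ℕ) (x0 z0 : LevelSpace d T) (w0 : ∀ i, LevelSpace d i) : Prop where
  x_zero : ∀ ω, P.x 0 ω = x0
  z_zero : ∀ ω, P.z 0 ω = z0
  w_zero : ∀ i < T, ∀ ω, P.w 0 i ω = w0 i
  w_top : ∀ k ω, P.w k T ω = P.x k ω
  u_eq : ∀ k ω, IsSubSolution X β (P.x k ω) (P.z k ω) (P.u k ω)
  x_succ : ∀ k ω, P.x (k + 1) ω = (1 - τ k) • P.x k ω + τ k • P.u k ω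
  z_succ : ∀ k ω, P.z (k + 1) ω = (1 - τ k) • P.z k ω + τ k • prodVec (fun i => P.J k i ω) T
  w_succ : ∀ k, ∀ i < T, ∀ ω, P.w (k + 1) i ω
    = (1 - τ k) • P.w k i ω + τ k • ((b k : ℝ)⁻¹ • ∑ j ∈ Finset.range (b k), P.G k i j ω)

/-- The assumptions on the stochastic first-order oracle, each of the `b k` samples of a
mini-batch being one answer of the oracle. -/
structure Oracle [MeasurableSpace Ω] (P : Run d T Ω) (μ : Measure Ω)
    (f : ∀ i, LevelSpace d (i + 1) → LevelSpace d i) (b : ℕ → ℕ) (σG σJ σJhat : ℕ → ℝ) :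
    Prop where
  measurable_J : ∀ k, ∀ i < T, Measurable (P.J k i)
  measurable_G : ∀ k, ∀ i < T, ∀ j < b k, Measurable (P.G k i j)
  integrable_J : ∀ k, ∀ i < T, ∀ a c, Integrable (fun ω => P.J k i ω a c) μ
  integrable_G : ∀ k, ∀ i < T, ∀ j < b k, Integrable (P.G k i j) μ
  unbiased_J : ∀ k, ∀ i < T, ∀ a c,
    μ[fun ω => P.J k i ω a c | P.history k] =ᵐ[μ] fun ω => gradMatrix (f i) (P.w k (i + 1) ω) a c
  unbiased_G : ∀ k, ∀ i < T, ∀ j < b k,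
    μ[P.G k i j | P.history k] =ᵐ[μ] fun ω => f i (P.w k (i + 1) ω)
  sq_integrable_G : ∀ k, ∀ i < T, ∀ j < b k,
    Integrable (fun ω => ‖P.G k i j ω - f i (P.w k (i + 1) ω)‖ ^ 2) μ
  variance_G : ∀ k, ∀ i < T, ∀ j < b k,
    μ[fun ω => ‖P.G k i j ω - f i (P.w k (i + 1) ω)‖ ^ 2 | P.history k]
      ≤ᵐ[μ] fun _ => σG i ^ 2
  sq_integrable_J_sub : ∀ k, ∀ i < T,
    Integrable (fun ω => frobSq (P.J k i ω - gradMatrix (f i) (P.w k (i + 1) ω))) μ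
  variance_J : ∀ k, ∀ i < T,
    μ[fun ω => frobSq (P.J k i ω - gradMatrix (f i) (P.w k (i + 1) ω)) | P.history k]
      ≤ᵐ[μ] fun _ => σJhat i ^ 2
  sq_integrable_J : ∀ k, ∀ i < T, Integrable (fun ω => frobSq (P.J k i ω)) μ
  second_moment_J : ∀ k, ∀ i < T,
    μ[fun ω => frobSq (P.J k i ω) | P.history k] ≤ᵐ[μ] fun _ => σJ i ^ 2
  indep_G_J : ∀ k, ∀ i < T, ∀ j < b k, CondIndepPair (P.history k) μ (P.G k i j) (P.J k i)
  indep_J : ∀ k, CondIndepFamily (P.history k) μ (fun i : Fin T => P.J k i)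
  indep_G : ∀ k, CondIndepFamily (P.history k) μ (fun p : Fin T × Fin (b k) => P.G k p.1 p.2)

/-- `R` is a random index in `{1, …, N}` with `ℙ[R = k] = τ k / ∑_{j=1}^N τ j`, independent of
all the iterates. -/
structure RandomIndex [MeasurableSpace Ω] (P : Run d T Ω) (μ : Measure Ω) (τ : ℕ → ℝ)
    (N : ℕ) (R : Ω → ℕ) : Prop where
  measurable : Measurable R
  indep : Indep (MeasurableSpace.comap R inferInstance) (⨆ k, P.history k) μ
  law : ∀ k ∈ Finset.Icc 1 N, μ.real {ω | R ω = k} = τ k / ∑ j ∈ Finset.Icc 1 N, τ j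

end Run

end NASA

end

/-!
# Convergence of multi-level nested stochastic averaging

The proof is a Lyapunov argument. Write `p = u - x` for the step direction, and call
`D i = f i (w (i + 1)) - w i` the tracking error of level `i`. The merit function
`F(x) - η(x, z) + ∑ γ i ‖D i‖²` decreases on average:

* `F - η` decreases by about `τ β ‖p‖²` (`Model.objective_sub_eta_succ_le`). The descent lemma for
  `F` produces `⟨∇F(x), p⟩`, the one-sided expansion of `η` (`IsSubSolution.eta_sub_le`) produces
  minus the inner product of `p` with the sampled gradient. Both cancel up to a centered term and
  the bias of the sampled gradient, which comes from differentiating `f i` at `w (i + 1)` instead of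
  the true inner value; it is at most `∑ C j ‖D j‖` (`norm_gradient_sub_prodVec_le`).
* Each `‖D i‖²` contracts by the factor `1 - τ`, up to the movement of its own argument, which is
  of size `τ` times `D (i + 1)` plus noise (`τ p` for the innermost level), and up to sampling
  noise (`Model.sqErr_succ_le`, `Model.sqErr_succ_last_le`). The noise of level `i` is uncorrelated
  with the movement of its argument because distinct levels are sampled independently, and its
  variance carries the factor `1 / b`, which the batch size makes of order `τ`.

The conditions on `γ`, `lam` and `β` make the negative terms dominate, so that the merit function
drops by at least `τ lam (‖p‖² + ∑ ‖D i‖²) - τ² σ²` on average (`Model.potential_succ_le`).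
Summation bounds `∑ τ 𝔼[‖p‖² + ∑ ‖D i‖²]` (`Model.lam_mul_sum_total_le`).

The gradient error `∇F(x) - z` obeys a similar recursion with factor `1 - τ`, whose forcing term is
controlled by `‖p‖² + ∑ ‖D i‖²` (`Model.track_succ_le`). Unrolling it, each forcing term enters
`∑ τ 𝔼‖∇F(x) - z‖²` with the telescoping weight `1 - ∏ (1 - τ l)`, which is at most `c`, and always
at most `1` (`sum_mul_le_of_recursion`). The stationarity measure is bounded by `‖p‖²` and the
gradient error (`IsSubSolution.sq_norm_le`), and evaluating at the independent random index turns
weighted sums into expectations (`Model.integral_randomIndex`).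

Conditional independence enters through one fact, `CondIndepFamily.condExp_sup`: given the history,
the other members of a conditionally independent family do not change the conditional expectation
of a function of one member. It yields unbiasedness and the second moment bound for the product of
the sampled matrices, which is not assumed to be integrable, and the orthogonality of the samples.
-/

noncomputable section

namespace NASA

/-! ### The proximal subproblem -/

section Subproblem

variable {n : ℕ} {X : Set (EuclideanSpace ℝ (Fin n))} {β : ℝ}
  {x z u x' z' u' : EuclideanSpace ℝ (Fin n)}

/-- Exact second-order expansion of the quadratic subproblem objective. -/
lemma subObjective_eq_add (y : EuclideanSpace ℝ (Fin n)) :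
    subObjective β x z y = subObjective β x z u + inner ℝ (z + β • (u - x)) (y - u)
      + β / 2 * ‖y - u‖ ^ 2 := by
  have e : y - x = (u - x) + (y - u) := by abel
  unfold subObjective
  rw [e, norm_add_sq_real, inner_add_right, inner_add_left, real_inner_smul_left]
  ring

/-- First-order optimality: the variational inequality of the subproblem. -/
lemma IsSubSolution.inner_nonneg (hX : Convex ℝ X) (hβ : 0 < β) (hu : IsSubSolution X β x z u)
    {y : EuclideanSpace ℝ (Fin n)} (hy : y ∈ X) :
    0 ≤ inner ℝ (z + β • (u - x)) (y - u) := by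
  by_contra! ha
  set a := inner ℝ (z + β • (u - x)) (y - u) with hadef
  set b := β / 2 * ‖y - u‖ ^ 2 with hb
  have hb0 : 0 ≤ b := by positivity
  -- A short step towards `y` makes the linear term dominate the quadratic one.
  set t := min 1 (-a / (2 * (b + 1))) with ht
  have ht0 : 0 < t := lt_min one_pos (div_pos (by linarith) (by linarith))
  have ht1 : t ≤ 1 := min_le_left _ _
  have ht2 : t * (2 * (b + 1)) ≤ -a := by
    rw [← le_div_iff₀ (by linarith)]; exact min_le_right _ _
  have hmem : u + t • (y - u) ∈ X := hX.add_smul_sub_mem hu.1 hy ⟨ht0.le, ht1⟩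
  have h := hu.2 hmem
  simp only [Set.mem_ofPred_eq] at h
  rw [subObjective_eq_add (u := u) (u + t • (y - u)), add_sub_cancel_left, real_inner_smul_right,
    norm_smul, Real.norm_of_nonneg ht0.le] at h
  have h2 : 0 ≤ t * (a + t * b) := by rw [hb]; nlinarith
  nlinarith [nonneg_of_mul_nonneg_right h2 ht0]

lemma exists_isSubSolution (hXc : IsClosed X) (hX : Convex ℝ X) (hne : X.Nonempty) (hβ : 0 < β)
    (x z : EuclideanSpace ℝ (Fin n)) : ∃ u, IsSubSolution X β x z u := by
  obtain ⟨v, hv, hvmin⟩ := exists_norm_eq_iInf_of_complete_convex hne hXc.isComplete hX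
    (x - β⁻¹ • z)
  rw [norm_eq_iInf_iff_real_inner_le_zero hX hv] at hvmin
  refine ⟨v, hv, fun y hy => ?_⟩
  have h := hvmin y hy
  have e : z + β • (v - x) = (-β) • (x - β⁻¹ • z - v) := by
    simp only [neg_smul, smul_sub, smul_smul, neg_mul, mul_inv_cancel₀ hβ.ne', one_smul]
    abel
  have h2 : 0 ≤ inner ℝ (z + β • (v - x)) (y - v) := by
    rw [e, real_inner_smul_left]; nlinarith
  simp only [Set.mem_ofPred_eq]
  rw [subObjective_eq_add (u := v) y]
  have : 0 ≤ β / 2 * ‖y - v‖ ^ 2 := by positivity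
  linarith

lemma isSubSolution_subSolution (hXc : IsClosed X) (hX : Convex ℝ X) (hne : X.Nonempty)
    (hβ : 0 < β) (x z : EuclideanSpace ℝ (Fin n)) :
    IsSubSolution X β x z (subSolution X β x z) :=
  Classical.epsilon_spec (exists_isSubSolution hXc hX hne hβ x z)

/-- The solution is the projection of `x - β⁻¹ z`, and projections are nonexpansive. -/
lemma IsSubSolution.norm_sub_le (hX : Convex ℝ X) (hβ : 0 < β) (hu : IsSubSolution X β x z u)
    (hu' : IsSubSolution X β x' z' u') :
    ‖u - u'‖ ≤ ‖(x - β⁻¹ • z) - (x' - β⁻¹ • z')‖ := by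
  have h1 := hu.inner_nonneg hX hβ hu'.1
  have h2 := hu'.inner_nonneg hX hβ hu.1
  set q := (x - β⁻¹ • z) - (x' - β⁻¹ • z') with hq
  have e : β • ((q - (u - u'))) = (z' + β • (u' - x')) - (z + β • (u - x)) := by
    rw [hq]
    simp only [smul_sub, smul_smul, mul_inv_cancel₀ hβ.ne', one_smul]
    abel
  have h3 : 0 ≤ inner ℝ (β • (q - (u - u'))) (u - u') := by
    rw [e, inner_sub_left]
    have : inner ℝ (z + β • (u - x)) (u - u') = - inner ℝ (z + β • (u - x)) (u' - u) := by
      rw [← inner_neg_right, neg_sub]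
    linarith
  rw [real_inner_smul_left, inner_sub_left, real_inner_self_eq_norm_sq] at h3
  have h4 := nonneg_of_mul_nonneg_right h3 hβ
  have h5 := real_inner_le_norm q (u - u')
  by_contra! h6
  nlinarith [norm_nonneg q, norm_nonneg (u - u')]

lemma IsSubSolution.eq_subSolution (hXc : IsClosed X) (hX : Convex ℝ X) (hβ : 0 < β)
    (hu : IsSubSolution X β x z u) : u = subSolution X β x z := by
  have h := hu.norm_sub_le hX hβ (isSubSolution_subSolution hXc hX ⟨u, hu.1⟩ hβ x z)
  rw [sub_self, norm_zero] at h
  exact sub_eq_zero.1 (norm_le_zero_iff.1 h)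

lemma continuous_subSolution (hXc : IsClosed X) (hX : Convex ℝ X) (hne : X.Nonempty)
    (hβ : 0 < β) : Continuous fun p : EuclideanSpace ℝ (Fin n) × EuclideanSpace ℝ (Fin n) =>
      subSolution X β p.1 p.2 := by
  rw [continuous_iff_continuousAt]
  intro p
  rw [ContinuousAt, tendsto_iff_norm_sub_tendsto_zero]
  refine squeeze_zero (fun _ => norm_nonneg _) (fun q =>
    (isSubSolution_subSolution hXc hX hne hβ q.1 q.2).norm_sub_le hX hβ
      (isSubSolution_subSolution hXc hX hne hβ p.1 p.2)) ?_
  have : Continuous fun q : EuclideanSpace ℝ (Fin n) × EuclideanSpace ℝ (Fin n) =>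
      ‖(q.1 - β⁻¹ • q.2) - (p.1 - β⁻¹ • p.2)‖ := by fun_prop
  simpa using this.tendsto p

lemma IsSubSolution.inner_le (hX : Convex ℝ X) (hβ : 0 < β) (hx : x ∈ X)
    (hu : IsSubSolution X β x z u) : inner ℝ z (u - x) ≤ -β * ‖u - x‖ ^ 2 := by
  have h := hu.inner_nonneg hX hβ hx
  rw [← neg_sub u x, inner_neg_right, inner_add_left, real_inner_smul_left,
    real_inner_self_eq_norm_sq] at h
  linarith

lemma IsSubSolution.norm_le (hX : Convex ℝ X) (hβ : 0 < β) (hx : x ∈ X)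
    (hu : IsSubSolution X β x z u) : β * ‖u - x‖ ≤ ‖z‖ := by
  have h := hu.inner_le hX hβ hx
  have h2 := neg_le_of_abs_le (abs_real_inner_le_norm z (u - x))
  by_contra! h3
  have h4 : 0 < ‖u - x‖ := by
    by_contra! h5
    have : ‖u - x‖ = 0 := le_antisymm h5 (norm_nonneg _)
    rw [this] at h3
    linarith [norm_nonneg z]
  nlinarith

lemma IsSubSolution.eta_eq (hu : IsSubSolution X β x z u) :
    eta X β x z = subObjective β x z u := by
  refine IsLeast.csInf_eq ⟨⟨u, hu.1, rfl⟩, ?_⟩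
  rintro _ ⟨y, hy, rfl⟩
  exact hu.2 hy

lemma IsSubSolution.eta_nonpos (hx : x ∈ X) (hu : IsSubSolution X β x z u) :
    eta X β x z ≤ 0 := by
  rw [hu.eta_eq]
  have := hu.2 hx
  simpa [subObjective] using this

/-- One-sided smoothness of `η`: test the problem at `(x, z)` with the solution at `(x', z')` and
use strong convexity; completing the square leaves only a term in `z' - z`. -/
lemma IsSubSolution.eta_sub_le (hX : Convex ℝ X) (hβ : 0 < β) (hu : IsSubSolution X β x z u)
    (hu' : IsSubSolution X β x' z' u') :
    eta X β x z - eta X β x' z' ≤ inner ℝ (z + β • (u - x)) (x' - x)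
      - inner ℝ (u - x) (z' - z) + 1 / (2 * β) * ‖z' - z‖ ^ 2 := by
  have h := hu.inner_nonneg hX hβ hu'.1
  have h1 := subObjective_eq_add (β := β) (x := x) (z := z) (u := u) u'
  rw [hu.eta_eq, hu'.eta_eq]
  have h2 : subObjective β x z u ≤ subObjective β x z u' - β / 2 * ‖u' - u‖ ^ 2 := by linarith
  set δ := u' - u with hδ
  set Δ := x' - x with hΔ
  set ζ := z' - z with hζ
  set p := u - x with hp
  have e1 : u' - x = p + δ := by rw [hp, hδ]; abel
  have e2 : u' - x' = p + δ - Δ := by rw [hp, hδ, hΔ]; abel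
  have e3 : z' = z + ζ := by rw [hζ]; abel
  have h3 : subObjective β x z u' - subObjective β x' z' u' - β / 2 * ‖δ‖ ^ 2
      = inner ℝ (z + β • p) Δ - inner ℝ p ζ + 1 / (2 * β) * ‖ζ‖ ^ 2
        - β / 2 * ‖δ - Δ + β⁻¹ • ζ‖ ^ 2 := by
    unfold subObjective
    rw [e1, e2, e3]
    simp only [← real_inner_self_eq_norm_sq, inner_add_left, inner_add_right, inner_sub_left,
      inner_sub_right, real_inner_smul_left, real_inner_smul_right]
    rw [real_inner_comm p δ, real_inner_comm p ζ, real_inner_comm p Δ, real_inner_comm δ Δ,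
      real_inner_comm ζ Δ, real_inner_comm ζ δ]
    field_simp
    ring
  have h4 : 0 ≤ β / 2 * ‖δ - Δ + β⁻¹ • ζ‖ ^ 2 := by positivity
  linarith

/-- Changing the proximal parameter from `β` to `1` changes the length of the step by a factor
between `1` and `β`. -/
lemma IsSubSolution.sq_norm_le (hX : Convex ℝ X) (hβ : 0 < β)
    (hu : IsSubSolution X β x z u) (hu' : IsSubSolution X 1 x z u') :
    ‖u' - x‖ ^ 2 ≤ max 1 (β ^ 2) * ‖u - x‖ ^ 2 := by
  have h1 := hu.inner_nonneg hX hβ hu'.1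
  have h2 := hu'.inner_nonneg hX one_pos hu.1
  have e1 : u' - u = (u' - x) - (u - x) := by abel
  have e2 : u - u' = (u - x) - (u' - x) := by abel
  rw [e1] at h1
  rw [e2] at h2
  set p := u - x
  set q := u' - x
  simp only [inner_add_left, inner_sub_right, real_inner_smul_left,
    real_inner_self_eq_norm_sq] at h1 h2
  rw [real_inner_comm p q] at h2
  have h3 := real_inner_le_norm p q
  have h4 : (‖q‖ - ‖p‖) * (‖q‖ - β * ‖p‖) ≤ 0 := by nlinarith
  have hp := norm_nonneg p
  have hq := norm_nonneg q
  rcases le_total ‖q‖ ‖p‖ with h | h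
  · calc ‖q‖ ^ 2 ≤ 1 * ‖p‖ ^ 2 := by rw [one_mul]; gcongr
      _ ≤ _ := by gcongr; exact le_max_left _ _
  · have h5 : ‖q‖ ≤ β * ‖p‖ ∨ ‖q‖ = ‖p‖ := by
      rcases h.eq_or_lt with h | h
      · exact .inr h.symm
      · left; nlinarith
    rcases h5 with h5 | h5
    · calc ‖q‖ ^ 2 ≤ (β * ‖p‖) ^ 2 := by gcongr
        _ = β ^ 2 * ‖p‖ ^ 2 := by ring
        _ ≤ _ := by gcongr; exact le_max_right _ _
    · calc ‖q‖ ^ 2 = 1 * ‖p‖ ^ 2 := by rw [h5, one_mul]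
        _ ≤ _ := by gcongr; exact le_max_left _ _

end Subproblem

/-! ### Derivatives of compositions -/

section Composition

variable {d : ℕ → ℕ}

/-- The composition `D 0 ∘ D 1 ∘ ⋯ ∘ D (n-1)` of linear maps between the levels. -/
def chain (D : ∀ i, LevelSpace d (i + 1) →L[ℝ] LevelSpace d i) :
    (n : ℕ) → LevelSpace d n →L[ℝ] LevelSpace d 0
  | 0 => .id ℝ _
  | n + 1 => (chain D n).comp (D n)

/-- The gradient matrices along a family of points `w`, that of `f i` being taken at
`w (i + 1)`. -/
def gradFamily (f : ∀ i, LevelSpace d (i + 1) → LevelSpace d i) (w : ∀ i, LevelSpace d i) (i : ℕ) :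
    LevelMatrix d i :=
  gradMatrix (f i) (w (i + 1))

variable {f : ∀ i, LevelSpace d (i + 1) → LevelSpace d i} {Lf Lg : ℕ → ℝ≥0}

lemma eq_sum_smul_single {n : ℕ} (h : EuclideanSpace ℝ (Fin n)) :
    h = ∑ a, h a • EuclideanSpace.single a (1 : ℝ) := by
  ext k
  simp [Pi.single_apply]

lemma matrixProd_gradFamily (w : ∀ i, LevelSpace d i) (n : ℕ) (a : Fin (levelDim d n))
    (c : Fin (levelDim d 0)) :
    matrixProd (gradFamily f w) n a c
      = chain (fun i => fderiv ℝ (f i) (w (i + 1))) n (EuclideanSpace.single a 1) c := by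
  induction n generalizing c with
  | zero => simp [matrixProd, chain, Matrix.one_apply, PiLp.single_apply, eq_comm]
  | succ n ih =>
    simp only [matrixProd, chain, Matrix.mul_apply, ContinuousLinearMap.comp_apply]
    rw [eq_sum_smul_single (fderiv ℝ (f n) (w (n + 1)) (EuclideanSpace.single a 1)), map_sum]
    simp [ih, gradFamily, gradMatrix]

lemma inner_prodVec_gradFamily (w : ∀ i, LevelSpace d i) (n : ℕ) (h : LevelSpace d n) :
    inner ℝ (prodVec (gradFamily f w) n) h
      = chain (fun i => fderiv ℝ (f i) (w (i + 1))) n h (0 : Fin 1) := by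
  have key : ∀ c : Fin (levelDim d 0), ∑ a, h a * matrixProd (gradFamily f w) n a c
      = chain (fun i => fderiv ℝ (f i) (w (i + 1))) n h c := fun c => by
    conv_rhs => rw [eq_sum_smul_single h, map_sum]
    simp [matrixProd_gradFamily]
  exact key _

variable {n : ℕ}

lemma differentiable_composite (hd : ∀ i < n, Differentiable ℝ (f i)) :
    Differentiable ℝ (composite f n) := by
  induction n with
  | zero => exact differentiable_id
  | succ n ih =>
    exact (ih fun i hi => hd i (by omega)).comp (hd n (by omega))

lemma fderiv_composite_succ (hd : ∀ i < n + 1, Differentiable ℝ (f i)) (x : LevelSpace d (n + 1)) :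
    fderiv ℝ (composite f (n + 1)) x
      = (fderiv ℝ (composite f n) (f n x)).comp (fderiv ℝ (f n) x) :=
  fderiv_comp x (differentiable_composite (fun i hi => hd i (by omega)) _) (hd n (by omega) _)

lemma lipschitzWith_composite (hl : ∀ i < n, LipschitzWith (Lf i) (f i)) :
    LipschitzWith (∏ l ∈ Finset.range n, Lf l) (composite f n) := by
  induction n with
  | zero =>
    rw [Finset.prod_range_zero]
    exact LipschitzWith.id
  | succ n ih =>
    rw [Finset.prod_range_succ]
    exact (ih fun i hi => hl i (by omega)).comp (hl n (by omega))

lemma norm_chain_le {D : ∀ i, LevelSpace d (i + 1) →L[ℝ] LevelSpace d i}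
    (hD : ∀ i < n, ‖D i‖ ≤ Lf i) : ‖chain D n‖ ≤ ∏ l ∈ Finset.range n, (Lf l : ℝ) := by
  induction n with
  | zero => simpa [chain] using ContinuousLinearMap.norm_id_le
  | succ n ih =>
    rw [Finset.prod_range_succ]
    refine (ContinuousLinearMap.opNorm_comp_le _ _).trans ?_
    have := ih fun i hi => hD i (by omega)
    have := hD n (by omega)
    gcongr

lemma lipGradF_succ : lipGradF (n + 1) Lf Lg
    = lipGradF n Lf Lg * Lf n ^ 2 + Lg n * ∏ l ∈ Finset.range n, Lf l := by
  unfold lipGradF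
  rw [Finset.sum_range_succ, Finset.sum_mul]
  congr 1
  · refine Finset.sum_congr rfl fun j hj => ?_
    rw [Finset.prod_Ico_succ_top (by simp at hj; omega)]
    ring
  · simp

/-- The derivative of the composition is Lipschitz with constant `L_{∇F}`. -/
lemma norm_fderiv_composite_sub_le (hd : ∀ i < n, Differentiable ℝ (f i))
    (hl : ∀ i < n, LipschitzWith (Lf i) (f i)) (hg : ∀ i < n, LipschitzWith (Lg i) (fderiv ℝ (f i)))
    (x y : LevelSpace d n) :
    ‖fderiv ℝ (composite f n) x - fderiv ℝ (composite f n) y‖ ≤ lipGradF n Lf Lg * ‖x - y‖ := by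
  induction n with
  | zero =>
    have e : composite f 0 = id := rfl
    simp [e, lipGradF]
  | succ n ih =>
    have ih := ih (fun i hi => hd i (by omega)) (fun i hi => hl i (by omega))
      (fun i hi => hg i (by omega)) (f n x) (f n y)
    rw [fderiv_composite_succ hd, fderiv_composite_succ hd]
    set A := fderiv ℝ (composite f n) (f n x)
    set A' := fderiv ℝ (composite f n) (f n y) with hA'
    set B := fderiv ℝ (f n) x with hB
    set B' := fderiv ℝ (f n) y
    have e : A.comp B - A'.comp B' = (A - A').comp B + A'.comp (B - B') := by
      ext v; simp
    have h1 : ‖f n x - f n y‖ ≤ Lf n * ‖x - y‖ := (hl n (by omega)).norm_sub_le x y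
    have h2 : ‖B - B'‖ ≤ Lg n * ‖x - y‖ := (hg n (by omega)).norm_sub_le x y
    have h3 : ‖B‖ ≤ Lf n := norm_fderiv_le_of_lipschitz ℝ (hl n (by omega))
    have h4 : ‖A'‖ ≤ (∏ l ∈ Finset.range n, Lf l : ℝ≥0) :=
      norm_fderiv_le_of_lipschitz ℝ (lipschitzWith_composite fun i hi => hl i (by omega))
    rw [e]
    calc _ ≤ ‖A - A'‖ * ‖B‖ + ‖A'‖ * ‖B - B'‖ :=
          (norm_add_le _ _).trans (add_le_add (ContinuousLinearMap.opNorm_comp_le _ _)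
            (ContinuousLinearMap.opNorm_comp_le _ _))
      _ ≤ lipGradF n Lf Lg * (Lf n * ‖x - y‖) * Lf n
          + (∏ l ∈ Finset.range n, Lf l : ℝ≥0) * (Lg n * ‖x - y‖) := by
          gcongr
          exact ih.trans (by gcongr)
      _ = _ := by rw [lipGradF_succ]; push_cast; ring

/-- The error made by differentiating the levels at the tracking points `w` instead of the true
inner values: every tracking error `f j (w (j + 1)) - w j` is damped or amplified by the levels
around it. -/
lemma norm_fderiv_composite_sub_chain_le (hd : ∀ i < n, Differentiable ℝ (f i))
    (hl : ∀ i < n, LipschitzWith (Lf i) (f i)) (hg : ∀ i < n, LipschitzWith (Lg i) (fderiv ℝ (f i)))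
    (w : ∀ i, LevelSpace d i) (x : LevelSpace d n) :
    ‖fderiv ℝ (composite f n) x - chain (fun i => fderiv ℝ (f i) (w (i + 1))) n‖
      ≤ lipGradF n Lf Lg * ‖x - w n‖
        + ∑ j ∈ Finset.range n, (lipGradF j Lf Lg * ∏ l ∈ Finset.Ico j n, (Lf l : ℝ))
          * ‖f j (w (j + 1)) - w j‖ := by
  induction n with
  | zero =>
    have e : composite f 0 = id := rfl
    simp [e, lipGradF, chain]
  | succ n ih =>
    have ih := ih (fun i hi => hd i (by omega)) (fun i hi => hl i (by omega))
      (fun i hi => hg i (by omega)) (f n x)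
    rw [fderiv_composite_succ hd, chain]
    set A := fderiv ℝ (composite f n) (f n x)
    set D := fun i => fderiv ℝ (f i) (w (i + 1)) with hD
    set B := fderiv ℝ (f n) x with hB
    have e : A.comp B - (chain D n).comp (D n) = (A - chain D n).comp B
        + (chain D n).comp (B - D n) := by
      ext v; simp
    have h1 : ‖f n x - w n‖ ≤ Lf n * ‖x - w (n + 1)‖ + ‖f n (w (n + 1)) - w n‖ := by
      rw [← sub_add_sub_cancel (f n x) (f n (w (n + 1))) (w n)]
      exact (norm_add_le _ _).trans (by gcongr; exact (hl n (by omega)).norm_sub_le _ _)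
    have h2 : ‖B - D n‖ ≤ Lg n * ‖x - w (n + 1)‖ := (hg n (by omega)).norm_sub_le _ _
    have h3 : ‖B‖ ≤ Lf n := norm_fderiv_le_of_lipschitz ℝ (hl n (by omega))
    have h4 : ‖chain D n‖ ≤ ∏ l ∈ Finset.range n, (Lf l : ℝ) :=
      norm_chain_le fun i hi => norm_fderiv_le_of_lipschitz ℝ (hl i (by omega))
    set S := ∑ j ∈ Finset.range n, (lipGradF j Lf Lg * ∏ l ∈ Finset.Ico j n, (Lf l : ℝ))
          * ‖f j (w (j + 1)) - w j‖ with hS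
    have hS' : ∑ j ∈ Finset.range n, (lipGradF j Lf Lg * ∏ l ∈ Finset.Ico j (n + 1), (Lf l : ℝ))
          * ‖f j (w (j + 1)) - w j‖ = S * Lf n := by
      rw [hS, Finset.sum_mul]
      refine Finset.sum_congr rfl fun j hj => ?_
      rw [Finset.prod_Ico_succ_top (by simp at hj; omega)]
      ring
    rw [e, Finset.sum_range_succ, hS', Nat.Ico_succ_singleton, Finset.prod_singleton]
    calc _ ≤ ‖A - chain D n‖ * ‖B‖ + ‖chain D n‖ * ‖B - D n‖ :=
          (norm_add_le _ _).trans (add_le_add (ContinuousLinearMap.opNorm_comp_le _ _)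
            (ContinuousLinearMap.opNorm_comp_le _ _))
      _ ≤ (lipGradF n Lf Lg * (Lf n * ‖x - w (n + 1)‖ + ‖f n (w (n + 1)) - w n‖) + S) * Lf n
          + (∏ l ∈ Finset.range n, (Lf l : ℝ)) * (Lg n * ‖x - w (n + 1)‖) := by
          gcongr
          exact ih.trans (by gcongr)
      _ = _ := by rw [lipGradF_succ]; push_cast; ring

lemma constC_eq {T j : ℕ} (hj : j < T) :
    constC T Lf Lg j = lipGradF j Lf Lg * ∏ l ∈ Finset.Ico j T, Lf l := by
  unfold constC lipGradF constR
  rw [Finset.sum_mul]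
  refine Finset.sum_congr rfl fun r hr => ?_
  rw [Finset.mem_range] at hr
  have e1 : (Finset.range T).erase r
      = Finset.range r ∪ (Finset.Ico (r + 1) j ∪ Finset.Ico j T) := by
    ext k; simp only [Finset.mem_erase, Finset.mem_range, Finset.mem_union, Finset.mem_Ico]; omega
  have e2 : Finset.Ioo r j = Finset.Ico (r + 1) j := by
    ext k; simp only [Finset.mem_Ioo, Finset.mem_Ico]; omega
  rw [e1, e2, Finset.prod_union, Finset.prod_union, Finset.prod_pow]
  · ring
  · rw [Finset.disjoint_left]; intro k; simp only [Finset.mem_Ico]; omega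
  · rw [Finset.disjoint_left]; intro k
    simp only [Finset.mem_union, Finset.mem_range, Finset.mem_Ico]; omega

/-- A vector representing the `0`-th coordinate of a linear map is at most as long as the map. -/
lemma norm_le_of_inner_eq {V : Type*} [NormedAddCommGroup V] [InnerProductSpace ℝ V] {v : V}
    {A : V →L[ℝ] LevelSpace d 0} (h : ∀ y, inner ℝ v y = A y (0 : Fin 1)) : ‖v‖ ≤ ‖A‖ := by
  have h1 : ‖v‖ * ‖v‖ ≤ ‖A‖ * ‖v‖ := by
    rw [← real_inner_self_eq_norm_mul_norm, h]
    exact (le_abs_self _).trans ((PiLp.norm_apply_le (A v) _).trans (A.le_opNorm v))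
  by_contra! h2
  nlinarith [norm_nonneg A]

lemma inner_gradient_objective (hd : ∀ i < n, Differentiable ℝ (f i)) (x h : LevelSpace d n) :
    inner ℝ (gradient (objective f n) x) h = fderiv ℝ (composite f n) x h (0 : Fin 1) := by
  let π : LevelSpace d 0 →L[ℝ] ℝ := EuclideanSpace.proj (𝕜 := ℝ) (0 : Fin 1)
  have e : HasFDerivAt (objective f n) (π.comp (fderiv ℝ (composite f n) x)) x :=
    π.hasFDerivAt.comp x (differentiable_composite hd x).hasFDerivAt
  rw [gradient, InnerProductSpace.toDual_symm_apply, e.fderiv]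
  rfl

lemma differentiable_objective (hd : ∀ i < n, Differentiable ℝ (f i)) :
    Differentiable ℝ (objective f n) :=
  (EuclideanSpace.proj (𝕜 := ℝ) (0 : Fin 1) : LevelSpace d 0 →L[ℝ] ℝ).differentiable.comp
    (differentiable_composite hd)

lemma norm_objective_sub_le (hl : ∀ i < n, LipschitzWith (Lf i) (f i)) (x y : LevelSpace d n) :
    |objective f n x - objective f n y| ≤ (∏ l ∈ Finset.range n, Lf l : ℝ≥0) * ‖x - y‖ :=
  (PiLp.norm_apply_le (composite f n x - composite f n y) (0 : Fin 1)).trans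
    ((lipschitzWith_composite hl).norm_sub_le x y)

lemma norm_gradient_objective_sub_le (hd : ∀ i < n, Differentiable ℝ (f i))
    (hl : ∀ i < n, LipschitzWith (Lf i) (f i)) (hg : ∀ i < n, LipschitzWith (Lg i) (fderiv ℝ (f i)))
    (x y : LevelSpace d n) :
    ‖gradient (objective f n) x - gradient (objective f n) y‖ ≤ lipGradF n Lf Lg * ‖x - y‖ := by
  refine (norm_le_of_inner_eq (A := fderiv ℝ (composite f n) x - fderiv ℝ (composite f n) y)
    fun h => ?_).trans (norm_fderiv_composite_sub_le hd hl hg x y)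
  rw [inner_sub_left, inner_gradient_objective hd, inner_gradient_objective hd]
  rfl

lemma norm_prodVec_gradFamily_le (hl : ∀ i < n, LipschitzWith (Lf i) (f i))
    (w : ∀ i, LevelSpace d i) :
    ‖prodVec (gradFamily f w) n‖ ≤ ∏ l ∈ Finset.range n, (Lf l : ℝ) :=
  (norm_le_of_inner_eq (inner_prodVec_gradFamily w n)).trans
    (norm_chain_le fun i hi => norm_fderiv_le_of_lipschitz ℝ (hl i hi))

/-- The bias of the product of the gradient matrices as an estimate of the gradient of the
objective. -/
lemma norm_gradient_sub_prodVec_le (hd : ∀ i < n, Differentiable ℝ (f i))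
    (hl : ∀ i < n, LipschitzWith (Lf i) (f i)) (hg : ∀ i < n, LipschitzWith (Lg i) (fderiv ℝ (f i)))
    (w : ∀ i, LevelSpace d i) :
    ‖gradient (objective f n) (w n) - prodVec (gradFamily f w) n‖
      ≤ ∑ j ∈ Finset.Ico 1 n, constC n Lf Lg j * ‖f j (w (j + 1)) - w j‖ := by
  refine (norm_le_of_inner_eq (A := fderiv ℝ (composite f n) (w n)
    - chain (fun i => fderiv ℝ (f i) (w (i + 1))) n) fun h => ?_).trans
    ((norm_fderiv_composite_sub_chain_le hd hl hg w (w n)).trans_eq ?_)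
  · rw [inner_sub_left, inner_gradient_objective hd, inner_prodVec_gradFamily]
    rfl
  · rw [sub_self, norm_zero, mul_zero, zero_add]
    rcases Nat.eq_zero_or_pos n with rfl | hn
    · simp
    have e : Finset.range n = Finset.Ico 0 n := by rw [Finset.range_eq_Ico]
    rw [e, Finset.sum_eq_sum_Ico_succ_bot hn]
    simp only [lipGradF, Finset.range_zero, Finset.sum_empty, NNReal.coe_zero, zero_mul, zero_add]
    refine Finset.sum_congr rfl fun j hj => ?_
    rw [constC_eq (Finset.mem_Ico.1 hj).2, lipGradF]
    push_cast
    rfl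

lemma continuous_gradMatrix {m n : ℕ} {g : EuclideanSpace ℝ (Fin m) → EuclideanSpace ℝ (Fin n)}
    {K : ℝ≥0} (hg : LipschitzWith K (fderiv ℝ g)) (a : Fin m) (b : Fin n) :
    Continuous fun y => gradMatrix g y a b := by
  have := hg.continuous
  unfold gradMatrix
  fun_prop

/-- The descent lemma for a function with Lipschitz gradient. -/
lemma descent_lemma {V : Type*} [NormedAddCommGroup V] [InnerProductSpace ℝ V] [CompleteSpace V]
    {F : V → ℝ} {K : ℝ} (hF : Differentiable ℝ F)
    (hK : ∀ x y, ‖gradient F x - gradient F y‖ ≤ K * ‖x - y‖) (x h : V) :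
    F (x + h) ≤ F x + inner ℝ (gradient F x) h + K / 2 * ‖h‖ ^ 2 := by
  let g : ℝ → ℝ := fun t => F (x + t • h) - t * inner ℝ (gradient F x) h - K / 2 * ‖h‖ ^ 2 * t ^ 2
  have hline : ∀ t : ℝ, HasDerivAt (fun t : ℝ => x + t • h) h t := fun t => by
    simpa using ((hasDerivAt_id t).smul_const h).const_add x
  have hg : ∀ t, HasDerivAt g (inner ℝ (gradient F (x + t • h)) h - inner ℝ (gradient F x) h
      - K * ‖h‖ ^ 2 * t) t := fun t => by
    have h1 : HasDerivAt (fun t : ℝ => F (x + t • h)) (inner ℝ (gradient F (x + t • h)) h) t := by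
      have := (hF (x + t • h)).hasFDerivAt.comp_hasDerivAt t (hline t)
      rwa [gradient, InnerProductSpace.toDual_symm_apply]
    have h2 : HasDerivAt (fun t : ℝ => t * inner ℝ (gradient F x) h)
        (inner ℝ (gradient F x) h) t := by
      simpa using (hasDerivAt_id t).mul_const (inner ℝ (gradient F x) h)
    have h3 : HasDerivAt (fun t : ℝ => K / 2 * ‖h‖ ^ 2 * t ^ 2) (K * ‖h‖ ^ 2 * t) t := by
      refine ((hasDerivAt_pow 2 t).const_mul (K / 2 * ‖h‖ ^ 2)).congr_deriv ?_
      push_cast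
      ring
    exact (h1.sub h2).sub h3
  have hanti : AntitoneOn g (Set.Icc 0 1) := by
    refine antitoneOn_of_deriv_nonpos (convex_Icc 0 1)
      (fun t _ => (hg t).continuousAt.continuousWithinAt)
      (fun t _ => (hg t).differentiableAt.differentiableWithinAt) fun t ht => ?_
    rw [interior_Icc] at ht
    rw [(hg t).deriv, ← inner_sub_left]
    have h1 := real_inner_le_norm (gradient F (x + t • h) - gradient F x) h
    have h2 := hK (x + t • h) x
    rw [add_sub_cancel_left, norm_smul, Real.norm_of_nonneg ht.1.le] at h2
    nlinarith [mul_le_mul_of_nonneg_right h2 (norm_nonneg h)]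
  have := hanti (Set.left_mem_Icc.2 zero_le_one) (Set.right_mem_Icc.2 zero_le_one) zero_le_one
  simp only [g, one_smul, zero_smul, add_zero] at this
  linarith

end Composition

/-! ### The Frobenius norm of products -/

lemma frobSq_nonneg {m n : ℕ} (A : Matrix (Fin m) (Fin n) ℝ) : 0 ≤ frobSq A :=
  Finset.sum_nonneg fun _ _ => Finset.sum_nonneg fun _ _ => sq_nonneg _

lemma sq_apply_le_frobSq {m n : ℕ} (A : Matrix (Fin m) (Fin n) ℝ) (a : Fin m) (b : Fin n) :
    A a b ^ 2 ≤ frobSq A :=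
  (Finset.single_le_sum (f := fun b => A a b ^ 2) (fun _ _ => sq_nonneg _)
    (Finset.mem_univ b)).trans (Finset.single_le_sum (f := fun a => ∑ b, A a b ^ 2)
      (fun _ _ => Finset.sum_nonneg fun _ _ => sq_nonneg _) (Finset.mem_univ a))

/-- The Frobenius norm is submultiplicative, by the Cauchy-Schwarz inequality. -/
lemma frobSq_mul_le {l m n : ℕ} (A : Matrix (Fin l) (Fin m) ℝ) (B : Matrix (Fin m) (Fin n) ℝ) :
    frobSq (A * B) ≤ frobSq A * frobSq B := by
  calc frobSq (A * B) ≤ ∑ a, ∑ c, (∑ e, A a e ^ 2) * ∑ e, B e c ^ 2 := by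
        refine Finset.sum_le_sum fun a _ => Finset.sum_le_sum fun c _ => ?_
        rw [Matrix.mul_apply]
        exact Finset.sum_mul_sq_le_sq_mul_sq _ _ _
    _ = frobSq A * frobSq B := by
        unfold frobSq
        rw [Finset.sum_comm (s := Finset.univ) (t := Finset.univ) (f := fun e c => B e c ^ 2),
          Finset.sum_mul_sum]

lemma sq_norm_prodVec {d : ℕ → ℕ} (M : ∀ i, LevelMatrix d i) (T : ℕ) :
    ‖prodVec M T‖ ^ 2 = frobSq (matrixProd M T) := by
  rw [EuclideanSpace.norm_sq_eq]
  have key : ∀ n (c : Fin n), n = 1 → ∀ A : Matrix (Fin (levelDim d T)) (Fin n) ℝ,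
      ∑ a, ‖A a c‖ ^ 2 = frobSq A := by
    rintro n c rfl A
    simp [frobSq, Subsingleton.elim c 0]
  exact key _ _ rfl _

lemma frobSq_matrixProd_zero {d : ℕ → ℕ} (M : ∀ i, LevelMatrix d i) :
    frobSq (matrixProd M 0) = 1 := by
  have key : ∀ n, n = 1 → frobSq (1 : Matrix (Fin n) (Fin n) ℝ) = 1 := by
    rintro n rfl
    simp [frobSq]
  exact key _ rfl

/-! ### Conditional independence -/

lemma integrable_inner_of_memLp {Ω V : Type*} {mΩ : MeasurableSpace Ω} {μ : Measure Ω}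
    [NormedAddCommGroup V] [InnerProductSpace ℝ V]
    {v Y : Ω → V} (hv : MemLp v 2 μ) (hY : MemLp Y 2 μ) :
    Integrable (fun ω => inner ℝ (v ω) (Y ω)) μ := by
  refine Integrable.mono' (hv.norm.integrable_mul hY.norm) (hv.1.inner hY.1)
    (.of_forall fun ω => ?_)
  exact norm_inner_le_norm _ _

section CondIndep

variable {Ω : Type*} {m mΩ : MeasurableSpace Ω} {μ : Measure Ω} [IsProbabilityMeasure μ]

/-- Extends the product rule for the events `Y ∈ A` and `C` from indicators to integrable functions
of `Y`: both sides are integrals of `φ` against the law of `Y` under a finite measure, and the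
product rule says that the two laws coincide. -/
lemma setIntegral_inter_comp_eq_condExp {E V : Type*} [MeasurableSpace E]
    [NormedAddCommGroup V] [NormedSpace ℝ V] [CompleteSpace V] (hm : m ≤ mΩ)
    {Y : Ω → E} (hY : Measurable Y) {φ : E → V} (hφ : StronglyMeasurable φ)
    (hint : Integrable (fun ω => φ (Y ω)) μ) {C : Set Ω} (hC : MeasurableSet C)
    (hYC : ∀ A : Set E, MeasurableSet A →
      μ⟦Y ⁻¹' A ∩ C | m⟧ =ᵐ[μ] μ⟦Y ⁻¹' A | m⟧ * μ⟦C | m⟧)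
    {H : Set Ω} (hH : MeasurableSet[m] H) :
    ∫ ω in H ∩ C, φ (Y ω) ∂μ = ∫ ω in H ∩ C, (μ[fun ω => φ (Y ω) | m]) ω ∂μ := by
  have hH' : MeasurableSet H := hm _ hH
  set p : Ω → ℝ := μ⟦C | m⟧ with hp
  have hpm : StronglyMeasurable[m] p := stronglyMeasurable_condExp
  have hpm' : Measurable p := (hpm.mono hm).measurable
  have hCi : Integrable (C.indicator fun _ => (1 : ℝ)) μ := (integrable_const 1).indicator hC
  have hp0 : 0 ≤ᵐ[μ] p :=
    condExp_nonneg (.of_forall fun ω => Set.indicator_nonneg (fun _ _ => zero_le_one) ω)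
  have hp1 : p ≤ᵐ[μ] fun _ => 1 := by
    have := condExp_mono (m := m) hCi (integrable_const (1 : ℝ))
      (.of_forall fun ω => Set.indicator_le_self' (fun _ _ => zero_le_one) ω)
    rwa [condExp_const hm] at this
  have hpb : ∀ᵐ ω ∂μ, ‖p ω‖ ≤ 1 := by
    filter_upwards [hp0, hp1] with ω h0 h1
    rw [Real.norm_of_nonneg h0]; exact h1
  have hpsm : AEStronglyMeasurable p μ := hpm'.aestronglyMeasurable
  have hlaw : Measure.map Y (μ.restrict (H ∩ C))
      = Measure.map Y ((μ.restrict H).withDensity fun ω => ENNReal.ofReal (p ω)) := by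
    ext A hA
    have hYA : MeasurableSet (Y ⁻¹' A) := hY hA
    rw [Measure.map_apply hY hA, Measure.map_apply hY hA, withDensity_apply _ hYA,
      Measure.restrict_apply hYA, Measure.restrict_restrict hYA]
    have hi : Integrable ((Y ⁻¹' A).indicator (fun _ => (1 : ℝ))) μ :=
      (integrable_const 1).indicator hYA
    have hpi : Integrable p μ := integrable_condExp
    have hind : ((Y ⁻¹' A).indicator fun _ => (1 : ℝ)) * p = (Y ⁻¹' A).indicator p := by
      ext ω; by_cases h : ω ∈ Y ⁻¹' A <;> simp [h]
    have hmul : Integrable (((Y ⁻¹' A).indicator fun _ => (1 : ℝ)) * p) μ := by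
      rw [hind]; exact hpi.indicator hYA
    have e1 : ∫ ω in Y ⁻¹' A ∩ H, p ω ∂μ = μ.real (Y ⁻¹' A ∩ (H ∩ C)) := by
      calc ∫ ω in Y ⁻¹' A ∩ H, p ω ∂μ
          = ∫ ω in H, (((Y ⁻¹' A).indicator fun _ => (1 : ℝ)) * p) ω ∂μ := by
            rw [hind, setIntegral_indicator hYA, Set.inter_comm]
        _ = ∫ ω in H, (μ[((Y ⁻¹' A).indicator fun _ => (1 : ℝ)) * p | m]) ω ∂μ :=
            (setIntegral_condExp hm hmul hH).symm
        _ = ∫ ω in H, (μ⟦Y ⁻¹' A ∩ C | m⟧) ω ∂μ := by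
            refine integral_congr_ae (ae_restrict_of_ae ?_)
            exact (condExp_mul_of_stronglyMeasurable_right hpm hmul hi).trans (hYC A hA).symm
        _ = ∫ ω in H, ((Y ⁻¹' A ∩ C).indicator fun _ => (1 : ℝ)) ω ∂μ :=
            setIntegral_condExp hm ((integrable_const 1).indicator (hYA.inter hC)) hH
        _ = μ.real (Y ⁻¹' A ∩ (H ∩ C)) := by
            rw [setIntegral_indicator (hYA.inter hC), setIntegral_const, smul_eq_mul, mul_one]
            congr 1
            ext ω; simp only [Set.mem_inter_iff]; tauto
    rw [← ofReal_integral_eq_lintegral_ofReal hpi.integrableOn (ae_restrict_of_ae hp0), e1]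
    exact (ofReal_measureReal).symm
  have hpφ : Integrable (p • fun ω => φ (Y ω)) μ := by
    exact hint.bdd_smul 1 hpsm hpb
  have hce : Integrable (μ[fun ω => φ (Y ω) | m]) μ := integrable_condExp
  have hCe : (C.indicator fun _ => (1 : ℝ)) • (μ[fun ω => φ (Y ω) | m])
      = C.indicator (μ[fun ω => φ (Y ω) | m]) := by
    ext ω; by_cases h : ω ∈ C <;> simp [h]
  have hCei : Integrable ((C.indicator fun _ => (1 : ℝ)) • (μ[fun ω => φ (Y ω) | m])) μ := by
    rw [hCe]; exact hce.indicator hC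
  calc ∫ ω in H ∩ C, φ (Y ω) ∂μ
      = ∫ y, φ y ∂(Measure.map Y (μ.restrict (H ∩ C))) :=
        (integral_map hY.aemeasurable hφ.aestronglyMeasurable).symm
    _ = ∫ ω, φ (Y ω) ∂((μ.restrict H).withDensity fun ω => ENNReal.ofReal (p ω)) := by
        rw [hlaw, integral_map hY.aemeasurable hφ.aestronglyMeasurable]
    _ = ∫ ω in H, (p • fun ω => φ (Y ω)) ω ∂μ := by
        rw [integral_withDensity_eq_integral_toReal_smul hpm'.ennreal_ofReal
          (.of_forall fun _ => ENNReal.ofReal_lt_top)]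
        refine integral_congr_ae (ae_restrict_of_ae ?_)
        filter_upwards [hp0] with ω h0
        simp [ENNReal.toReal_ofReal h0]
    _ = ∫ ω in H, (μ[p • fun ω => φ (Y ω) | m]) ω ∂μ := (setIntegral_condExp hm hpφ hH).symm
    _ = ∫ ω in H, (μ[(C.indicator fun _ => (1 : ℝ)) • (μ[fun ω => φ (Y ω) | m]) | m]) ω ∂μ := by
        refine integral_congr_ae (ae_restrict_of_ae ?_)
        exact (condExp_smul_of_aestronglyMeasurable_left hpm.aestronglyMeasurable hpφ hint).trans
          (condExp_smul_of_aestronglyMeasurable_right hCi hCei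
            stronglyMeasurable_condExp.aestronglyMeasurable).symm
    _ = ∫ ω in H, C.indicator (μ[fun ω => φ (Y ω) | m]) ω ∂μ := by
        rw [setIntegral_condExp hm hCei hH, hCe]
    _ = ∫ ω in H ∩ C, (μ[fun ω => φ (Y ω) | m]) ω ∂μ := setIntegral_indicator hC

/-- If the `Y j` are independent given `m`, then the members of the family other than `Y i` carry
no further information on `Y i`. -/
lemma CondIndepFamily.condExp_sup {ι V : Type*} {E : ι → Type*} [∀ i, MeasurableSpace (E i)]
    [NormedAddCommGroup V] [NormedSpace ℝ V] [CompleteSpace V] (hm : m ≤ mΩ)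
    {Y : ∀ i, Ω → E i} (hY : ∀ i, Measurable (Y i)) (hind : CondIndepFamily m μ Y)
    (i : ι) {φ : E i → V} (hφ : StronglyMeasurable φ)
    (hint : Integrable (fun ω => φ (Y i ω)) μ) :
    μ[fun ω => φ (Y i ω) | m ⊔ ⨆ j ∈ {j | j ≠ i}, MeasurableSpace.comap (Y j) inferInstance]
      =ᵐ[μ] μ[fun ω => φ (Y i ω) | m] := by
  classical
  set 𝒢 := m ⊔ ⨆ j ∈ {j | j ≠ i}, MeasurableSpace.comap (Y j) inferInstance with h𝒢
  have hm𝒢 : m ≤ 𝒢 := le_sup_left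
  have hle : 𝒢 ≤ mΩ := sup_le hm (iSup₂_le fun j _ => (hY j).comap_le)
  -- The events of `m` and of the `σ(Y j)` form one family, indexed by `Option ι`.
  let mm : Option ι → MeasurableSpace Ω := fun o =>
    o.elim m fun j => MeasurableSpace.comap (Y j) inferInstance
  let S : Set (Option ι) := insert none (some '' {j | j ≠ i})
  have hS : 𝒢 = ⨆ o ∈ S, mm o := by
    simp only [S, iSup_insert, iSup_image, mm, Option.elim, h𝒢]
  refine (ae_eq_condExp_of_forall_setIntegral_eq hle hint
    (fun s _ _ => integrable_condExp.integrableOn) (fun s hs hμs => ?_)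
    (stronglyMeasurable_condExp.mono hm𝒢).aestronglyMeasurable).symm
  have hce : Integrable (μ[fun ω => φ (Y i ω) | m]) μ := integrable_condExp
  clear hμs
  symm
  induction s, hs using MeasurableSpace.induction_on_inter
    (hS.trans (generateFrom_piiUnionInter_measurableSet mm S).symm)
    (isPiSystem_piiUnionInter _ (fun o => @MeasurableSpace.isPiSystem_measurableSet Ω (mm o)) S) with
  | empty => simp
  | basic s hs =>
    obtain ⟨t, htS, g, hg, rfl⟩ := hs
    -- Split off the event of `m`; the others have the form `Y j ∈ B j` with `j ≠ i`.
    let H : Set Ω := if none ∈ t then g none else Set.univ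
    have hH : MeasurableSet[m] H := by
      by_cases h : none ∈ t
      · simpa only [H, h, if_true] using show MeasurableSet[m] (g none) from hg none h
      · simp [H, h]
    have hB : ∀ j, ∃ B : Set (E j), MeasurableSet B ∧ (some j ∈ t → Y j ⁻¹' B = g (some j)) := by
      intro j
      by_cases h : some j ∈ t
      · obtain ⟨B, hB, hBe⟩ := hg (some j) h
        exact ⟨B, hB, fun _ => hBe⟩
      · exact ⟨∅, .empty, fun h' => absurd h' h⟩
    choose B hBm hBe using hB
    let t' := Finset.eraseNone t
    have hit : i ∉ t' := by
      intro h
      rw [Finset.mem_eraseNone] at h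
      simpa [S] using htS h
    have hset : ⋂ x ∈ t, g x = H ∩ ⋂ j ∈ t', Y j ⁻¹' B j := by
      ext ω
      simp only [Set.mem_iInter, Set.mem_inter_iff, t', Finset.mem_eraseNone]
      constructor
      · intro h
        refine ⟨?_, fun j hj => by rw [hBe j hj]; exact h _ hj⟩
        by_cases hn : none ∈ t
        · simpa [H, hn] using h none hn
        · simp [H, hn]
      · rintro ⟨h1, h2⟩ (_ | j) hj
        · simpa [H, hj] using h1
        · rw [← hBe j hj]; exact h2 j hj
    rw [hset]
    refine setIntegral_inter_comp_eq_condExp hm (hY i) hφ hint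
      (Finset.measurableSet_biInter _ fun j _ => hY j (hBm j)) (fun A hA => ?_) hH
    have hBu : ∀ j ∈ t', Function.update B i A j = B j := fun j hj =>
      Function.update_of_ne (fun h => hit (by rwa [← h])) _ _
    have h1 := hind (insert i t') (Function.update B i A) (fun j _ => by
      by_cases h : j = i
      · subst h; simpa using hA
      · rw [Function.update_of_ne h]; exact hBm j)
    have h2 := hind t' B (fun j _ => hBm j)
    rw [Finset.set_biInter_insert, Finset.prod_insert hit, Function.update_self] at h1
    have e1 : ⋂ j ∈ t', Y j ⁻¹' Function.update B i A j = ⋂ j ∈ t', Y j ⁻¹' B j :=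
      Set.iInter₂_congr fun j hj => by rw [hBu j hj]
    have e2 : ∏ j ∈ t', μ⟦Y j ⁻¹' Function.update B i A j | m⟧ = ∏ j ∈ t', μ⟦Y j ⁻¹' B j | m⟧ :=
      Finset.prod_congr rfl fun j hj => by rw [hBu j hj]
    rw [e1, e2] at h1
    filter_upwards [h1, h2] with ω h1 h2
    rw [h1, Pi.mul_apply, Pi.mul_apply, h2]
  | compl s hs ih =>
    have e1 := integral_add_compl (hle s hs) hint
    have e2 := integral_add_compl (hle s hs) hce
    rw [integral_condExp hm] at e2
    rw [← e2, ih] at e1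
    exact add_left_cancel e1
  | iUnion s hd hs ih =>
    rw [integral_iUnion (fun n => hle _ (hs n)) hd hint.integrableOn,
      integral_iUnion (fun n => hle _ (hs n)) hd hce.integrableOn]
    exact tsum_congr ih

/-- Pull-out property of nonnegative functions: no integrability of the product is needed. -/
lemma lintegral_mul_ofReal_condExp (hm : m ≤ mΩ) {Y : Ω → ℝ}
    (hY : Integrable Y μ) (hY0 : 0 ≤ Y) {g : Ω → ENNReal} (hg : Measurable[m] g) :
    ∫⁻ ω, g ω * ENNReal.ofReal (Y ω) ∂μ
      = ∫⁻ ω, g ω * ENNReal.ofReal ((μ[Y | m]) ω) ∂μ := by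
  have hc0 : 0 ≤ᵐ[μ] μ[Y | m] := condExp_nonneg (.of_forall hY0)
  have hlaw : (μ.withDensity fun ω => ENNReal.ofReal (Y ω)).trim hm
      = (μ.withDensity fun ω => ENNReal.ofReal ((μ[Y | m]) ω)).trim hm := by
    refine @Measure.ext _ m _ _ fun s hs => ?_
    rw [trim_measurableSet_eq hm hs, trim_measurableSet_eq hm hs, withDensity_apply _ (hm _ hs),
      withDensity_apply _ (hm _ hs),
      ← ofReal_integral_eq_lintegral_ofReal hY.integrableOn (.of_forall hY0),
      ← ofReal_integral_eq_lintegral_ofReal integrable_condExp.integrableOn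
        (ae_restrict_of_ae hc0), setIntegral_condExp hm hY hs]
  have hg' : Measurable g := hg.mono hm le_rfl
  have key : ∀ Z : Ω → ℝ, AEMeasurable Z μ → ∫⁻ ω, g ω * ENNReal.ofReal (Z ω) ∂μ
      = ∫⁻ ω, g ω ∂((μ.withDensity fun ω => ENNReal.ofReal (Z ω)).trim hm) := fun Z hZ => by
    rw [lintegral_trim hm hg, lintegral_withDensity_eq_lintegral_mul₀ hZ.ennreal_ofReal
      hg'.aemeasurable]
    simp [mul_comm]
  rw [key Y hY.aemeasurable, key _ integrable_condExp.aemeasurable, hlaw]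

/-- A centered square-integrable vector is orthogonal to everything known beforehand. -/
lemma integral_inner_eq_zero_of_condExp (hm : m ≤ mΩ) {V : Type*}
    [NormedAddCommGroup V] [InnerProductSpace ℝ V] [CompleteSpace V] {v Y : Ω → V}
    (hvm : StronglyMeasurable[m] v) (hv : MemLp v 2 μ) (hY : MemLp Y 2 μ)
    (h0 : μ[Y | m] =ᵐ[μ] 0) : ∫ ω, inner ℝ (v ω) (Y ω) ∂μ = 0 := by
  have hi : Integrable (fun ω => innerSL ℝ (v ω) (Y ω)) μ := by
    simpa using integrable_inner_of_memLp hv hY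
  have h := condExp_bilin_of_stronglyMeasurable_left (innerSL ℝ) hvm hi
    (hY.integrable (by norm_num))
  have e : ∫ ω, inner ℝ (v ω) (Y ω) ∂μ = ∫ ω, (μ[fun ω => innerSL ℝ (v ω) (Y ω) | m]) ω ∂μ := by
    rw [integral_condExp hm]; rfl
  rw [e, integral_congr_ae h]
  refine integral_eq_zero_of_ae ?_
  filter_upwards [h0] with ω hω
  simp [hω]

end CondIndep

/-! ### Measurable operations -/

section Measurability

variable {Ω : Type*} {d : ℕ → ℕ}

lemma measurable_smul_add_smul {m : MeasurableSpace Ω} {n : ℕ} {g h : Ω → EuclideanSpace ℝ (Fin n)}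
    (hg : Measurable[m] g) (hh : Measurable[m] h) (a b : ℝ) :
    Measurable[m] fun ω => a • g ω + b • h ω :=
  (hg.const_smul a).add (hh.const_smul b)

lemma measurable_smul_sum {m : MeasurableSpace Ω} {n : ℕ} {g : ℕ → Ω → EuclideanSpace ℝ (Fin n)}
    {s : Finset ℕ} (hg : ∀ j ∈ s, Measurable[m] (g j)) (a : ℝ) :
    Measurable[m] fun ω => a • ∑ j ∈ s, g j ω :=
  (Finset.measurable_sum s hg).const_smul a

lemma measurable_matrixProd {m : MeasurableSpace Ω} {M : Ω → ∀ i, LevelMatrix d i} {n : ℕ}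
    (hM : ∀ i < n, ∀ a c, Measurable[m] fun ω => M ω i a c) (a : Fin (levelDim d n))
    (c : Fin (levelDim d 0)) : Measurable[m] fun ω => matrixProd (M ω) n a c := by
  induction n with
  | zero => exact measurable_const
  | succ n ih =>
    simp only [matrixProd, Matrix.mul_apply]
    exact Finset.measurable_sum _ fun e _ =>
      (hM n (by omega) a e).mul (ih (fun i hi => hM i (by omega)) e)

lemma measurable_prodVec {m : MeasurableSpace Ω} {M : Ω → ∀ i, LevelMatrix d i} {n : ℕ}
    (hM : ∀ i < n, ∀ a c, Measurable[m] fun ω => M ω i a c) :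
    Measurable[m] fun ω => prodVec (M ω) n :=
  (WithLp.measurable_toLp 2 _).comp
    (measurable_pi_lambda _ fun a => measurable_matrixProd hM a (0 : Fin 1))

lemma measurable_apply_matrix {m n : ℕ} (a : Fin m) (c : Fin n) :
    Measurable fun M : Matrix (Fin m) (Fin n) ℝ => M a c :=
  (measurable_pi_apply c).comp (measurable_pi_apply (X := fun _ => Fin n → ℝ) a)

lemma measurable_frobSq {m n : ℕ} : Measurable (frobSq (m := m) (n := n)) :=
  Finset.measurable_sum _ fun a _ => Finset.measurable_sum _ fun c _ =>
    (measurable_apply_matrix a c).pow_const 2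

lemma measurable_comp_pair {V V' : Type*} {m : MeasurableSpace Ω} [MeasurableSpace V]
    [MeasurableSpace V'] {F : V → V → V'} (hF : Measurable fun p : V × V => F p.1 p.2) {g h : Ω → V}
    (hg : Measurable[m] g) (hh : Measurable[m] h) : Measurable[m] fun ω => F (g ω) (h ω) :=
  hF.comp (hg.prodMk hh)

lemma measurable_subSolution {m : MeasurableSpace Ω} {n : ℕ} {X : Set (EuclideanSpace ℝ (Fin n))}
    {β : ℝ} (hXc : IsClosed X) (hX : Convex ℝ X) (hne : X.Nonempty) (hβ : 0 < β)
    {g h : Ω → EuclideanSpace ℝ (Fin n)} (hg : Measurable[m] g) (hh : Measurable[m] h) :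
    Measurable[m] fun ω => subSolution X β (g ω) (h ω) :=
  measurable_comp_pair (continuous_subSolution hXc hX hne hβ).measurable hg hh

lemma measurable_sq_norm {m : MeasurableSpace Ω} {n : ℕ} {g : Ω → EuclideanSpace ℝ (Fin n)}
    (hg : Measurable[m] g) : Measurable[m] fun ω => ‖g ω‖ ^ 2 :=
  (measurable_norm.comp hg).pow_const 2

end Measurability

/-! ### The method together with its assumptions -/

/-- The problem, the run of the method and all the assumptions made on them, in one object. -/
structure Model {Ω : Type*} [MeasurableSpace Ω] (μ : Measure Ω) (d : ℕ → ℕ) (T : ℕ) where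
  X : Set (LevelSpace d T)
  f : ∀ i, LevelSpace d (i + 1) → LevelSpace d i
  Lf : ℕ → ℝ≥0
  Lg : ℕ → ℝ≥0
  lam : ℝ
  β : ℝ
  τ : ℕ → ℝ
  b : ℕ → ℕ
  σG : ℕ → ℝ
  σJ : ℕ → ℝ
  σJhat : ℕ → ℝ
  x0 : LevelSpace d T
  z0 : LevelSpace d T
  w0 : ∀ i, LevelSpace d i
  P : Run d T Ω
  two_le : 2 ≤ T
  closed : IsClosed X
  convex : Convex ℝ X
  diff : ∀ i < T, Differentiable ℝ (f i)
  lip : ∀ i < T, LipschitzWith (Lf i) (f i)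
  grad : ∀ i < T, LipschitzWith (Lg i) (fderiv ℝ (f i))
  param : ParameterRule T Lf Lg lam β
  step_mem : ∀ k, 0 < τ k ∧ τ k ≤ 1
  batch : ∀ k, b k = ⌈(maxLfSq T Lf : ℝ) / τ k⌉₊
  x0_mem : x0 ∈ X
  w0_top : w0 T = x0
  z0_le : ‖z0‖ ^ 2 ≤ prodSigmaJ T σJ
  gen : P.GeneratedBy X β τ b x0 z0 w0
  oracle : P.Oracle μ f b σG σJ σJhat

namespace Model

variable {Ω : Type*} [mΩ : MeasurableSpace Ω] {μ : Measure Ω} {d : ℕ → ℕ} {T : ℕ}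

/-- The direction `u k - x k`. -/
def dir (S : Model μ d T) (k : ℕ) (ω : Ω) : LevelSpace d T := S.P.u k ω - S.P.x k ω

/-- The tracking error `f i (w (i + 1)) - w i` of level `i`. -/
def err (S : Model μ d T) (k i : ℕ) (ω : Ω) : LevelSpace d i :=
  S.f i (S.P.w k (i + 1) ω) - S.P.w k i ω

/-- The deviation of the mini-batch average of level `i` from its conditional mean. -/
def noise (S : Model μ d T) (k i : ℕ) (ω : Ω) : LevelSpace d i :=
  (S.b k : ℝ)⁻¹ • ∑ j ∈ Finset.range (S.b k), S.P.G k i j ω - S.f i (S.P.w k (i + 1) ω)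

/-- The stochastic gradient, the product of the sampled matrices. -/
def est (S : Model μ d T) (k : ℕ) (ω : Ω) : LevelSpace d T := prodVec (fun i => S.P.J k i ω) T

/-- The conditional mean of the stochastic gradient. -/
def mean (S : Model μ d T) (k : ℕ) (ω : Ω) : LevelSpace d T :=
  prodVec (gradFamily S.f fun i => S.P.w k i ω) T

/-- The history together with the samples of all levels other than `i`. -/
@[reducible] def levelHistory (S : Model μ d T) (k i : ℕ) : MeasurableSpace Ω :=
  S.P.history k ⊔ ⨆ q ∈ {q : Fin T × Fin (S.b k) | (q.1 : ℕ) ≠ i},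
    MeasurableSpace.comap (S.P.G k q.1 q.2) inferInstance

variable (S : Model μ d T)

lemma lam_pos : 0 < S.lam := S.param.lam_pos

lemma gammaWeight_nonneg (i : ℕ) : 0 ≤ gammaWeight T S.Lf S.lam i := by
  unfold gammaWeight
  split_ifs
  · exact S.lam_pos.le
  · positivity

lemma β_pos : 0 < S.β := by
  have h1 := S.param.beta_ge
  have h2 := S.lam_pos
  have h3 := mul_nonneg (S.gammaWeight_nonneg (T - 1)) (sq_nonneg (S.Lf (T - 1) : ℝ))
  have h4 : 0 ≤ T * (maxCSq T S.Lf S.Lg : ℝ) / (4 * S.lam) := by positivity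
  linarith

lemma sq_Lf_le {i : ℕ} (hi : i < T) : (S.Lf i : ℝ) ^ 2 ≤ maxLfSq T S.Lf := by
  have := Finset.le_sup (f := fun i => S.Lf i ^ 2) (Finset.mem_range.2 hi)
  exact_mod_cast this

/-- The condition on `lam` at level `1` forces `Lf 0 ≠ 0`, so that no mini-batch is empty. -/
lemma b_pos (k : ℕ) : 0 < S.b k := by
  rw [S.batch, Nat.ceil_pos]
  refine div_pos ?_ (S.step_mem k).1
  have hT := S.two_le
  refine lt_of_lt_of_le ?_ (S.sq_Lf_le (i := 0) (by omega))
  have h := S.param.lam_le 1 le_rfl (by omega)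
  have h2 := S.lam_pos
  by_contra! h0
  have h0 : (S.Lf 0 : ℝ) = 0 := by
    have : (S.Lf 0 : ℝ) ^ 2 = 0 := le_antisymm h0 (sq_nonneg _)
    simpa using this
  simp [gammaWeight, h0] at h
  linarith

lemma sq_Lf_div_le (k : ℕ) {i : ℕ} (hi : i < T) : (S.Lf i : ℝ) ^ 2 / S.b k ≤ S.τ k := by
  have hb : (0 : ℝ) < S.b k := by exact_mod_cast S.b_pos k
  have h1 : (maxLfSq T S.Lf : ℝ) / S.τ k ≤ S.b k := by
    conv_rhs => rw [S.batch]
    exact Nat.le_ceil _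
  rw [div_le_iff₀ (S.step_mem k).1] at h1
  rw [div_le_iff₀ hb]
  linarith [S.sq_Lf_le hi]

lemma x_mem (k : ℕ) (ω : Ω) : S.P.x k ω ∈ S.X := by
  induction k with
  | zero => rw [S.gen.x_zero]; exact S.x0_mem
  | succ k ih =>
    rw [S.gen.x_succ]
    have := S.step_mem k
    exact S.convex ih (S.gen.u_eq k ω).1 (by linarith) this.1.le (by ring)

lemma u_eq_subSolution (k : ℕ) (ω : Ω) :
    S.P.u k ω = subSolution S.X S.β (S.P.x k ω) (S.P.z k ω) :=
  (S.gen.u_eq k ω).eq_subSolution S.closed S.convex S.β_pos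

lemma x_succ_eq (k : ℕ) (ω : Ω) : S.P.x (k + 1) ω = S.P.x k ω + S.τ k • S.dir k ω := by
  rw [S.gen.x_succ, dir, smul_sub, sub_smul, one_smul]; abel

lemma z_succ_eq (k : ℕ) (ω : Ω) :
    S.P.z (k + 1) ω = (1 - S.τ k) • S.P.z k ω + S.τ k • S.est k ω := S.gen.z_succ k ω

lemma w_succ_eq (k : ℕ) {i : ℕ} (hi : i < T) (ω : Ω) :
    S.P.w (k + 1) i ω = S.P.w k i ω + S.τ k • (S.err k i ω + S.noise k i ω) := by
  rw [S.gen.w_succ k i hi, err, noise]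
  simp only [smul_add, smul_sub, sub_smul, one_smul]
  abel

/-! ### Measurability -/

lemma measurable_f {i : ℕ} (hi : i < T) : Measurable (S.f i) := (S.lip i hi).continuous.measurable

lemma measurable_est (k : ℕ) : Measurable (S.est k) :=
  measurable_prodVec fun i hi a c =>
    (measurable_apply_matrix a c).comp (S.oracle.measurable_J k i hi)

lemma measurable_run (k : ℕ) : Measurable (S.P.x k) ∧ Measurable (S.P.z k) ∧
    ∀ i < T, Measurable (S.P.w k i) := by
  induction k with
  | zero =>
    refine ⟨?_, ?_, fun i hi => ?_⟩
    · rw [funext S.gen.x_zero]; exact measurable_const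
    · rw [funext S.gen.z_zero]; exact measurable_const
    · rw [funext (S.gen.w_zero i hi)]; exact measurable_const
  | succ k ih =>
    obtain ⟨hx, hz, hw⟩ := ih
    have hu : Measurable (S.P.u k) := by
      rw [funext (S.u_eq_subSolution k)]
      exact measurable_subSolution S.closed S.convex ⟨_, S.x0_mem⟩ S.β_pos hx hz
    refine ⟨?_, ?_, fun i hi => ?_⟩
    · rw [funext (S.gen.x_succ k)]; exact measurable_smul_add_smul hx hu _ _
    · rw [funext (S.gen.z_succ k)]
      exact measurable_smul_add_smul hz (S.measurable_est k) _ _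
    · rw [funext (S.gen.w_succ k i hi)]
      exact measurable_smul_add_smul (hw i hi) (measurable_smul_sum (fun j hj =>
        S.oracle.measurable_G k i hi j (Finset.mem_range.1 hj)) _) _ _

lemma measurable_u (k : ℕ) : Measurable (S.P.u k) := by
  rw [funext (S.u_eq_subSolution k)]
  exact measurable_subSolution S.closed S.convex ⟨_, S.x0_mem⟩ S.β_pos
    (S.measurable_run k).1 (S.measurable_run k).2.1

lemma history_le (k : ℕ) : S.P.history k ≤ mΩ := by
  refine iSup₂_le fun j _ => sup_le (sup_le (sup_le ?_ ?_) ?_) (iSup₂_le fun i hi => ?_)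
  · exact (S.measurable_run j).1.comap_le
  · exact (S.measurable_run j).2.1.comap_le
  · exact (S.measurable_u j).comap_le
  · exact ((S.measurable_run j).2.2 i hi).comap_le

lemma measurable_x (k : ℕ) : Measurable[S.P.history k] (S.P.x k) := by
  rw [measurable_iff_comap_le]
  exact le_iSup₂_of_le k le_rfl (le_sup_of_le_left (le_sup_of_le_left le_sup_left))

lemma measurable_z (k : ℕ) : Measurable[S.P.history k] (S.P.z k) := by
  rw [measurable_iff_comap_le]
  exact le_iSup₂_of_le k le_rfl (le_sup_of_le_left (le_sup_of_le_left le_sup_right))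

lemma measurable_u_history (k : ℕ) : Measurable[S.P.history k] (S.P.u k) := by
  rw [measurable_iff_comap_le]
  exact le_iSup₂_of_le k le_rfl (le_sup_of_le_left le_sup_right)

lemma measurable_w (k : ℕ) {i : ℕ} (hi : i ≤ T) : Measurable[S.P.history k] (S.P.w k i) := by
  rcases hi.lt_or_eq with hi | rfl
  · rw [measurable_iff_comap_le]
    exact le_iSup₂_of_le k le_rfl (le_sup_of_le_right (le_iSup₂_of_le i hi le_rfl))
  · rw [funext (S.gen.w_top k)]
    exact S.measurable_x k

lemma measurable_dir (k : ℕ) : Measurable[S.P.history k] (S.dir k) :=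
  (S.measurable_u_history k).sub (S.measurable_x k)

lemma measurable_err (k : ℕ) {i : ℕ} (hi : i < T) : Measurable[S.P.history k] (S.err k i) :=
  ((S.measurable_f hi).comp (S.measurable_w k hi)).sub (S.measurable_w k hi.le)

lemma measurable_x_succ (k : ℕ) : Measurable[S.P.history k] (S.P.x (k + 1)) := by
  rw [funext (S.gen.x_succ k)]
  exact measurable_smul_add_smul (S.measurable_x k) (S.measurable_u_history k) _ _

lemma measurable_mean (k : ℕ) : Measurable[S.P.history k] (S.mean k) :=
  measurable_prodVec fun i hi a c =>
    (continuous_gradMatrix (S.grad i hi) a c).measurable.comp (S.measurable_w k hi)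

lemma continuous_gradient_objective : Continuous (gradient (objective S.f T)) := by
  refine LipschitzWith.continuous (K := lipGradF T S.Lf S.Lg) (LipschitzWith.of_dist_le_mul ?_)
  intro x y
  rw [dist_eq_norm, dist_eq_norm]
  exact norm_gradient_objective_sub_le S.diff S.lip S.grad x y

lemma history_le_levelHistory (k i : ℕ) : S.P.history k ≤ S.levelHistory k i := le_sup_left

/-- The next argument of `f i` is built from samples of level `i + 1`, not of level `i`. -/
lemma measurable_w_succ_levelHistory (k : ℕ) {i : ℕ} (hi : i < T) :
    Measurable[S.levelHistory k i] (S.P.w (k + 1) (i + 1)) := by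
  rcases (Nat.succ_le_of_lt hi).lt_or_eq with h | rfl
  · rw [funext (S.gen.w_succ k (i + 1) h)]
    refine measurable_smul_add_smul
      ((S.measurable_w k hi).mono (S.history_le_levelHistory k i) le_rfl)
      (measurable_smul_sum (fun j hj => ?_) _) _ _
    rw [measurable_iff_comap_le]
    exact le_sup_of_le_right (le_iSup₂_of_le (⟨i + 1, h⟩, ⟨j, Finset.mem_range.1 hj⟩)
      (by simp) le_rfl)
  · rw [funext (S.gen.w_top (k + 1))]
    exact (S.measurable_x_succ k).mono (S.history_le_levelHistory k i) le_rfl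

end Model

/-! ### Second moments -/

lemma prodSigmaJ_nonneg (T : ℕ) (σJ : ℕ → ℝ) : 0 ≤ prodSigmaJ T σJ :=
  Finset.prod_nonneg fun _ _ => sq_nonneg _

lemma memLp_comp_lipschitz {Ω V W : Type*} {mΩ : MeasurableSpace Ω} {μ : Measure Ω}
    [IsFiniteMeasure μ] [NormedAddCommGroup V] [NormedAddCommGroup W] {K : ℝ≥0} {g : V → W}
    (hg : LipschitzWith K g) {Y : Ω → V} (hY : MemLp Y 2 μ) :
    MemLp (fun ω => g (Y ω)) 2 μ := by
  have h1 : MemLp (fun ω => g (Y ω) - g 0) 2 μ := by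
    refine hY.of_le_mul (c := K) ((hg.continuous.comp_aestronglyMeasurable hY.1).sub
      aestronglyMeasurable_const) (.of_forall fun ω => ?_)
    simpa using hg.norm_sub_le (Y ω) 0
  exact (h1.add (memLp_const (g 0))).congr_norm
    (hg.continuous.comp_aestronglyMeasurable hY.1) (.of_forall fun ω => by simp)

lemma norm_sq_convex_comb_le {V : Type*} [NormedAddCommGroup V] [InnerProductSpace ℝ V] {t : ℝ}
    (h0 : 0 ≤ t) (h1 : t ≤ 1) (a b : V) :
    ‖(1 - t) • a + t • b‖ ^ 2 ≤ (1 - t) * ‖a‖ ^ 2 + t * ‖b‖ ^ 2 := by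
  have h : (1 - t) * ‖a‖ ^ 2 + t * ‖b‖ ^ 2 - ‖(1 - t) • a + t • b‖ ^ 2
      = t * (1 - t) * ‖a - b‖ ^ 2 := by
    simp only [← real_inner_self_eq_norm_sq, inner_add_left, inner_add_right, inner_sub_left,
      inner_sub_right, real_inner_smul_left, real_inner_smul_right]
    rw [real_inner_comm a b]
    ring
  have h2 : 0 ≤ t * (1 - t) * ‖a - b‖ ^ 2 :=
    mul_nonneg (mul_nonneg h0 (by linarith)) (sq_nonneg _)
  linarith

namespace Model

variable {Ω : Type*} [mΩ : MeasurableSpace Ω] {μ : Measure Ω} {d : ℕ → ℕ} {T : ℕ}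
  (S : Model μ d T)

/-! ### Products of the sampled matrices -/

/-- The history together with the matrices sampled at all levels other than `i`. -/
@[reducible] def matrixHistory (k : ℕ) (i : Fin T) : MeasurableSpace Ω :=
  S.P.history k ⊔ ⨆ j ∈ {j : Fin T | j ≠ i}, MeasurableSpace.comap (S.P.J k j) inferInstance

lemma matrixHistory_le (k : ℕ) (i : Fin T) : S.matrixHistory k i ≤ mΩ :=
  sup_le (S.history_le k) (iSup₂_le fun j _ => (S.oracle.measurable_J k j j.2).comap_le)

lemma measurable_J_matrixHistory (k : ℕ) {i j : Fin T} (h : j ≠ i) :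
    Measurable[S.matrixHistory k i] (S.P.J k j) := by
  rw [measurable_iff_comap_le]
  exact le_sup_of_le_right (le_iSup₂_of_le j h le_rfl)

lemma measurable_matrixProd_matrixHistory (k : ℕ) {n : ℕ} (hn : n < T)
    (a : Fin (levelDim d n)) (c : Fin (levelDim d 0)) :
    Measurable[S.matrixHistory k ⟨n, hn⟩]
      fun ω => matrixProd (fun i => S.P.J k i ω) n a c :=
  measurable_matrixProd (fun i hi a c => (measurable_apply_matrix a c).comp
    (S.measurable_J_matrixHistory k (j := ⟨i, hi.trans hn⟩) (by simp [hi.ne]))) a c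

lemma measurable_matrixProd_J (k : ℕ) {n : ℕ} (hn : n ≤ T) (a : Fin (levelDim d n))
    (c : Fin (levelDim d 0)) : Measurable fun ω => matrixProd (fun i => S.P.J k i ω) n a c :=
  measurable_matrixProd (fun i hi a c => (measurable_apply_matrix a c).comp
    (S.oracle.measurable_J k i (hi.trans_le hn))) a c

lemma memLp_J (k : ℕ) {i : ℕ} (hi : i < T) (a : Fin (levelDim d (i + 1)))
    (c : Fin (levelDim d i)) : MemLp (fun ω => S.P.J k i ω a c) 2 μ := by
  have hm : AEStronglyMeasurable (fun ω => S.P.J k i ω a c) μ :=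
    ((measurable_apply_matrix a c).comp (S.oracle.measurable_J k i hi)).aestronglyMeasurable
  rw [memLp_two_iff_integrable_sq_norm hm]
  refine (S.oracle.sq_integrable_J k i hi).mono' (hm.norm.pow 2) (.of_forall fun ω => ?_)
  rw [norm_pow, norm_norm, Real.norm_eq_abs, sq_abs]
  exact sq_apply_le_frobSq _ a c

variable [IsProbabilityMeasure μ]

lemma condExp_J_matrixHistory (k : ℕ) (i : Fin T) {φ : LevelMatrix d i → ℝ} (hφ : Measurable φ)
    (hint : Integrable (fun ω => φ (S.P.J k i ω)) μ) :
    μ[fun ω => φ (S.P.J k i ω) | S.matrixHistory k i]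
      =ᵐ[μ] μ[fun ω => φ (S.P.J k i ω) | S.P.history k] :=
  CondIndepFamily.condExp_sup (E := fun i : Fin T => LevelMatrix d i)
    (Y := fun i : Fin T => S.P.J k i) (S.history_le k)
    (fun j => S.oracle.measurable_J k j j.2) (S.oracle.indep_J k) i hφ.stronglyMeasurable hint

/-- Second moments multiply along products of conditionally independent matrices. -/
lemma lintegral_frobSq_matrixProd_le (k : ℕ) {n : ℕ} (hn : n ≤ T) :
    ∫⁻ ω, ENNReal.ofReal (frobSq (matrixProd (fun i => S.P.J k i ω) n)) ∂μ
      ≤ ENNReal.ofReal (prodSigmaJ n S.σJ) := by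
  induction n with
  | zero => simp [frobSq_matrixProd_zero, prodSigmaJ]
  | succ n ih =>
    have hn' : n < T := hn
    have hm := S.matrixHistory_le k ⟨n, hn'⟩
    have hint := S.oracle.sq_integrable_J k n hn'
    have hmeas : Measurable[S.matrixHistory k ⟨n, hn'⟩]
        fun ω => ENNReal.ofReal (frobSq (matrixProd (fun i => S.P.J k i ω) n)) := by
      refine Measurable.ennreal_ofReal ?_
      unfold frobSq
      exact Finset.measurable_sum _ fun a _ => Finset.measurable_sum _ fun c _ =>
        (S.measurable_matrixProd_matrixHistory k hn' a c).pow_const 2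
    have hce : μ[fun ω => frobSq (S.P.J k n ω) | S.matrixHistory k ⟨n, hn'⟩]
        ≤ᵐ[μ] fun _ => S.σJ n ^ 2 :=
      (S.condExp_J_matrixHistory k ⟨n, hn'⟩ measurable_frobSq hint).trans_le
        (S.oracle.second_moment_J k n hn')
    calc ∫⁻ ω, ENNReal.ofReal (frobSq (matrixProd (fun i => S.P.J k i ω) (n + 1))) ∂μ
        ≤ ∫⁻ ω, ENNReal.ofReal (frobSq (matrixProd (fun i => S.P.J k i ω) n))
          * ENNReal.ofReal (frobSq (S.P.J k n ω)) ∂μ := by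
          refine lintegral_mono fun ω => ?_
          rw [← ENNReal.ofReal_mul (frobSq_nonneg _), mul_comm]
          exact ENNReal.ofReal_le_ofReal (frobSq_mul_le _ _)
      _ = ∫⁻ ω, ENNReal.ofReal (frobSq (matrixProd (fun i => S.P.J k i ω) n))
          * ENNReal.ofReal ((μ[fun ω => frobSq (S.P.J k n ω)
            | S.matrixHistory k ⟨n, hn'⟩]) ω) ∂μ :=
          lintegral_mul_ofReal_condExp hm hint (fun ω => frobSq_nonneg _) hmeas
      _ ≤ ∫⁻ ω, ENNReal.ofReal (frobSq (matrixProd (fun i => S.P.J k i ω) n))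
          * ENNReal.ofReal (S.σJ n ^ 2) ∂μ := by
          refine lintegral_mono_ae ?_
          filter_upwards [hce] with ω h
          gcongr
      _ ≤ ENNReal.ofReal (prodSigmaJ (n + 1) S.σJ) := by
          rw [lintegral_mul_const _ (hmeas.mono hm le_rfl), prodSigmaJ, Finset.prod_range_succ,
            ENNReal.ofReal_mul (Finset.prod_nonneg fun _ _ => sq_nonneg _)]
          gcongr
          exact ih hn'.le

lemma integrable_frobSq_matrixProd (k : ℕ) {n : ℕ} (hn : n ≤ T) :
    Integrable (fun ω => frobSq (matrixProd (fun i => S.P.J k i ω) n)) μ := by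
  refine ⟨(Finset.measurable_sum _ fun a _ => Finset.measurable_sum _ fun c _ =>
    (S.measurable_matrixProd_J k hn a c).pow_const 2).aestronglyMeasurable, ?_⟩
  rw [hasFiniteIntegral_iff_ofReal (.of_forall fun ω => frobSq_nonneg _)]
  exact (S.lintegral_frobSq_matrixProd_le k hn).trans_lt ENNReal.ofReal_lt_top

lemma memLp_matrixProd (k : ℕ) {n : ℕ} (hn : n ≤ T) (a : Fin (levelDim d n))
    (c : Fin (levelDim d 0)) :
    MemLp (fun ω => matrixProd (fun i => S.P.J k i ω) n a c) 2 μ := by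
  have hm := (S.measurable_matrixProd_J k hn a c).aestronglyMeasurable (μ := μ)
  rw [memLp_two_iff_integrable_sq_norm hm]
  refine (S.integrable_frobSq_matrixProd k hn).mono' (hm.norm.pow 2) (.of_forall fun ω => ?_)
  rw [norm_pow, norm_norm, Real.norm_eq_abs, sq_abs]
  exact sq_apply_le_frobSq _ a c

/-- The product of conditionally independent unbiased matrices is unbiased. -/
lemma condExp_matrixProd (k : ℕ) {n : ℕ} (hn : n ≤ T) (a : Fin (levelDim d n))
    (c : Fin (levelDim d 0)) :
    μ[fun ω => matrixProd (fun i => S.P.J k i ω) n a c | S.P.history k]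
      =ᵐ[μ] fun ω => matrixProd (gradFamily S.f fun i => S.P.w k i ω) n a c := by
  induction n generalizing c with
  | zero =>
    simp only [matrixProd]
    rw [condExp_const (S.history_le k)]
  | succ n ih =>
    have hn' : n < T := hn
    have hm := S.matrixHistory_le k ⟨n, hn'⟩
    have hprod : ∀ e, Integrable
        ((fun ω => S.P.J k n ω a e) * fun ω => matrixProd (fun i => S.P.J k i ω) n e c) μ :=
      fun e => (S.memLp_J k hn' a e).integrable_mul (S.memLp_matrixProd k hn'.le e c)
    have hterm : ∀ e, μ[(fun ω => S.P.J k n ω a e)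
        * (fun ω => matrixProd (fun i => S.P.J k i ω) n e c) | S.P.history k]
        =ᵐ[μ] fun ω => gradFamily S.f (fun i => S.P.w k i ω) n a e
          * matrixProd (gradFamily S.f fun i => S.P.w k i ω) n e c := fun e => by
      have hg : Measurable[S.P.history k]
          fun ω => gradFamily S.f (fun i => S.P.w k i ω) n a e :=
        (continuous_gradMatrix (S.grad n hn') a e).measurable.comp (S.measurable_w k hn')
      have h1 : μ[(fun ω => S.P.J k n ω a e)
          * (fun ω => matrixProd (fun i => S.P.J k i ω) n e c) | S.matrixHistory k ⟨n, hn'⟩]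
          =ᵐ[μ] (fun ω => gradFamily S.f (fun i => S.P.w k i ω) n a e)
            * fun ω => matrixProd (fun i => S.P.J k i ω) n e c :=
        (condExp_mul_of_stronglyMeasurable_right
          (S.measurable_matrixProd_matrixHistory k hn' e c).stronglyMeasurable (hprod e)
          (S.oracle.integrable_J k n hn' a e)).trans
          (((S.condExp_J_matrixHistory k ⟨n, hn'⟩ (measurable_apply_matrix a e)
            (S.oracle.integrable_J k n hn' a e)).trans
            (S.oracle.unbiased_J k n hn' a e)).mul .rfl)
      have hi : Integrable ((fun ω => gradFamily S.f (fun i => S.P.w k i ω) n a e)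
          * fun ω => matrixProd (fun i => S.P.J k i ω) n e c) μ :=
        integrable_condExp.congr h1
      calc _ =ᵐ[μ] μ[μ[(fun ω => S.P.J k n ω a e)
              * (fun ω => matrixProd (fun i => S.P.J k i ω) n e c) | S.matrixHistory k ⟨n, hn'⟩]
              | S.P.history k] := (condExp_condExp_of_le le_sup_left hm).symm
        _ =ᵐ[μ] _ := condExp_congr_ae h1
        _ =ᵐ[μ] _ := condExp_mul_of_stronglyMeasurable_left hg.stronglyMeasurable hi
              ((S.memLp_matrixProd k hn'.le e c).integrable (by norm_num))
        _ =ᵐ[μ] _ := Filter.EventuallyEq.rfl.mul (ih hn'.le e c)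
    have hsum : (fun ω => matrixProd (fun i => S.P.J k i ω) (n + 1) a c)
        = ∑ e, ((fun ω => S.P.J k n ω a e)
          * fun ω => matrixProd (fun i => S.P.J k i ω) n e c) := by
      ext ω
      simp [matrixProd, Matrix.mul_apply]
    rw [hsum]
    refine (condExp_finsetSum (fun e _ => hprod e) _).trans ?_
    filter_upwards [Filter.eventually_all.2 hterm] with ω hω
    simp only [Finset.sum_apply, hω, matrixProd, Matrix.mul_apply]

end Model

/-! ### Square-integrable random vectors -/

lemma measurable_coord {Ω : Type*} {m : MeasurableSpace Ω} {n : ℕ}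
    {g : Ω → EuclideanSpace ℝ (Fin n)} (hg : Measurable[m] g) (a : Fin n) :
    Measurable[m] fun ω => g ω a :=
  (EuclideanSpace.proj (𝕜 := ℝ) a : EuclideanSpace ℝ (Fin n) →L[ℝ] ℝ).continuous.measurable.comp hg

lemma memLp_coord {Ω : Type*} {mΩ : MeasurableSpace Ω} {μ : Measure Ω} {n : ℕ}
    {g : Ω → EuclideanSpace ℝ (Fin n)} (hg : MemLp g 2 μ) (a : Fin n) :
    MemLp (fun ω => g ω a) 2 μ :=
  (EuclideanSpace.proj (𝕜 := ℝ) a : EuclideanSpace ℝ (Fin n) →L[ℝ] ℝ).comp_memLp' hg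

lemma memLp_smul_add_smul {Ω V : Type*} {mΩ : MeasurableSpace Ω} {μ : Measure Ω}
    [NormedAddCommGroup V] [NormedSpace ℝ V] {g h : Ω → V} (hg : MemLp g 2 μ) (hh : MemLp h 2 μ)
    (a b : ℝ) : MemLp (fun ω => a • g ω + b • h ω) 2 μ :=
  (hg.const_smul a).add (hh.const_smul b)

lemma memLp_smul_sum {Ω V : Type*} {mΩ : MeasurableSpace Ω} {μ : Measure Ω}
    [NormedAddCommGroup V] [NormedSpace ℝ V] {g : ℕ → Ω → V} {s : Finset ℕ}
    (hg : ∀ j ∈ s, MemLp (g j) 2 μ) (a : ℝ) : MemLp (fun ω => a • ∑ j ∈ s, g j ω) 2 μ :=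
  (memLp_finsetSum s hg).const_smul a

namespace Model

variable {Ω : Type*} [mΩ : MeasurableSpace Ω] {μ : Measure Ω} {d : ℕ → ℕ} {T : ℕ}
  (S : Model μ d T)

/-! ### Samples and mini-batches -/

/-- The history together with all the samples of function values except the one indexed by `p`. -/
@[reducible] def sampleHistory (k : ℕ) (p : Fin T × Fin (S.b k)) : MeasurableSpace Ω :=
  S.P.history k ⊔ ⨆ q ∈ {q | q ≠ p}, MeasurableSpace.comap (S.P.G k q.1 q.2) inferInstance

lemma sampleHistory_le (k : ℕ) (p : Fin T × Fin (S.b k)) : S.sampleHistory k p ≤ mΩ :=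
  sup_le (S.history_le k) (iSup₂_le fun q _ =>
    (S.oracle.measurable_G k q.1 q.1.2 q.2 q.2.2).comap_le)

lemma measurable_sample_sub (k : ℕ) {i j : ℕ} (hi : i < T) (hj : j < S.b k) :
    Measurable fun ω => S.P.G k i j ω - S.f i (S.P.w k (i + 1) ω) :=
  (S.oracle.measurable_G k i hi j hj).sub ((S.measurable_f hi).comp
    ((S.measurable_w k hi).mono (S.history_le k) le_rfl))

lemma noise_eq (k i : ℕ) (ω : Ω) : S.noise k i ω = (S.b k : ℝ)⁻¹ •
    ∑ j ∈ Finset.range (S.b k), (S.P.G k i j ω - S.f i (S.P.w k (i + 1) ω)) := by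
  have hb : (S.b k : ℝ) ≠ 0 := by exact_mod_cast (S.b_pos k).ne'
  rw [noise, Finset.sum_sub_distrib, smul_sub, Finset.sum_const, Finset.card_range,
    ← Nat.cast_smul_eq_nsmul ℝ, smul_smul, inv_mul_cancel₀ hb, one_smul]

lemma norm_dir_le (k : ℕ) (ω : Ω) : S.β * ‖S.dir k ω‖ ≤ ‖S.P.z k ω‖ :=
  (S.gen.u_eq k ω).norm_le S.convex S.β_pos (S.x_mem k ω)

lemma memLp_sample_sub (k : ℕ) {i j : ℕ} (hi : i < T) (hj : j < S.b k) :
    MemLp (fun ω => S.P.G k i j ω - S.f i (S.P.w k (i + 1) ω)) 2 μ := by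
  rw [memLp_two_iff_integrable_sq_norm (S.measurable_sample_sub k hi hj).aestronglyMeasurable]
  exact S.oracle.sq_integrable_G k i hi j hj

lemma memLp_dir_of_z {k : ℕ} (hz : MemLp (S.P.z k) 2 μ) : MemLp (S.dir k) 2 μ := by
  refine hz.of_le_mul (c := S.β⁻¹)
    ((S.measurable_dir k).mono (S.history_le k) le_rfl).aestronglyMeasurable
    (.of_forall fun ω => ?_)
  rw [← div_eq_inv_mul, le_div_iff₀ S.β_pos, mul_comm]
  exact S.norm_dir_le k ω

lemma memLp_noise (k : ℕ) {i : ℕ} (hi : i < T) : MemLp (S.noise k i) 2 μ := by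
  rw [funext (S.noise_eq k i)]
  exact memLp_smul_sum (fun j hj => S.memLp_sample_sub k hi (Finset.mem_range.1 hj)) _

variable [IsProbabilityMeasure μ]

/-! ### The stochastic gradient -/

lemma integral_sq_est_le (k : ℕ) : ∫ ω, ‖S.est k ω‖ ^ 2 ∂μ ≤ prodSigmaJ T S.σJ := by
  have h : ∫⁻ ω, ENNReal.ofReal (‖S.est k ω‖ ^ 2) ∂μ ≤ ENNReal.ofReal (prodSigmaJ T S.σJ) := by
    simp only [est, sq_norm_prodVec]
    exact S.lintegral_frobSq_matrixProd_le k le_rfl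
  rw [integral_eq_lintegral_of_nonneg_ae (.of_forall fun ω => sq_nonneg _)
    ((S.measurable_est k).norm.pow_const 2).aestronglyMeasurable]
  exact ENNReal.toReal_le_of_le_ofReal (prodSigmaJ_nonneg _ _) h

lemma memLp_est (k : ℕ) : MemLp (S.est k) 2 μ := by
  rw [memLp_two_iff_integrable_sq_norm (S.measurable_est k).aestronglyMeasurable]
  simp only [est, sq_norm_prodVec]
  exact S.integrable_frobSq_matrixProd k le_rfl

lemma memLp_mean (k : ℕ) : MemLp (S.mean k) 2 μ :=
  MemLp.of_bound ((S.measurable_mean k).mono (S.history_le k) le_rfl).aestronglyMeasurable _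
    (.of_forall fun ω => norm_prodVec_gradFamily_le S.lip fun i => S.P.w k i ω)

/-- The stochastic gradient minus its conditional mean is orthogonal to the past. -/
lemma integral_inner_est_sub_mean (k : ℕ) {v : Ω → LevelSpace d T}
    (hvm : Measurable[S.P.history k] v) (hv : MemLp v 2 μ) :
    ∫ ω, inner ℝ (v ω) (S.est k ω - S.mean k ω) ∂μ = 0 := by
  have hdiff : MemLp (fun ω => S.est k ω - S.mean k ω) 2 μ := (S.memLp_est k).sub (S.memLp_mean k)
  have hzero : ∀ a, ∫ ω, inner ℝ (v ω a) (S.est k ω a - S.mean k ω a) ∂μ = 0 := fun a => by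
    refine integral_inner_eq_zero_of_condExp (S.history_le k)
      (measurable_coord hvm a).stronglyMeasurable (memLp_coord hv a) (memLp_coord hdiff a) ?_
    have h1 := S.condExp_matrixProd k le_rfl a (0 : Fin 1)
    have h2 : μ[fun ω => S.mean k ω a | S.P.history k] = fun ω => S.mean k ω a :=
      condExp_of_stronglyMeasurable (S.history_le k)
        (measurable_coord (S.measurable_mean k) a).stronglyMeasurable
        ((memLp_coord (S.memLp_mean k) a).integrable (by norm_num))
    have h3 := condExp_sub (m := S.P.history k)
      ((memLp_coord (S.memLp_est k) a).integrable (by norm_num))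
      ((memLp_coord (S.memLp_mean k) a).integrable (by norm_num))
    filter_upwards [h1, h3] with ω h1 h3
    refine h3.trans ?_
    rw [Pi.sub_apply, h2]
    exact sub_eq_zero.2 h1
  simp only [PiLp.inner_apply]
  rw [integral_finsetSum _ fun a _ =>
    integrable_inner_of_memLp (memLp_coord hv a) (memLp_coord hdiff a)]
  exact Finset.sum_eq_zero fun a _ => hzero a

lemma integral_sq_est_sub_mean_le (k : ℕ) :
    ∫ ω, ‖S.est k ω - S.mean k ω‖ ^ 2 ∂μ ≤ prodSigmaJ T S.σJ := by
  have hdiff : MemLp (fun ω => S.est k ω - S.mean k ω) 2 μ := (S.memLp_est k).sub (S.memLp_mean k)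
  have hi := integrable_inner_of_memLp (S.memLp_mean k) hdiff
  have h0 := S.integral_inner_est_sub_mean k (S.measurable_mean k) (S.memLp_mean k)
  have he := (S.memLp_est k).integrable_norm_pow (by norm_num)
  have hd := hdiff.integrable_norm_pow (by norm_num)
  have e : ∀ ω, ‖S.est k ω - S.mean k ω‖ ^ 2 ≤ ‖S.est k ω‖ ^ 2
      - 2 * inner ℝ (S.mean k ω) (S.est k ω - S.mean k ω) := fun ω => by
    rw [norm_sub_sq_real, inner_sub_right, real_inner_self_eq_norm_sq,
      real_inner_comm (S.mean k ω) (S.est k ω)]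
    nlinarith [sq_nonneg ‖S.mean k ω‖]
  calc _ ≤ ∫ ω, (‖S.est k ω‖ ^ 2 - 2 * inner ℝ (S.mean k ω) (S.est k ω - S.mean k ω)) ∂μ :=
        integral_mono hd (he.sub (hi.const_mul 2)) e
    _ = ∫ ω, ‖S.est k ω‖ ^ 2 ∂μ := by
        rw [integral_sub he (hi.const_mul 2), integral_const_mul]
        simp [h0]
    _ ≤ _ := S.integral_sq_est_le k

/-! ### Square integrability of the iterates -/

lemma memLp_run (k : ℕ) : MemLp (S.P.x k) 2 μ ∧ MemLp (S.P.z k) 2 μ ∧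
    ∀ i ≤ T, MemLp (S.P.w k i) 2 μ := by
  have key : ∀ k, MemLp (S.P.x k) 2 μ → (∀ i < T, MemLp (S.P.w k i) 2 μ) →
      ∀ i ≤ T, MemLp (S.P.w k i) 2 μ := fun k hx hw i hi => by
    rcases hi.lt_or_eq with hi | rfl
    · exact hw i hi
    · rwa [funext (S.gen.w_top k)]
  induction k with
  | zero =>
    have hx : MemLp (S.P.x 0) 2 μ := by rw [funext S.gen.x_zero]; exact memLp_const _
    refine ⟨hx, ?_, key 0 hx fun i hi => ?_⟩
    · rw [funext S.gen.z_zero]; exact memLp_const _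
    · rw [funext (S.gen.w_zero i hi)]; exact memLp_const _
  | succ k ih =>
    obtain ⟨hx, hz, hw⟩ := ih
    have hx' : MemLp (S.P.x (k + 1)) 2 μ := by
      rw [funext (S.x_succ_eq k)]
      simpa only [one_smul] using memLp_smul_add_smul hx (S.memLp_dir_of_z hz) 1 (S.τ k)
    refine ⟨hx', ?_, key _ hx' fun i hi => ?_⟩
    · rw [funext (S.z_succ_eq k)]
      exact memLp_smul_add_smul hz (S.memLp_est k) _ _
    · rw [funext (S.w_succ_eq k hi)]
      have herr : MemLp (S.err k i) 2 μ :=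
        (memLp_comp_lipschitz (S.lip i hi) (hw (i + 1) hi)).sub (hw i hi.le)
      simpa only [one_smul] using
        memLp_smul_add_smul (h := fun ω => S.err k i ω + S.noise k i ω) (hw i hi.le)
          (herr.add (S.memLp_noise k hi)) 1 (S.τ k)

lemma memLp_x (k : ℕ) : MemLp (S.P.x k) 2 μ := (S.memLp_run k).1

lemma memLp_z (k : ℕ) : MemLp (S.P.z k) 2 μ := (S.memLp_run k).2.1

lemma memLp_w (k : ℕ) {i : ℕ} (hi : i ≤ T) : MemLp (S.P.w k i) 2 μ := (S.memLp_run k).2.2 i hi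

lemma memLp_dir (k : ℕ) : MemLp (S.dir k) 2 μ := S.memLp_dir_of_z (S.memLp_z k)

lemma memLp_err (k : ℕ) {i : ℕ} (hi : i < T) : MemLp (S.err k i) 2 μ :=
  (memLp_comp_lipschitz (S.lip i hi) (S.memLp_w k hi)).sub (S.memLp_w k hi.le)

lemma memLp_gradient (k : ℕ) : MemLp (fun ω => gradient (objective S.f T) (S.P.x k ω)) 2 μ := by
  refine memLp_comp_lipschitz (K := lipGradF T S.Lf S.Lg) (LipschitzWith.of_dist_le_mul ?_)
    (S.memLp_x k)
  intro x y
  rw [dist_eq_norm, dist_eq_norm]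
  exact norm_gradient_objective_sub_le S.diff S.lip S.grad x y

lemma integral_sq_z_le (k : ℕ) : ∫ ω, ‖S.P.z k ω‖ ^ 2 ∂μ ≤ prodSigmaJ T S.σJ := by
  induction k with
  | zero => simpa [S.gen.z_zero] using S.z0_le
  | succ k ih =>
    have hτ := S.step_mem k
    have hz := (S.memLp_z k).integrable_norm_pow (by norm_num)
    have he := (S.memLp_est k).integrable_norm_pow (by norm_num)
    calc ∫ ω, ‖S.P.z (k + 1) ω‖ ^ 2 ∂μ
        ≤ ∫ ω, ((1 - S.τ k) * ‖S.P.z k ω‖ ^ 2 + S.τ k * ‖S.est k ω‖ ^ 2) ∂μ := by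
          refine integral_mono ((S.memLp_z (k + 1)).integrable_norm_pow (by norm_num))
            ((hz.const_mul _).add (he.const_mul _)) fun ω => ?_
          simp only [S.z_succ_eq]
          exact norm_sq_convex_comb_le hτ.1.le hτ.2 _ _
      _ = (1 - S.τ k) * ∫ ω, ‖S.P.z k ω‖ ^ 2 ∂μ + S.τ k * ∫ ω, ‖S.est k ω‖ ^ 2 ∂μ := by
          rw [integral_add (hz.const_mul _) (he.const_mul _), integral_const_mul,
            integral_const_mul]
      _ ≤ (1 - S.τ k) * prodSigmaJ T S.σJ + S.τ k * prodSigmaJ T S.σJ := by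
          have := S.integral_sq_est_le k
          have : 0 ≤ 1 - S.τ k := by linarith
          have := hτ.1.le
          gcongr
      _ = _ := by ring

lemma integral_sq_dir_le (k : ℕ) :
    ∫ ω, ‖S.dir k ω‖ ^ 2 ∂μ ≤ prodSigmaJ T S.σJ / S.β ^ 2 := by
  have hβ := S.β_pos
  rw [le_div_iff₀ (by positivity), ← integral_mul_const]
  refine (integral_mono (((S.memLp_dir k).integrable_norm_pow (by norm_num)).mul_const _)
    ((S.memLp_z k).integrable_norm_pow (by norm_num)) fun ω => ?_).trans (S.integral_sq_z_le k)
  have := S.norm_dir_le k ω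
  calc ‖S.dir k ω‖ ^ 2 * S.β ^ 2 = (S.β * ‖S.dir k ω‖) ^ 2 := by ring
    _ ≤ ‖S.P.z k ω‖ ^ 2 := by gcongr

lemma integral_sq_est_sub_z_le (k : ℕ) :
    ∫ ω, ‖S.est k ω - S.P.z k ω‖ ^ 2 ∂μ ≤ 4 * prodSigmaJ T S.σJ := by
  have he := (S.memLp_est k).integrable_norm_pow (p := 2) (by norm_num)
  have hz := (S.memLp_z k).integrable_norm_pow (p := 2) (by norm_num)
  calc _ ≤ ∫ ω, (2 * ‖S.est k ω‖ ^ 2 + 2 * ‖S.P.z k ω‖ ^ 2) ∂μ := by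
        refine integral_mono (((S.memLp_est k).sub (S.memLp_z k)).integrable_norm_pow
          (by norm_num)) ((he.const_mul 2).add (hz.const_mul 2)) fun ω => ?_
        have := parallelogram_law_with_norm ℝ (S.est k ω) (S.P.z k ω)
        nlinarith [sq_nonneg ‖S.est k ω + S.P.z k ω‖]
    _ = 2 * ∫ ω, ‖S.est k ω‖ ^ 2 ∂μ + 2 * ∫ ω, ‖S.P.z k ω‖ ^ 2 ∂μ := by
        rw [integral_add (he.const_mul 2) (hz.const_mul 2), integral_const_mul,
          integral_const_mul]
    _ ≤ _ := by linarith [S.integral_sq_est_le k, S.integral_sq_z_le k]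

/-! ### The sampling noise of the function values -/

/-- A sample is centered given the history and all the other samples of the iteration. -/
lemma integral_inner_sample_sub (k : ℕ) (p : Fin T × Fin (S.b k)) {v : Ω → LevelSpace d p.1}
    (hvm : Measurable[S.sampleHistory k p] v) (hv : MemLp v 2 μ) :
    ∫ ω, inner ℝ (v ω) (S.P.G k p.1 p.2 ω - S.f p.1 (S.P.w k (p.1 + 1) ω)) ∂μ = 0 := by
  have hle := S.sampleHistory_le k p
  have hGi := S.oracle.integrable_G k p.1 p.1.2 p.2 p.2.2
  have hfm : Measurable[S.P.history k] fun ω => S.f p.1 (S.P.w k (p.1 + 1) ω) :=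
    (S.measurable_f p.1.2).comp (S.measurable_w k p.1.2)
  have hfm' : Measurable[S.sampleHistory k p] fun ω => S.f p.1 (S.P.w k (p.1 + 1) ω) :=
    hfm.mono le_sup_left le_rfl
  have hfi : Integrable (fun ω => S.f p.1 (S.P.w k (p.1 + 1) ω)) μ :=
    (memLp_comp_lipschitz (S.lip p.1 p.1.2) (S.memLp_w k p.1.2)).integrable (by norm_num)
  have h1 : μ[S.P.G k p.1 p.2 | S.sampleHistory k p] =ᵐ[μ] fun ω => S.f p.1 (S.P.w k (p.1 + 1) ω) :=
    (CondIndepFamily.condExp_sup (E := fun q : Fin T × Fin (S.b k) => LevelSpace d q.1)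
      (Y := fun q : Fin T × Fin (S.b k) => S.P.G k q.1 q.2) (φ := id) (S.history_le k)
      (fun q => S.oracle.measurable_G k q.1 q.1.2 q.2 q.2.2) (S.oracle.indep_G k) p
      stronglyMeasurable_id hGi).trans (S.oracle.unbiased_G k p.1 p.1.2 p.2 p.2.2)
  have h2 : μ[fun ω => S.f p.1 (S.P.w k (p.1 + 1) ω) | S.sampleHistory k p]
      = fun ω => S.f p.1 (S.P.w k (p.1 + 1) ω) :=
    condExp_of_stronglyMeasurable hle hfm'.stronglyMeasurable hfi
  refine integral_inner_eq_zero_of_condExp hle hvm.stronglyMeasurable hv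
    (S.memLp_sample_sub k p.1.2 p.2.2) ?_
  filter_upwards [condExp_sub (m := S.sampleHistory k p) hGi hfi, h1] with ω h3 h1
  refine h3.trans ?_
  rw [Pi.sub_apply, h1, h2]
  simp

/-- The mini-batch noise of a level is orthogonal to the past and to the samples of the other
levels. -/
lemma integral_inner_noise (k : ℕ) {i : ℕ} (hi : i < T) {v : Ω → LevelSpace d i}
    (hvm : Measurable[S.levelHistory k i] v) (hv : MemLp v 2 μ) :
    ∫ ω, inner ℝ (v ω) (S.noise k i ω) ∂μ = 0 := by
  simp only [S.noise_eq, real_inner_smul_right, inner_sum]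
  rw [integral_const_mul, integral_finsetSum _ fun j hj => integrable_inner_of_memLp hv
    (S.memLp_sample_sub k hi (Finset.mem_range.1 hj))]
  rw [Finset.sum_eq_zero, mul_zero]
  intro j hj
  refine S.integral_inner_sample_sub k (⟨i, hi⟩, ⟨j, Finset.mem_range.1 hj⟩)
    (hvm.mono (sup_le_sup_left (iSup₂_le fun q hq => ?_) _) le_rfl) hv
  have hq' : q ≠ (⟨i, hi⟩, ⟨j, Finset.mem_range.1 hj⟩) := by
    rintro rfl
    exact hq rfl
  exact le_iSup₂_of_le q hq' le_rfl

/-- Averaging over a mini-batch divides the variance by its size. -/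
lemma integral_sq_noise_le (k : ℕ) {i : ℕ} (hi : i < T) :
    ∫ ω, ‖S.noise k i ω‖ ^ 2 ∂μ ≤ S.σG i ^ 2 / S.b k := by
  have hb : (0 : ℝ) < S.b k := by exact_mod_cast S.b_pos k
  set D : ℕ → Ω → LevelSpace d i := fun j ω => S.P.G k i j ω - S.f i (S.P.w k (i + 1) ω) with hD
  have hL : ∀ j ∈ Finset.range (S.b k), MemLp (D j) 2 μ := fun j hj =>
    S.memLp_sample_sub k hi (Finset.mem_range.1 hj)
  have horth : ∀ j ∈ Finset.range (S.b k), ∀ j' ∈ Finset.range (S.b k), j' ≠ j →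
      ∫ ω, inner ℝ (D j' ω) (D j ω) ∂μ = 0 := fun j hj j' hj' hne => by
    rw [Finset.mem_range] at hj hj'
    refine S.integral_inner_sample_sub k (⟨i, hi⟩, ⟨j, hj⟩) (v := D j') ?_
      (S.memLp_sample_sub k hi hj')
    refine Measurable.sub ?_ (((S.measurable_f hi).comp (S.measurable_w k hi)).mono
      le_sup_left le_rfl)
    rw [measurable_iff_comap_le]
    exact le_sup_of_le_right (le_iSup₂_of_le (⟨i, hi⟩, ⟨j', hj'⟩) (by simpa using hne) le_rfl)
  have hvar : ∀ j ∈ Finset.range (S.b k), ∫ ω, inner ℝ (D j ω) (D j ω) ∂μ ≤ S.σG i ^ 2 :=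
    fun j hj => by
    simp only [real_inner_self_eq_norm_sq]
    rw [← integral_condExp (S.history_le k)]
    refine (integral_mono_ae integrable_condExp (integrable_const _)
      (S.oracle.variance_G k i hi j (Finset.mem_range.1 hj))).trans ?_
    simp
  have hexp : ∀ ω, ‖S.noise k i ω‖ ^ 2 = ((S.b k : ℝ)⁻¹) ^ 2 *
      ∑ j ∈ Finset.range (S.b k), ∑ j' ∈ Finset.range (S.b k), inner ℝ (D j' ω) (D j ω) :=
    fun ω => by
    rw [S.noise_eq, norm_smul, mul_pow, norm_inv, RCLike.norm_natCast,
      ← real_inner_self_eq_norm_sq, inner_sum]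
    simp only [sum_inner, hD]
  simp only [hexp]
  rw [integral_const_mul, integral_finsetSum _ fun j hj => integrable_finsetSum _ fun j' hj' =>
    integrable_inner_of_memLp (hL j' hj') (hL j hj)]
  have hsum : ∑ j ∈ Finset.range (S.b k), ∫ ω, ∑ j' ∈ Finset.range (S.b k),
      inner ℝ (D j' ω) (D j ω) ∂μ ≤ ∑ j ∈ Finset.range (S.b k), S.σG i ^ 2 := by
    refine Finset.sum_le_sum fun j hj => ?_
    rw [integral_finsetSum _ fun j' hj' => integrable_inner_of_memLp (hL j' hj') (hL j hj),
      Finset.sum_eq_single_of_mem j hj fun j' hj' hne => horth j hj j' hj' hne]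
    exact hvar j hj
  rw [Finset.sum_const, Finset.card_range, nsmul_eq_mul] at hsum
  calc _ ≤ ((S.b k : ℝ)⁻¹) ^ 2 * (S.b k * S.σG i ^ 2) := by gcongr
    _ = _ := by field_simp

end Model

namespace Model

variable {Ω : Type*} [mΩ : MeasurableSpace Ω] {μ : Measure Ω} {d : ℕ → ℕ} {T : ℕ}
  (S : Model μ d T)

/-! ### Descent of the merit function -/

/-- The mean squared length of the direction. -/
def sqDir (k : ℕ) : ℝ := ∫ ω, ‖S.dir k ω‖ ^ 2 ∂μ

/-- The mean squared tracking error of level `i`. -/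
def sqErr (k i : ℕ) : ℝ := ∫ ω, ‖S.err k i ω‖ ^ 2 ∂μ

lemma sqDir_nonneg (k : ℕ) : 0 ≤ S.sqDir k := integral_nonneg fun _ => sq_nonneg _

lemma sqErr_nonneg (k i : ℕ) : 0 ≤ S.sqErr k i := integral_nonneg fun _ => sq_nonneg _

/-- The variation of the argument of `f i` during iteration `k`, seen through `f i`. -/
def shift (k i : ℕ) (ω : Ω) : LevelSpace d i :=
  S.f i (S.P.w (k + 1) (i + 1) ω) - S.f i (S.P.w k (i + 1) ω)

lemma err_succ (k : ℕ) {i : ℕ} (hi : i < T) (ω : Ω) : S.err (k + 1) i ω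
    = ((1 - S.τ k) • S.err k i ω + S.shift k i ω) - S.τ k • S.noise k i ω := by
  have h := S.w_succ_eq k hi ω
  rw [err, h, shift]
  simp only [err, sub_smul, smul_add, one_smul]
  abel

lemma measurable_shift (k : ℕ) {i : ℕ} (hi : i < T) :
    Measurable[S.levelHistory k i] (S.shift k i) :=
  ((S.measurable_f hi).comp (S.measurable_w_succ_levelHistory k hi)).sub
    ((S.measurable_f hi).comp ((S.measurable_w k hi).mono (S.history_le_levelHistory k i) le_rfl))

lemma constC_sq_le {j : ℕ} (hj : j ∈ Finset.Ico 1 T) :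
    (constC T S.Lf S.Lg j : ℝ) ^ 2 ≤ maxCSq T S.Lf S.Lg := by
  have := Finset.le_sup (f := fun j => constC T S.Lf S.Lg j ^ 2) hj
  exact_mod_cast this

/-- Pathwise decrease of `F - η` along one iteration. -/
lemma objective_sub_eta_succ_le (k : ℕ) (ω : Ω) :
    objective S.f T (S.P.x (k + 1) ω) - eta S.X S.β (S.P.x (k + 1) ω) (S.P.z (k + 1) ω)
      ≤ objective S.f T (S.P.x k ω) - eta S.X S.β (S.P.x k ω) (S.P.z k ω)
        + S.τ k * (T * (maxCSq T S.Lf S.Lg : ℝ) / (4 * S.lam) - S.β) * ‖S.dir k ω‖ ^ 2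
        + S.τ k * S.lam * ∑ j ∈ Finset.Ico 1 T, ‖S.err k j ω‖ ^ 2
        - S.τ k * inner ℝ (S.dir k ω) (S.est k ω - S.mean k ω)
        + S.τ k ^ 2 * (lipGradF T S.Lf S.Lg / 2 * ‖S.dir k ω‖ ^ 2
          + 1 / (2 * S.β) * ‖S.est k ω - S.P.z k ω‖ ^ 2) := by
  have hτ := S.step_mem k
  have hlam := S.lam_pos
  have hβ := S.β_pos
  have h1 := descent_lemma (differentiable_objective S.diff)
    (norm_gradient_objective_sub_le S.diff S.lip S.grad) (S.P.x k ω) (S.τ k • S.dir k ω)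
  rw [← S.x_succ_eq] at h1
  have h2 := (S.gen.u_eq k ω).eta_sub_le S.convex hβ (S.gen.u_eq (k + 1) ω)
  have h3 := (S.gen.u_eq k ω).inner_le S.convex hβ (S.x_mem k ω)
  have ex : S.P.x (k + 1) ω - S.P.x k ω = S.τ k • S.dir k ω := by rw [S.x_succ_eq]; abel
  have ez : S.P.z (k + 1) ω - S.P.z k ω = S.τ k • (S.est k ω - S.P.z k ω) := by
    rw [S.z_succ_eq, sub_smul, one_smul, smul_sub]; abel
  rw [ex, ez] at h2
  change inner ℝ (S.P.z k ω) (S.dir k ω) ≤ _ * ‖S.dir k ω‖ ^ 2 at h3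
  change _ ≤ inner ℝ (S.P.z k ω + S.β • S.dir k ω) _ - inner ℝ (S.dir k ω) _ + _ at h2
  have h4 := norm_gradient_sub_prodVec_le S.diff S.lip S.grad fun i => S.P.w k i ω
  simp only [S.gen.w_top] at h4
  change ‖_ - S.mean k ω‖ ≤ ∑ j ∈ Finset.Ico 1 T, (constC T S.Lf S.Lg j : ℝ) * ‖S.err k j ω‖ at h4
  set g := gradient (objective S.f T) (S.P.x k ω)
  set p := S.dir k ω with hp
  -- Young's inequality, level by level.
  have h5 : inner ℝ (g - S.mean k ω) p ≤ S.lam * ∑ j ∈ Finset.Ico 1 T, ‖S.err k j ω‖ ^ 2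
      + T * (maxCSq T S.Lf S.Lg : ℝ) / (4 * S.lam) * ‖p‖ ^ 2 := by
    have hterm : ∀ j ∈ Finset.Ico 1 T, (constC T S.Lf S.Lg j : ℝ) * ‖S.err k j ω‖ * ‖p‖
        ≤ S.lam * ‖S.err k j ω‖ ^ 2 + (maxCSq T S.Lf S.Lg : ℝ) / (4 * S.lam) * ‖p‖ ^ 2 := by
      intro j hj
      have hC := S.constC_sq_le hj
      have e : S.lam * ‖S.err k j ω‖ ^ 2
          + (constC T S.Lf S.Lg j : ℝ) ^ 2 / (4 * S.lam) * ‖p‖ ^ 2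
          - (constC T S.Lf S.Lg j : ℝ) * ‖S.err k j ω‖ * ‖p‖
          = (2 * S.lam * ‖S.err k j ω‖ - constC T S.Lf S.Lg j * ‖p‖) ^ 2 / (4 * S.lam) := by
        field_simp
        ring
      have e2 : 0 ≤ (2 * S.lam * ‖S.err k j ω‖ - constC T S.Lf S.Lg j * ‖p‖) ^ 2
          / (4 * S.lam) := by positivity
      have e3 : (constC T S.Lf S.Lg j : ℝ) ^ 2 / (4 * S.lam) * ‖p‖ ^ 2
          ≤ (maxCSq T S.Lf S.Lg : ℝ) / (4 * S.lam) * ‖p‖ ^ 2 := by gcongr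
      linarith
    calc inner ℝ (g - S.mean k ω) p ≤ ‖g - S.mean k ω‖ * ‖p‖ := real_inner_le_norm _ _
      _ ≤ (∑ j ∈ Finset.Ico 1 T, (constC T S.Lf S.Lg j : ℝ) * ‖S.err k j ω‖) * ‖p‖ := by gcongr
      _ ≤ ∑ j ∈ Finset.Ico 1 T, (S.lam * ‖S.err k j ω‖ ^ 2
          + (maxCSq T S.Lf S.Lg : ℝ) / (4 * S.lam) * ‖p‖ ^ 2) := by
          rw [Finset.sum_mul]; exact Finset.sum_le_sum hterm
      _ = S.lam * ∑ j ∈ Finset.Ico 1 T, ‖S.err k j ω‖ ^ 2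
          + ((T - 1 : ℕ) : ℝ) * ((maxCSq T S.Lf S.Lg : ℝ) / (4 * S.lam) * ‖p‖ ^ 2) := by
          rw [Finset.sum_add_distrib, ← Finset.mul_sum, Finset.sum_const, Nat.card_Ico,
            nsmul_eq_mul]
      _ ≤ S.lam * ∑ j ∈ Finset.Ico 1 T, ‖S.err k j ω‖ ^ 2
          + (T : ℝ) * ((maxCSq T S.Lf S.Lg : ℝ) / (4 * S.lam) * ‖p‖ ^ 2) := by
          gcongr
          exact Nat.sub_le T 1
      _ = _ := by ring
  have e6 : inner ℝ (g - S.mean k ω) p - inner ℝ p (S.est k ω - S.mean k ω)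
      = inner ℝ g p - inner ℝ p (S.est k ω) := by
    rw [inner_sub_left, inner_sub_right, real_inner_comm p (S.mean k ω)]; ring
  rw [real_inner_smul_right, norm_smul, Real.norm_of_nonneg hτ.1.le] at h1
  rw [real_inner_smul_right, real_inner_smul_right, inner_add_left, real_inner_smul_left,
    real_inner_self_eq_norm_sq, inner_sub_right, real_inner_comm (S.P.z k ω) p, norm_smul,
    Real.norm_of_nonneg hτ.1.le] at h2
  have h5' := mul_le_mul_of_nonneg_left h5 hτ.1.le
  have h3' := mul_le_mul_of_nonneg_left h3 hτ.1.le
  have e6' := congrArg (S.τ k * ·) e6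
  simp only [mul_sub] at e6'
  linarith

lemma sq_div_b_le (k i : ℕ) : S.σG i ^ 2 / S.b k ≤ S.σG i ^ 2 :=
  div_le_self (sq_nonneg _) (by exact_mod_cast S.b_pos k)

variable [IsProbabilityMeasure μ]

lemma integrable_sq_dir (k : ℕ) : Integrable (fun ω => ‖S.dir k ω‖ ^ 2) μ :=
  (S.memLp_dir k).integrable_norm_pow (by norm_num)

lemma integrable_sq_err (k : ℕ) {i : ℕ} (hi : i < T) :
    Integrable (fun ω => ‖S.err k i ω‖ ^ 2) μ :=
  (S.memLp_err k hi).integrable_norm_pow (by norm_num)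

lemma integrable_objective_sub_eta (k : ℕ) : Integrable (fun ω => objective S.f T (S.P.x k ω)
    - eta S.X S.β (S.P.x k ω) (S.P.z k ω)) μ := by
  have h1 : MemLp (fun ω => objective S.f T (S.P.x k ω)) 2 μ :=
    memLp_comp_lipschitz (K := ∏ l ∈ Finset.range T, S.Lf l)
      (LipschitzWith.of_dist_le_mul fun x y => by
        rw [dist_eq_norm, dist_eq_norm]
        exact norm_objective_sub_le S.lip x y) (S.memLp_x k)
  have h2 := integrable_inner_of_memLp (S.memLp_z k) (S.memLp_dir k)
  have h3 := (S.integrable_sq_dir k).const_mul (S.β / 2)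
  refine (h1.integrable (by norm_num)).sub ((h2.add h3).congr (.of_forall fun ω => ?_))
  exact (S.gen.u_eq k ω).eta_eq.symm

lemma integral_objective_sub_eta_succ_le (k : ℕ) :
    ∫ ω, (objective S.f T (S.P.x (k + 1) ω)
        - eta S.X S.β (S.P.x (k + 1) ω) (S.P.z (k + 1) ω)) ∂μ
      ≤ ∫ ω, (objective S.f T (S.P.x k ω) - eta S.X S.β (S.P.x k ω) (S.P.z k ω)) ∂μ
        + S.τ k * (T * (maxCSq T S.Lf S.Lg : ℝ) / (4 * S.lam) - S.β) * S.sqDir k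
        + S.τ k * S.lam * ∑ j ∈ Finset.Ico 1 T, S.sqErr k j
        + S.τ k ^ 2 * (1 / 2 * prodSigmaJ T S.σJ
          * (((lipGradF T S.Lf S.Lg : ℝ) + (1 + 4 * S.β ^ 2) * lipGradEta S.β) / S.β ^ 2)) := by
  have hβ := S.β_pos
  have hdiff : MemLp (fun ω => S.est k ω - S.mean k ω) 2 μ := (S.memLp_est k).sub (S.memLp_mean k)
  have i1 := S.integrable_objective_sub_eta k
  have i2 := S.integrable_sq_dir k
  have i3 : Integrable (fun ω => ∑ j ∈ Finset.Ico 1 T, ‖S.err k j ω‖ ^ 2) μ :=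
    integrable_finsetSum _ fun j hj => S.integrable_sq_err k (Finset.mem_Ico.1 hj).2
  have i4 := integrable_inner_of_memLp (S.memLp_dir k) hdiff
  have i5 : Integrable (fun ω => ‖S.est k ω - S.P.z k ω‖ ^ 2) μ :=
    ((S.memLp_est k).sub (S.memLp_z k)).integrable_norm_pow (by norm_num)
  have h0 := S.integral_inner_est_sub_mean k (S.measurable_dir k) (S.memLp_dir k)
  have hmono := integral_mono (S.integrable_objective_sub_eta (k + 1))
    ((((i1.fun_add (i2.const_mul _)).fun_add (i3.const_mul _)).sub' (i4.const_mul _)).fun_add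
      (((i2.const_mul _).fun_add (i5.const_mul _)).const_mul _))
    (S.objective_sub_eta_succ_le k)
  refine hmono.trans ?_
  rw [integral_add (((i1.fun_add (i2.const_mul _)).fun_add (i3.const_mul _)).sub' (i4.const_mul _))
      (((i2.const_mul _).fun_add (i5.const_mul _)).const_mul _),
    integral_sub ((i1.fun_add (i2.const_mul _)).fun_add (i3.const_mul _)) (i4.const_mul _),
    integral_add (i1.fun_add (i2.const_mul _)) (i3.const_mul _), integral_add i1 (i2.const_mul _),
    integral_const_mul, integral_const_mul, integral_const_mul, integral_const_mul,
    integral_add (i2.const_mul _) (i5.const_mul _), integral_const_mul, integral_const_mul, h0,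
    integral_finsetSum _ fun j hj => S.integrable_sq_err k (Finset.mem_Ico.1 hj).2]
  have h1 := S.integral_sq_dir_le k
  have h2 := S.integral_sq_est_sub_z_le k
  have hη : 1 / S.β ≤ lipGradEta S.β := by
    have h : 1 + 1 / (2 * S.β) ≤ √((1 + S.β) ^ 2 + (1 + 1 / (2 * S.β)) ^ 2) :=
      Real.le_sqrt_of_sq_le (by nlinarith [sq_nonneg (1 + S.β)])
    have e : 1 / S.β = 2 * (1 / (2 * S.β)) := by field_simp
    rw [lipGradEta, e]
    linarith
  have hη0 : 0 ≤ lipGradEta S.β := le_trans (by positivity) hη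
  have hPJ : 0 ≤ prodSigmaJ T S.σJ := prodSigmaJ_nonneg _ _
  have key : (lipGradF T S.Lf S.Lg / 2 : ℝ) * ∫ ω, ‖S.dir k ω‖ ^ 2 ∂μ
      + 1 / (2 * S.β) * ∫ ω, ‖S.est k ω - S.P.z k ω‖ ^ 2 ∂μ
      ≤ 1 / 2 * prodSigmaJ T S.σJ
        * (((lipGradF T S.Lf S.Lg : ℝ) + (1 + 4 * S.β ^ 2) * lipGradEta S.β) / S.β ^ 2) := by
    calc _ ≤ (lipGradF T S.Lf S.Lg / 2 : ℝ) * (prodSigmaJ T S.σJ / S.β ^ 2)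
          + 1 / (2 * S.β) * (4 * prodSigmaJ T S.σJ) := by gcongr
      _ = (lipGradF T S.Lf S.Lg / 2 : ℝ) * (prodSigmaJ T S.σJ / S.β ^ 2)
          + 2 * prodSigmaJ T S.σJ * (1 / S.β) := by field_simp; ring
      _ ≤ (lipGradF T S.Lf S.Lg / 2 : ℝ) * (prodSigmaJ T S.σJ / S.β ^ 2)
          + 2 * prodSigmaJ T S.σJ * lipGradEta S.β
          + 1 / 2 * prodSigmaJ T S.σJ * (lipGradEta S.β / S.β ^ 2) := by
          have : 0 ≤ 1 / 2 * prodSigmaJ T S.σJ * (lipGradEta S.β / S.β ^ 2) := by positivity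
          have := mul_le_mul_of_nonneg_left hη (mul_nonneg zero_le_two hPJ)
          linarith
      _ = _ := by field_simp; ring
  have := mul_le_mul_of_nonneg_left key (sq_nonneg (S.τ k))
  simp only [sqDir, sqErr]
  linarith

lemma memLp_shift (k : ℕ) {i : ℕ} (hi : i < T) : MemLp (S.shift k i) 2 μ :=
  (memLp_comp_lipschitz (S.lip i hi) (S.memLp_w (k + 1) hi)).sub
    (memLp_comp_lipschitz (S.lip i hi) (S.memLp_w k hi))

/-- The tracking error contracts, up to the shift of the argument and the noise. The noise is
uncorrelated with the shift because distinct levels are sampled independently. -/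
lemma sqErr_succ_le_shift (k : ℕ) {i : ℕ} (hi : i < T) :
    S.sqErr (k + 1) i ≤ (1 - S.τ k) * S.sqErr k i + (S.τ k)⁻¹ * ∫ ω, ‖S.shift k i ω‖ ^ 2 ∂μ
      + S.τ k ^ 2 * (S.σG i ^ 2 / S.b k) := by
  have hτ := S.step_mem k
  set v : Ω → LevelSpace d i := fun ω => (1 - S.τ k) • S.err k i ω + S.shift k i ω with hv
  have hvL : MemLp v 2 μ := by
    simpa only [one_smul] using
      memLp_smul_add_smul (S.memLp_err k hi) (S.memLp_shift k hi) (1 - S.τ k) 1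
  have hvm : Measurable[S.levelHistory k i] v := by
    simpa only [one_smul] using measurable_smul_add_smul
      ((S.measurable_err k hi).mono (S.history_le_levelHistory k i) le_rfl)
      (S.measurable_shift k hi) (1 - S.τ k) 1
  have h0 := S.integral_inner_noise k hi hvm hvL
  have i1 := S.integrable_sq_err k hi
  have i2 := (S.memLp_shift k hi).integrable_norm_pow (p := 2) (by norm_num)
  have i3 := integrable_inner_of_memLp hvL (S.memLp_noise k hi)
  have i4 := (S.memLp_noise k hi).integrable_norm_pow (p := 2) (by norm_num)
  have hpt : ∀ ω, ‖S.err (k + 1) i ω‖ ^ 2 ≤ (1 - S.τ k) * ‖S.err k i ω‖ ^ 2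
      + (S.τ k)⁻¹ * ‖S.shift k i ω‖ ^ 2 - 2 * S.τ k * inner ℝ (v ω) (S.noise k i ω)
      + S.τ k ^ 2 * ‖S.noise k i ω‖ ^ 2 := fun ω => by
    have h1 := norm_sq_convex_comb_le hτ.1.le hτ.2 (S.err k i ω) ((S.τ k)⁻¹ • S.shift k i ω)
    rw [smul_smul, mul_inv_cancel₀ hτ.1.ne', one_smul, norm_smul, norm_inv,
      Real.norm_of_nonneg hτ.1.le, mul_pow] at h1
    have e : S.τ k * ((S.τ k)⁻¹ ^ 2 * ‖S.shift k i ω‖ ^ 2)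
        = (S.τ k)⁻¹ * ‖S.shift k i ω‖ ^ 2 := by
      have := hτ.1.ne'
      field_simp
    rw [S.err_succ k hi, norm_sub_sq_real, real_inner_smul_right, norm_smul,
      Real.norm_of_nonneg hτ.1.le, mul_pow]
    rw [e] at h1
    linarith
  refine (integral_mono (S.integrable_sq_err (k + 1) hi)
    ((((i1.const_mul _).fun_add (i2.const_mul _)).sub' (i3.const_mul _)).fun_add (i4.const_mul _))
    hpt).trans ?_
  rw [integral_add (((i1.const_mul _).fun_add (i2.const_mul _)).sub' (i3.const_mul _))
      (i4.const_mul _), integral_sub ((i1.const_mul _).fun_add (i2.const_mul _)) (i3.const_mul _),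
    integral_add (i1.const_mul _) (i2.const_mul _), integral_const_mul, integral_const_mul,
    integral_const_mul, integral_const_mul, h0, mul_zero, sub_zero]
  simp only [sqErr]
  gcongr
  exact S.integral_sq_noise_le k hi

lemma integral_sq_shift_le (k : ℕ) {i : ℕ} (hi : i + 1 < T) :
    ∫ ω, ‖S.shift k i ω‖ ^ 2 ∂μ ≤ (S.Lf i : ℝ) ^ 2 * S.τ k ^ 2
      * (S.sqErr k (i + 1) + S.σG (i + 1) ^ 2 / S.b k) := by
  have hτ := S.step_mem k
  have hi' : i < T := by omega
  have hem : Measurable[S.levelHistory k (i + 1)] (S.err k (i + 1)) :=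
    (S.measurable_err k hi).mono (S.history_le_levelHistory k (i + 1)) le_rfl
  have h0 := S.integral_inner_noise k hi hem (S.memLp_err k hi)
  have i1 := S.integrable_sq_err k hi
  have i3 := integrable_inner_of_memLp (S.memLp_err k hi) (S.memLp_noise k hi)
  have i4 := (S.memLp_noise k hi).integrable_norm_pow (p := 2) (by norm_num)
  have hpt : ∀ ω, ‖S.shift k i ω‖ ^ 2 ≤ (S.Lf i : ℝ) ^ 2 * S.τ k ^ 2
      * (‖S.err k (i + 1) ω‖ ^ 2 + 2 * inner ℝ (S.err k (i + 1) ω) (S.noise k (i + 1) ω)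
        + ‖S.noise k (i + 1) ω‖ ^ 2) := fun ω => by
    have h := (S.lip i hi').norm_sub_le (S.P.w (k + 1) (i + 1) ω) (S.P.w k (i + 1) ω)
    rw [S.w_succ_eq k hi, add_sub_cancel_left, norm_smul, Real.norm_of_nonneg hτ.1.le] at h
    rw [← norm_add_sq_real]
    calc ‖S.shift k i ω‖ ^ 2
        ≤ (S.Lf i * (S.τ k * ‖S.err k (i + 1) ω + S.noise k (i + 1) ω‖)) ^ 2 := by
          rw [shift, S.w_succ_eq k hi]; gcongr
      _ = _ := by ring
  refine (integral_mono ((S.memLp_shift k hi').integrable_norm_pow (by norm_num))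
    (((i1.fun_add (i3.const_mul _)).fun_add i4).const_mul _) hpt).trans ?_
  rw [integral_const_mul, integral_add (i1.fun_add (i3.const_mul _)) i4,
    integral_add i1 (i3.const_mul _), integral_const_mul, h0, mul_zero, add_zero]
  simp only [sqErr]
  gcongr
  exact S.integral_sq_noise_le k hi

/-- The innermost level sees the deterministic displacement of `x`. -/
lemma integral_sq_shift_last_le (k : ℕ) :
    ∫ ω, ‖S.shift k (T - 1) ω‖ ^ 2 ∂μ ≤ (S.Lf (T - 1) : ℝ) ^ 2 * S.τ k ^ 2 * S.sqDir k := by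
  have hτ := S.step_mem k
  have hT := S.two_le
  have hi : T - 1 < T := by omega
  rw [sqDir, ← integral_const_mul]
  refine integral_mono ((S.memLp_shift k hi).integrable_norm_pow (by norm_num))
    ((S.integrable_sq_dir k).const_mul _) fun ω => ?_
  have h := (S.lip _ hi).norm_sub_le (S.P.w (k + 1) (T - 1 + 1) ω) (S.P.w k (T - 1 + 1) ω)
  have e : ‖S.P.w (k + 1) (T - 1 + 1) ω - S.P.w k (T - 1 + 1) ω‖ = S.τ k * ‖S.dir k ω‖ := by
    have key : ∀ t, t = T → ‖S.P.w (k + 1) t ω - S.P.w k t ω‖ = S.τ k * ‖S.dir k ω‖ := by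
      rintro t rfl
      rw [S.gen.w_top, S.gen.w_top, S.x_succ_eq, add_sub_cancel_left, norm_smul,
        Real.norm_of_nonneg hτ.1.le]
    exact key _ (by omega)
  rw [e] at h
  calc ‖S.shift k (T - 1) ω‖ ^ 2 ≤ (S.Lf (T - 1) * (S.τ k * ‖S.dir k ω‖)) ^ 2 := by
        rw [shift]; gcongr
    _ = _ := by ring

lemma sqErr_succ_le (k : ℕ) {i : ℕ} (hi : i + 1 < T) :
    S.sqErr (k + 1) i ≤ (1 - S.τ k) * S.sqErr k i
      + S.τ k * (S.Lf i : ℝ) ^ 2 * S.sqErr k (i + 1)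
      + S.τ k ^ 2 * (S.σG i ^ 2 + S.σG (i + 1) ^ 2) := by
  have hτ := S.step_mem k
  have h1 := S.sqErr_succ_le_shift k (i := i) (by omega)
  have h2 := mul_le_mul_of_nonneg_left (S.integral_sq_shift_le k hi) (inv_nonneg.2 hτ.1.le)
  have h3 := mul_le_mul_of_nonneg_left (S.sq_div_b_le k i) (sq_nonneg (S.τ k))
  -- The batch size is chosen so that the propagated variance is of order `τ ^ 2`.
  have h4 := mul_le_mul_of_nonneg_left (S.sq_Lf_div_le k (i := i) (by omega))
    (mul_nonneg hτ.1.le (sq_nonneg (S.σG (i + 1))))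
  have e : (S.τ k)⁻¹ * ((S.Lf i : ℝ) ^ 2 * S.τ k ^ 2
      * (S.sqErr k (i + 1) + S.σG (i + 1) ^ 2 / S.b k))
      = S.τ k * (S.Lf i : ℝ) ^ 2 * S.sqErr k (i + 1)
        + S.τ k * S.σG (i + 1) ^ 2 * ((S.Lf i : ℝ) ^ 2 / S.b k) := by
    have := hτ.1.ne'
    field_simp
  rw [e] at h2
  linarith

lemma sqErr_succ_last_le (k : ℕ) :
    S.sqErr (k + 1) (T - 1) ≤ (1 - S.τ k) * S.sqErr k (T - 1)
      + S.τ k * (S.Lf (T - 1) : ℝ) ^ 2 * S.sqDir k + S.τ k ^ 2 * S.σG (T - 1) ^ 2 := by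
  have hτ := S.step_mem k
  have hT := S.two_le
  have h1 := S.sqErr_succ_le_shift k (i := T - 1) (by omega)
  have h2 := mul_le_mul_of_nonneg_left (S.integral_sq_shift_last_le k) (inv_nonneg.2 hτ.1.le)
  have h3 := mul_le_mul_of_nonneg_left (S.sq_div_b_le k (T - 1)) (sq_nonneg (S.τ k))
  have e : (S.τ k)⁻¹ * ((S.Lf (T - 1) : ℝ) ^ 2 * S.τ k ^ 2 * S.sqDir k)
      = S.τ k * (S.Lf (T - 1) : ℝ) ^ 2 * S.sqDir k := by
    have := hτ.1.ne'
    field_simp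
  rw [e] at h2
  linarith

/-- The mean value of the merit function, without the constant `F*`. -/
def potential (k : ℕ) : ℝ :=
  ∫ ω, (objective S.f T (S.P.x k ω) - eta S.X S.β (S.P.x k ω) (S.P.z k ω)) ∂μ
    + ∑ i ∈ Finset.range T, gammaWeight T S.Lf S.lam i * S.sqErr k i

/-- The mean squares that the merit function controls. -/
def total (k : ℕ) : ℝ := S.sqDir k + ∑ i ∈ Finset.range T, S.sqErr k i

/-- The merit function decreases on average. -/
lemma potential_succ_le (k : ℕ) :
    S.potential (k + 1) ≤ S.potential k - S.τ k * S.lam * S.total k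
      + S.τ k ^ 2 * sigmaSq T S.Lf S.Lg S.lam S.β S.σG S.σJ := by
  have hτ := S.step_mem k
  obtain ⟨t, ht⟩ : ∃ t, T = t + 1 := ⟨T - 1, by have := S.two_le; omega⟩
  have h1 := S.integral_objective_sub_eta_succ_le k
  set γ := gammaWeight T S.Lf S.lam with hγ
  have hγ0 : ∀ i, 0 ≤ γ i := S.gammaWeight_nonneg
  have hγz : γ 0 = S.lam := by simp [hγ, gammaWeight]
  have hrange : ∀ g : ℕ → ℝ, ∑ i ∈ Finset.range T, g i
      = ∑ i ∈ Finset.range t, g i + g t := fun g => by rw [ht, Finset.sum_range_succ]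
  have hrange' : ∀ g : ℕ → ℝ, ∑ i ∈ Finset.range T, g i
      = ∑ i ∈ Finset.range t, g (i + 1) + g 0 := fun g => by rw [ht, Finset.sum_range_succ']
  have hIco : ∑ j ∈ Finset.Ico 1 T, S.sqErr k j = ∑ i ∈ Finset.range t, S.sqErr k (i + 1) := by
    rw [Finset.sum_Ico_eq_sum_range]
    simp only [ht, Nat.add_sub_cancel, Nat.add_comm 1]
  have ht1 : T - 1 = t := by omega
  -- Sum the level-wise recursions with the weights `γ`.
  have h2 : ∑ i ∈ Finset.range T, γ i * S.sqErr (k + 1) i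
      ≤ (1 - S.τ k) * ∑ i ∈ Finset.range T, γ i * S.sqErr k i
        + S.τ k * (∑ i ∈ Finset.range t, γ i * (S.Lf i : ℝ) ^ 2 * S.sqErr k (i + 1)
          + γ t * (S.Lf t : ℝ) ^ 2 * S.sqDir k)
        + S.τ k ^ 2 * (∑ i ∈ Finset.range T, γ i * S.σG i ^ 2
          + ∑ i ∈ Finset.range t, γ i * S.σG (i + 1) ^ 2) := by
    rw [hrange, hrange fun i => γ i * S.sqErr k i, hrange fun i => γ i * S.σG i ^ 2]
    have hlast := S.sqErr_succ_last_le k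
    rw [ht1] at hlast
    have hlast' := mul_le_mul_of_nonneg_left hlast (hγ0 t)
    have hsum : ∑ i ∈ Finset.range t, γ i * S.sqErr (k + 1) i
        ≤ ∑ i ∈ Finset.range t, ((1 - S.τ k) * (γ i * S.sqErr k i)
          + S.τ k * (γ i * (S.Lf i : ℝ) ^ 2 * S.sqErr k (i + 1))
          + S.τ k ^ 2 * (γ i * S.σG i ^ 2 + γ i * S.σG (i + 1) ^ 2)) := by
      refine Finset.sum_le_sum fun i hi => ?_
      have h := S.sqErr_succ_le k (i := i) (by simp at hi; omega)
      have := mul_le_mul_of_nonneg_left h (hγ0 i)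
      linarith
    rw [Finset.sum_add_distrib, Finset.sum_add_distrib, ← Finset.mul_sum, ← Finset.mul_sum,
      ← Finset.mul_sum, Finset.sum_add_distrib] at hsum
    linarith
  -- The weights increase fast enough to leave `2 * lam` of every tracking error.
  have h3 : ∑ i ∈ Finset.range t, γ i * (S.Lf i : ℝ) ^ 2 * S.sqErr k (i + 1)
      ≤ ∑ i ∈ Finset.range t, γ (i + 1) * S.sqErr k (i + 1)
        - 2 * S.lam * ∑ i ∈ Finset.range t, S.sqErr k (i + 1) := by
    rw [Finset.mul_sum, ← Finset.sum_sub_distrib]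
    refine Finset.sum_le_sum fun i hi => ?_
    have h := S.param.lam_le (i + 1) (by omega) (by simp at hi; omega)
    rw [Nat.add_sub_cancel] at h
    have := mul_le_mul_of_nonneg_right h (S.sqErr_nonneg k (i + 1))
    linarith
  have h4 := S.param.beta_ge
  rw [ht1] at h4
  have h5 := mul_le_mul_of_nonneg_right h4 (S.sqDir_nonneg k)
  have e1 := hrange' fun i => γ i * S.sqErr k i
  have e2 := hrange' fun i => S.sqErr k i
  simp only [hγz] at e1
  unfold potential total sigmaSq
  rw [← hγ, ht1]
  rw [hIco] at h1
  have h3' := mul_le_mul_of_nonneg_left h3 hτ.1.le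
  have h5' := mul_le_mul_of_nonneg_left h5 hτ.1.le
  rw [e2]
  have e1' := congrArg (S.τ k * ·) e1
  beta_reduce at e1'
  linarith

lemma le_potential {c : ℝ} (hc : ∀ x ∈ S.X, c ≤ objective S.f T x) (k : ℕ) :
    c ≤ S.potential k := by
  have h1 : c ≤ ∫ ω, (objective S.f T (S.P.x k ω)
      - eta S.X S.β (S.P.x k ω) (S.P.z k ω)) ∂μ := by
    have := integral_mono (integrable_const c) (S.integrable_objective_sub_eta k) fun ω => by
      have h1 := hc _ (S.x_mem k ω)
      have h2 := (S.gen.u_eq k ω).eta_nonpos (S.x_mem k ω)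
      change c ≤ objective S.f T (S.P.x k ω) - eta S.X S.β (S.P.x k ω) (S.P.z k ω)
      linarith
    simpa using this
  have h2 : 0 ≤ ∑ i ∈ Finset.range T, gammaWeight T S.Lf S.lam i * S.sqErr k i :=
    Finset.sum_nonneg fun i _ => mul_nonneg (S.gammaWeight_nonneg i) (S.sqErr_nonneg k i)
  unfold potential
  linarith

lemma potential_zero (c : ℝ) : S.potential 0 - c
    = merit S.f T S.X S.β c (gammaWeight T S.Lf S.lam) S.x0 S.z0 S.w0 := by
  have hw : ∀ i ≤ T, ∀ ω, S.P.w 0 i ω = S.w0 i := fun i hi ω => by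
    rcases hi.lt_or_eq with hi | rfl
    · exact S.gen.w_zero i hi ω
    · rw [S.gen.w_top, S.gen.x_zero, S.w0_top]
  have h : ∀ i ∈ Finset.range T, gammaWeight T S.Lf S.lam i * S.sqErr 0 i
      = gammaWeight T S.Lf S.lam i * ‖S.f i (S.w0 (i + 1)) - S.w0 i‖ ^ 2 := fun i hi => by
    rw [Finset.mem_range] at hi
    simp [sqErr, err, hw i hi.le, hw (i + 1) hi]
  rw [potential, merit, Finset.sum_congr rfl h]
  simp only [S.gen.x_zero, S.gen.z_zero]
  simp
  ring

/-- Summation of the descent of the merit function. -/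
lemma lam_mul_sum_total_le {c : ℝ} (hc : ∀ x ∈ S.X, c ≤ objective S.f T x) (n : ℕ) :
    S.lam * ∑ k ∈ Finset.range n, S.τ k * S.total k ≤ S.potential 0 - c
      + sigmaSq T S.Lf S.Lg S.lam S.β S.σG S.σJ * ∑ k ∈ Finset.range n, S.τ k ^ 2 := by
  have h : S.lam * ∑ k ∈ Finset.range n, S.τ k * S.total k ≤ S.potential 0 - S.potential n
      + sigmaSq T S.Lf S.Lg S.lam S.β S.σG S.σJ * ∑ k ∈ Finset.range n, S.τ k ^ 2 := by
    induction n with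
    | zero => simp
    | succ n ih =>
      rw [Finset.sum_range_succ, Finset.sum_range_succ]
      linarith [S.potential_succ_le n]
  linarith [S.le_potential hc n]

end Model

/-! ### Summation of linear recursions -/

lemma sum_Icc_mul_Gam {τ : ℕ → ℝ} (hτ0 : τ 0 = 1) (N : ℕ) :
    ∑ i ∈ Finset.Icc 1 N, τ i * Gam τ i = 1 - ∏ l ∈ Finset.Ico 1 (N + 1), (1 - τ l) := by
  induction N with
  | zero => simp
  | succ N ih =>
    rw [Finset.sum_Icc_succ_top (by omega), ih,
      Finset.prod_Ico_succ_top (show 1 ≤ N + 1 by omega), Gam, if_pos hτ0]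
    ring

/-- Only the instance `k = 0` of the condition on `Γ` matters. -/
lemma GammaCondition.one_sub_prod_le {τ : ℕ → ℝ} {c : ℝ} (h : GammaCondition τ c) (hτ0 : τ 0 = 1)
    {N : ℕ} (hN : 1 ≤ N) : 1 - ∏ l ∈ Finset.Ico 1 (N + 1), (1 - τ l) ≤ c := by
  have := h 0 N hN
  rw [zero_add, sum_Icc_mul_Gam hτ0] at this
  simpa [Gam, hτ0] using this

/-- Unrolling `E (k + 1) ≤ (1 - τ k) E k + h k`: the term `h i` enters `∑ τ k E k` with the
telescoping weight `1 - ∏ (1 - τ l)`, the product being over `i < l ≤ N`. -/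
lemma sum_mul_le_of_recursion {τ E h : ℕ → ℝ} {c : ℝ} (hτ : ∀ k, 0 < τ k ∧ τ k ≤ 1)
    (hτ0 : τ 0 = 1) (hh : ∀ k, 0 ≤ h k) (hrec : ∀ k, E (k + 1) ≤ (1 - τ k) * E k + h k) {N : ℕ}
    (hc : 1 - ∏ l ∈ Finset.Ico 1 (N + 1), (1 - τ l) ≤ c) :
    ∑ k ∈ Finset.Icc 1 N, τ k * E k ≤ c * ∑ k ∈ Finset.range N, h k := by
  let q : ℕ → ℝ := fun m => 1 - ∏ l ∈ Finset.Ico m (N + 1), (1 - τ l)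
  have hfac : ∀ l, 0 ≤ 1 - τ l ∧ 1 - τ l ≤ 1 := fun l => by
    have := hτ l; constructor <;> linarith
  have hq0 : ∀ m, 0 ≤ q m := fun m =>
    sub_nonneg.2 (Finset.prod_le_one (fun l _ => (hfac l).1) fun l _ => (hfac l).2)
  have hqc : ∀ m, 1 ≤ m → m ≤ N + 1 → q m ≤ c := fun m h1 h2 => by
    refine le_trans ?_ hc
    rw [← Finset.prod_Ico_consecutive _ h1 h2]
    have h3 : ∏ l ∈ Finset.Ico 1 m, (1 - τ l) ≤ 1 :=
      Finset.prod_le_one (fun l _ => (hfac l).1) fun l _ => (hfac l).2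
    have h4 : 0 ≤ ∏ l ∈ Finset.Ico m (N + 1), (1 - τ l) :=
      Finset.prod_nonneg fun l _ => (hfac l).1
    simp only [q]
    nlinarith
  have hqs : ∀ m, m ≤ N → q m = τ m + (1 - τ m) * q (m + 1) := fun m hm => by
    simp only [q]
    rw [Finset.prod_eq_prod_Ico_succ_bot (by omega)]
    ring
  have hqN : q (N + 1) = 0 := by simp [q]
  have key : ∀ n, 1 ≤ n → n ≤ N + 1 →
      ∑ k ∈ Finset.Ico 1 n, τ k * E k + q n * E n ≤ ∑ i ∈ Finset.range n, q (i + 1) * h i := by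
    intro n hn
    induction n, hn using Nat.le_induction with
    | base =>
      intro _
      have h1 := mul_le_mul_of_nonneg_left (hrec 0) (hq0 1)
      rw [hτ0, sub_self, zero_mul, zero_add] at h1
      simpa using h1
    | succ n hn ih =>
      intro hnN
      have h1 := mul_le_mul_of_nonneg_left (hrec n) (hq0 (n + 1))
      have h2 := ih (by omega)
      rw [hqs n (by omega)] at h2
      rw [Finset.sum_Ico_succ_top hn, Finset.sum_range_succ]
      linarith
  have h1 := key (N + 1) (by omega) le_rfl
  rw [hqN, zero_mul, add_zero, Finset.sum_range_succ, hqN, zero_mul, add_zero] at h1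
  refine le_trans (le_of_eq ?_) (h1.trans ?_)
  · rfl
  · rw [Finset.mul_sum]
    refine Finset.sum_le_sum fun i hi => ?_
    exact mul_le_mul_of_nonneg_right (hqc _ (by omega) (by simp at hi; omega)) (hh i)

namespace Model

variable {Ω : Type*} [mΩ : MeasurableSpace Ω] {μ : Measure Ω} {d : ℕ → ℕ} {T : ℕ}
  (S : Model μ d T)

/-! ### The stationarity measure -/

lemma measurable_gradient_x (k : ℕ) :
    Measurable[S.P.history k] fun ω => gradient (objective S.f T) (S.P.x k ω) :=
  S.continuous_gradient_objective.measurable.comp (S.measurable_x k)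

lemma measurable_sq_gradient_sub_z (k : ℕ) : Measurable[S.P.history k]
    fun ω => ‖gradient (objective S.f T) (S.P.x k ω) - S.P.z k ω‖ ^ 2 :=
  measurable_sq_norm ((S.measurable_gradient_x k).sub (S.measurable_z k))

lemma measurable_stationarity (k : ℕ) : Measurable[S.P.history k]
    fun ω => stationarity S.X (objective S.f T) (S.P.x k ω) (S.P.z k ω) := by
  have h : Measurable[S.P.history k] fun ω => subSolution S.X 1 (S.P.x k ω) (S.P.z k ω) :=
    measurable_subSolution S.closed S.convex ⟨_, S.x0_mem⟩ one_pos (S.measurable_x k)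
      (S.measurable_z k)
  exact measurable_comp_pair (F := fun a b : ℝ => a + b) measurable_add
    (measurable_sq_norm (h.sub (S.measurable_x k)))
    (measurable_sq_norm ((S.measurable_z k).sub (S.measurable_gradient_x k)))

lemma stationarity_le (k : ℕ) (ω : Ω) :
    stationarity S.X (objective S.f T) (S.P.x k ω) (S.P.z k ω) ≤ max 1 (S.β ^ 2)
      * ‖S.dir k ω‖ ^ 2 + ‖gradient (objective S.f T) (S.P.x k ω) - S.P.z k ω‖ ^ 2 := by
  unfold stationarity
  rw [norm_sub_rev (S.P.z k ω)]
  gcongr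
  exact (S.gen.u_eq k ω).sq_norm_le S.convex S.β_pos
    (isSubSolution_subSolution S.closed S.convex ⟨_, S.x0_mem⟩ one_pos _ _)

lemma stationarity_nonneg (k : ℕ) (ω : Ω) :
    0 ≤ stationarity S.X (objective S.f T) (S.P.x k ω) (S.P.z k ω) :=
  add_nonneg (sq_nonneg _) (sq_nonneg _)

/-! ### Gradient tracking -/

/-- The mean squared error of `z` as an estimate of the gradient. -/
def track (k : ℕ) : ℝ := ∫ ω, ‖gradient (objective S.f T) (S.P.x k ω) - S.P.z k ω‖ ^ 2 ∂μ

lemma sqDir_le_total (k : ℕ) : S.sqDir k ≤ S.total k :=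
  le_add_of_nonneg_right (Finset.sum_nonneg fun i _ => S.sqErr_nonneg k i)

lemma sqErr_le_total (k : ℕ) {i : ℕ} (hi : i < T) : S.sqErr k i ≤ S.total k :=
  (Finset.single_le_sum (f := fun i => S.sqErr k i) (fun i _ => S.sqErr_nonneg k i)
    (Finset.mem_range.2 hi)).trans (le_add_of_nonneg_left (S.sqDir_nonneg k))

lemma total_nonneg (k : ℕ) : 0 ≤ S.total k := (S.sqDir_nonneg k).trans (S.sqDir_le_total k)

/-- The part of the drift of the gradient estimate that is known in advance: the bias of the
estimate and the scaled variation of the gradient. -/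
def drift (k : ℕ) (ω : Ω) : LevelSpace d T :=
  (gradient (objective S.f T) (S.P.x k ω) - S.mean k ω)
    + (S.τ k)⁻¹ • (gradient (objective S.f T) (S.P.x (k + 1) ω)
      - gradient (objective S.f T) (S.P.x k ω))

lemma sq_norm_drift_le (k : ℕ) (ω : Ω) : ‖S.drift k ω‖ ^ 2 ≤ 2 * (constLSq T S.Lf S.Lg : ℝ)
    * ((T : ℝ) - 1) * (‖S.dir k ω‖ ^ 2 + ∑ i ∈ Finset.range T, ‖S.err k i ω‖ ^ 2) := by
  have hτ := S.step_mem k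
  have hT := S.two_le
  have hT' : (1 : ℝ) ≤ (T : ℝ) - 1 := by
    have : (2 : ℝ) ≤ T := by exact_mod_cast hT
    linarith
  set L2 : ℝ := (constLSq T S.Lf S.Lg : ℝ) with hL2
  have hL0 : 0 ≤ L2 := NNReal.coe_nonneg _
  have hLF : (lipGradF T S.Lf S.Lg : ℝ) ^ 2 ≤ L2 := by
    have h : lipGradF T S.Lf S.Lg ^ 2 ≤ constLSq T S.Lf S.Lg := le_max_left _ _
    exact_mod_cast h
  have hLC : (maxCSq T S.Lf S.Lg : ℝ) ≤ L2 := by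
    have h : maxCSq T S.Lf S.Lg ≤ constLSq T S.Lf S.Lg := le_max_right _ _
    exact_mod_cast h
  have h4 := norm_gradient_sub_prodVec_le S.diff S.lip S.grad fun i => S.P.w k i ω
  simp only [S.gen.w_top] at h4
  change ‖_ - S.mean k ω‖ ≤ ∑ j ∈ Finset.Ico 1 T, (constC T S.Lf S.Lg j : ℝ) * ‖S.err k j ω‖ at h4
  have h5 := norm_gradient_objective_sub_le S.diff S.lip S.grad (S.P.x (k + 1) ω) (S.P.x k ω)
  unfold drift
  set a := gradient (objective S.f T) (S.P.x k ω) - S.mean k ω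
  set g := gradient (objective S.f T) (S.P.x (k + 1) ω) - gradient (objective S.f T) (S.P.x k ω)
  have ha : ‖a‖ ^ 2 ≤ ((T : ℝ) - 1) * L2 * ∑ i ∈ Finset.range T, ‖S.err k i ω‖ ^ 2 := by
    calc ‖a‖ ^ 2 ≤ (∑ j ∈ Finset.Ico 1 T, (constC T S.Lf S.Lg j : ℝ) * ‖S.err k j ω‖) ^ 2 := by
          gcongr
      _ ≤ ((Finset.Ico 1 T).card : ℝ) * ∑ j ∈ Finset.Ico 1 T,
          ((constC T S.Lf S.Lg j : ℝ) * ‖S.err k j ω‖) ^ 2 := sq_sum_le_card_mul_sum_sq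
      _ ≤ ((T : ℝ) - 1) * ∑ j ∈ Finset.Ico 1 T, L2 * ‖S.err k j ω‖ ^ 2 := by
          rw [Nat.card_Ico, Nat.cast_sub (by omega), Nat.cast_one]
          refine mul_le_mul_of_nonneg_left (Finset.sum_le_sum fun j hj => ?_) (by linarith)
          rw [mul_pow]
          exact mul_le_mul_of_nonneg_right ((S.constC_sq_le hj).trans hLC) (sq_nonneg _)
      _ = ((T : ℝ) - 1) * L2 * ∑ j ∈ Finset.Ico 1 T, ‖S.err k j ω‖ ^ 2 := by
          rw [← Finset.mul_sum]; ring
      _ ≤ ((T : ℝ) - 1) * L2 * ∑ i ∈ Finset.range T, ‖S.err k i ω‖ ^ 2 := by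
          refine mul_le_mul_of_nonneg_left (Finset.sum_le_sum_of_subset_of_nonneg
            (fun j hj => ?_) fun _ _ _ => sq_nonneg _) (mul_nonneg (by linarith) hL0)
          simp only [Finset.mem_Ico, Finset.mem_range] at hj ⊢
          exact hj.2
  have hg : ‖(S.τ k)⁻¹ • g‖ ^ 2 ≤ ((T : ℝ) - 1) * L2 * ‖S.dir k ω‖ ^ 2 := by
    rw [S.x_succ_eq, add_sub_cancel_left, norm_smul, Real.norm_of_nonneg hτ.1.le] at h5
    have h6 : ‖(S.τ k)⁻¹ • g‖ ≤ lipGradF T S.Lf S.Lg * ‖S.dir k ω‖ := by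
      rw [norm_smul, norm_inv, Real.norm_of_nonneg hτ.1.le, inv_mul_le_iff₀ hτ.1]
      linarith
    calc _ ≤ (lipGradF T S.Lf S.Lg * ‖S.dir k ω‖) ^ 2 := by gcongr
      _ = (lipGradF T S.Lf S.Lg : ℝ) ^ 2 * ‖S.dir k ω‖ ^ 2 := by ring
      _ ≤ L2 * ‖S.dir k ω‖ ^ 2 := by gcongr
      _ ≤ ((T : ℝ) - 1) * L2 * ‖S.dir k ω‖ ^ 2 := by
          rw [mul_assoc]
          exact le_mul_of_one_le_left (by positivity) hT'
  have hp := parallelogram_law_with_norm ℝ a ((S.τ k)⁻¹ • g)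
  nlinarith [sq_nonneg ‖a - (S.τ k)⁻¹ • g‖]

lemma gradient_sub_z_succ (k : ℕ) (ω : Ω) :
    gradient (objective S.f T) (S.P.x (k + 1) ω) - S.P.z (k + 1) ω
      = ((1 - S.τ k) • (gradient (objective S.f T) (S.P.x k ω) - S.P.z k ω)
        + S.τ k • S.drift k ω) - S.τ k • (S.est k ω - S.mean k ω) := by
  have := (S.step_mem k).1.ne'
  rw [S.z_succ_eq, drift]
  simp only [smul_add, smul_sub, smul_smul, mul_inv_cancel₀ this, one_smul, sub_smul]
  abel

lemma measurable_gradient_x_succ (k : ℕ) :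
    Measurable[S.P.history k] fun ω => gradient (objective S.f T) (S.P.x (k + 1) ω) :=
  S.continuous_gradient_objective.measurable.comp (S.measurable_x_succ k)

lemma measurable_drift (k : ℕ) : Measurable[S.P.history k] (S.drift k) :=
  ((S.measurable_gradient_x k).sub (S.measurable_mean k)).add
    (((S.measurable_gradient_x_succ k).sub
      (S.measurable_gradient_x k)).const_smul (S.τ k)⁻¹)

lemma sigmaSq_nonneg : 0 ≤ sigmaSq T S.Lf S.Lg S.lam S.β S.σG S.σJ := by
  have hβ := S.β_pos
  have h1 : 0 ≤ prodSigmaJ T S.σJ := prodSigmaJ_nonneg _ _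
  have h2 : 0 ≤ lipGradEta S.β := by unfold lipGradEta; positivity
  have h3 : 0 ≤ ∑ i ∈ Finset.range T, gammaWeight T S.Lf S.lam i * S.σG i ^ 2 :=
    Finset.sum_nonneg fun i _ => mul_nonneg (S.gammaWeight_nonneg i) (sq_nonneg _)
  have h4 : 0 ≤ ∑ i ∈ Finset.range (T - 1), gammaWeight T S.Lf S.lam i * S.σG (i + 1) ^ 2 :=
    Finset.sum_nonneg fun i _ => mul_nonneg (S.gammaWeight_nonneg i) (sq_nonneg _)
  unfold sigmaSq
  positivity

lemma iSup_history_le : ⨆ k, S.P.history k ≤ mΩ := iSup_le S.history_le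

variable [IsProbabilityMeasure μ]

lemma memLp_drift (k : ℕ) : MemLp (S.drift k) 2 μ :=
  ((S.memLp_gradient k).sub (S.memLp_mean k)).add
    (((S.memLp_gradient (k + 1)).sub (S.memLp_gradient k)).const_smul (S.τ k)⁻¹)

lemma memLp_gradient_sub_z (k : ℕ) :
    MemLp (fun ω => gradient (objective S.f T) (S.P.x k ω) - S.P.z k ω) 2 μ :=
  (S.memLp_gradient k).sub (S.memLp_z k)

lemma integrable_sq_gradient_sub_z (k : ℕ) :
    Integrable (fun ω => ‖gradient (objective S.f T) (S.P.x k ω) - S.P.z k ω‖ ^ 2) μ :=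
  (S.memLp_gradient_sub_z k).integrable_norm_pow (by norm_num)

lemma integral_sq_drift_le (k : ℕ) : ∫ ω, ‖S.drift k ω‖ ^ 2 ∂μ
    ≤ 2 * (constLSq T S.Lf S.Lg : ℝ) * ((T : ℝ) - 1) * S.total k := by
  have i1 := S.integrable_sq_dir k
  have i2 : ∀ i ∈ Finset.range T, Integrable (fun ω => ‖S.err k i ω‖ ^ 2) μ :=
    fun i hi => S.integrable_sq_err k (Finset.mem_range.1 hi)
  refine (integral_mono ((S.memLp_drift k).integrable_norm_pow (by norm_num))
    ((i1.fun_add (integrable_finsetSum _ i2)).const_mul _) (S.sq_norm_drift_le k)).trans_eq ?_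
  rw [integral_const_mul, integral_add i1 (integrable_finsetSum _ i2), integral_finsetSum _ i2]
  rfl

/-- The averaged gradient estimate contracts towards the gradient: its innovation is centered. -/
lemma track_succ_le (k : ℕ) : S.track (k + 1) ≤ (1 - S.τ k) * S.track k
    + (S.τ k * (2 * (constLSq T S.Lf S.Lg : ℝ) * ((T : ℝ) - 1) * S.total k)
      + S.τ k ^ 2 * prodSigmaJ T S.σJ) := by
  have hτ := S.step_mem k
  set v : Ω → LevelSpace d T := fun ω =>
    (1 - S.τ k) • (gradient (objective S.f T) (S.P.x k ω) - S.P.z k ω) + S.τ k • S.drift k ω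
    with hv
  have hdiff : MemLp (fun ω => S.est k ω - S.mean k ω) 2 μ := (S.memLp_est k).sub (S.memLp_mean k)
  have hvL : MemLp v 2 μ := memLp_smul_add_smul (S.memLp_gradient_sub_z k) (S.memLp_drift k) _ _
  have hvm : Measurable[S.P.history k] v := measurable_smul_add_smul
    ((S.measurable_gradient_x k).sub (S.measurable_z k))
    (S.measurable_drift k) _ _
  have h0 := S.integral_inner_est_sub_mean k hvm hvL
  have i1 := S.integrable_sq_gradient_sub_z k
  have i2 := (S.memLp_drift k).integrable_norm_pow (p := 2) (by norm_num)
  have i3 := integrable_inner_of_memLp hvL hdiff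
  have i4 := hdiff.integrable_norm_pow (p := 2) (by norm_num)
  have hpt : ∀ ω, ‖gradient (objective S.f T) (S.P.x (k + 1) ω) - S.P.z (k + 1) ω‖ ^ 2
      ≤ (1 - S.τ k) * ‖gradient (objective S.f T) (S.P.x k ω) - S.P.z k ω‖ ^ 2
        + S.τ k * ‖S.drift k ω‖ ^ 2
        - 2 * S.τ k * inner ℝ (v ω) (S.est k ω - S.mean k ω)
        + S.τ k ^ 2 * ‖S.est k ω - S.mean k ω‖ ^ 2 := fun ω => by
    have h1 := norm_sq_convex_comb_le hτ.1.le hτ.2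
      (gradient (objective S.f T) (S.P.x k ω) - S.P.z k ω) (S.drift k ω)
    rw [S.gradient_sub_z_succ, norm_sub_sq_real, real_inner_smul_right, norm_smul,
      Real.norm_of_nonneg hτ.1.le, mul_pow]
    linarith
  refine (integral_mono (S.integrable_sq_gradient_sub_z (k + 1))
    ((((i1.const_mul _).fun_add (i2.const_mul _)).sub' (i3.const_mul _)).fun_add (i4.const_mul _))
    hpt).trans ?_
  rw [integral_add (((i1.const_mul _).fun_add (i2.const_mul _)).sub' (i3.const_mul _))
      (i4.const_mul _), integral_sub ((i1.const_mul _).fun_add (i2.const_mul _)) (i3.const_mul _),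
    integral_add (i1.const_mul _) (i2.const_mul _), integral_const_mul, integral_const_mul,
    integral_const_mul, integral_const_mul, h0, mul_zero, sub_zero]
  have h2 := mul_le_mul_of_nonneg_left (S.integral_sq_drift_le k) hτ.1.le
  have h3 := mul_le_mul_of_nonneg_left (S.integral_sq_est_sub_mean_le k) (sq_nonneg (S.τ k))
  unfold track
  linarith

/-- The weighted sum of the mean squared gradient errors; the constant is half of the one in the
definition of `boundB1`. -/
lemma sum_track_le {c Fstar : ℝ} (hc : ∀ x ∈ S.X, Fstar ≤ objective S.f T x) (hτ0 : S.τ 0 = 1)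
    {N : ℕ} (hq : 1 - ∏ l ∈ Finset.Ico 1 (N + 1), (1 - S.τ l) ≤ c) (hc0 : 0 ≤ c) :
    ∑ k ∈ Finset.Icc 1 N, S.τ k * S.track k
      ≤ 2 * c * (constLSq T S.Lf S.Lg : ℝ) * ((T : ℝ) - 1) / S.lam * (S.potential 0 - Fstar
        + sigmaSq T S.Lf S.Lg S.lam S.β S.σG S.σJ * ∑ k ∈ Finset.range N, S.τ k ^ 2)
        + c * prodSigmaJ T S.σJ * ∑ k ∈ Finset.range N, S.τ k ^ 2 := by
  have hlam := S.lam_pos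
  have hT' : (0 : ℝ) ≤ (T : ℝ) - 1 := by
    have : (2 : ℝ) ≤ T := by exact_mod_cast S.two_le
    linarith
  have hPJ : 0 ≤ prodSigmaJ T S.σJ := prodSigmaJ_nonneg _ _
  set K : ℝ := 2 * (constLSq T S.Lf S.Lg : ℝ) * ((T : ℝ) - 1) with hK
  have hK0 : 0 ≤ K := by positivity
  have h1 := sum_mul_le_of_recursion (E := S.track)
    (h := fun k => S.τ k * (K * S.total k) + S.τ k ^ 2 * prodSigmaJ T S.σJ) S.step_mem hτ0
    (fun k => by have := S.total_nonneg k; have := (S.step_mem k).1.le; positivity)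
    S.track_succ_le hq
  have h2 := S.lam_mul_sum_total_le hc N
  have e : ∑ k ∈ Finset.range N, (S.τ k * (K * S.total k) + S.τ k ^ 2 * prodSigmaJ T S.σJ)
      = K / S.lam * (S.lam * ∑ k ∈ Finset.range N, S.τ k * S.total k)
        + prodSigmaJ T S.σJ * ∑ k ∈ Finset.range N, S.τ k ^ 2 := by
    rw [Finset.sum_add_distrib, Finset.mul_sum, Finset.mul_sum, Finset.mul_sum]
    congr 1
    · exact Finset.sum_congr rfl fun k _ => by field_simp
    · exact Finset.sum_congr rfl fun k _ => mul_comm _ _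
  rw [e] at h1
  refine h1.trans ?_
  have h3 : c * (K / S.lam * (S.lam * ∑ k ∈ Finset.range N, S.τ k * S.total k))
      ≤ c * (K / S.lam * (S.potential 0 - Fstar
        + sigmaSq T S.Lf S.Lg S.lam S.β S.σG S.σJ * ∑ k ∈ Finset.range N, S.τ k ^ 2)) := by
    gcongr
  rw [mul_add]
  have e2 : c * (K / S.lam * (S.potential 0 - Fstar
        + sigmaSq T S.Lf S.Lg S.lam S.β S.σG S.σJ * ∑ k ∈ Finset.range N, S.τ k ^ 2))
      = 2 * c * (constLSq T S.Lf S.Lg : ℝ) * ((T : ℝ) - 1) / S.lam * (S.potential 0 - Fstar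
        + sigmaSq T S.Lf S.Lg S.lam S.β S.σG S.σJ * ∑ k ∈ Finset.range N, S.τ k ^ 2) := by
    rw [hK]; ring
  linarith

/-- Any sequence below `total` inherits its summability bound; the sum may omit the index `0`. -/
lemma sum_Icc_le {Fstar : ℝ} (hc : ∀ x ∈ S.X, Fstar ≤ objective S.f T x) {a : ℕ → ℝ}
    (ha : ∀ k, a k ≤ S.total k) (N : ℕ) :
    ∑ k ∈ Finset.Icc 1 N, S.τ k * a k ≤ 1 / S.lam * (S.potential 0 - Fstar
      + sigmaSq T S.Lf S.Lg S.lam S.β S.σG S.σJ * ∑ k ∈ Finset.range (N + 1), S.τ k ^ 2) := by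
  have hlam := S.lam_pos
  have h := S.lam_mul_sum_total_le hc (N + 1)
  calc ∑ k ∈ Finset.Icc 1 N, S.τ k * a k ≤ ∑ k ∈ Finset.Icc 1 N, S.τ k * S.total k :=
        Finset.sum_le_sum fun k _ => mul_le_mul_of_nonneg_left (ha k) (S.step_mem k).1.le
    _ ≤ ∑ k ∈ Finset.range (N + 1), S.τ k * S.total k := by
        refine Finset.sum_le_sum_of_subset_of_nonneg (fun k hk => ?_)
          fun k _ _ => mul_nonneg (S.step_mem k).1.le (S.total_nonneg k)
        simp only [Finset.mem_Icc, Finset.mem_range] at hk ⊢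
        omega
    _ ≤ _ := by
        rw [one_div, ← div_eq_inv_mul, le_div_iff₀ hlam, mul_comm]
        exact h

/-! ### The random index -/

/-- Averaging over the random index. -/
lemma integral_randomIndex {N : ℕ} (hN : 1 ≤ N) {R : Ω → ℕ} (hR : S.P.RandomIndex μ S.τ N R)
    {g : ℕ → Ω → ℝ} (hgm : ∀ k, Measurable[S.P.history k] (g k)) (hgi : ∀ k, Integrable (g k) μ) :
    Integrable (fun ω => g (R ω) ω) μ ∧ ∫ ω, g (R ω) ω ∂μ
      = (∑ k ∈ Finset.Icc 1 N, S.τ k * ∫ ω, g k ω ∂μ) / ∑ k ∈ Finset.Icc 1 N, S.τ k := by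
  have hτs : 0 < ∑ k ∈ Finset.Icc 1 N, S.τ k :=
    Finset.sum_pos (fun k _ => (S.step_mem k).1) ⟨1, by simp [hN]⟩
  have hRk : ∀ k, MeasurableSet {ω | R ω = k} := fun k => hR.measurable (measurableSet_singleton k)
  have hmem : ∀ᵐ ω ∂μ, R ω ∈ Finset.Icc 1 N := by
    have h1 : μ.real (⋃ k ∈ Finset.Icc 1 N, {ω | R ω = k}) = 1 := by
      rw [measureReal_biUnion_finset (fun i _ j _ hij => Set.disjoint_left.2 fun ω h1 h2 =>
        hij (h1.symm.trans h2)) (fun k _ => hRk k), Finset.sum_congr rfl hR.law,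
        ← Finset.sum_div, div_self hτs.ne']
    have h2 : μ (⋃ k ∈ Finset.Icc 1 N, {ω | R ω = k}) = 1 := by
      rwa [measureReal_def, ENNReal.toReal_eq_one_iff] at h1
    filter_upwards [mem_ae_iff_prob_eq_one₀
      (Finset.measurableSet_biUnion _ fun k _ => hRk k).nullMeasurableSet |>.2 h2] with ω hω
    simp only [Set.mem_iUnion, Set.mem_ofPred_eq] at hω
    obtain ⟨k, hk, rfl⟩ := hω
    exact hk
  have hae : (fun ω => ∑ k ∈ Finset.Icc 1 N, {ω | R ω = k}.indicator (g k) ω)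
      =ᵐ[μ] fun ω => g (R ω) ω := by
    filter_upwards [hmem] with ω hω
    rw [Finset.sum_eq_single_of_mem (R ω) hω fun k _ hk => by simp [hk.symm]]
    simp
  have hind : ∀ k ∈ Finset.Icc 1 N, Integrable ({ω | R ω = k}.indicator (g k)) μ :=
    fun k _ => (hgi k).indicator (hRk k)
  refine ⟨(integrable_finsetSum _ hind).congr hae, ?_⟩
  rw [← integral_congr_ae hae, integral_finsetSum _ hind, Finset.sum_div]
  refine Finset.sum_congr rfl fun k hk => ?_
  have hRm : MeasurableSpace.comap R inferInstance ≤ mΩ := hR.measurable.comap_le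
  have hce := condExp_indep_eq S.iSup_history_le hRm
    ((hgm k).mono (le_iSup S.P.history k) le_rfl).stronglyMeasurable hR.indep.symm
  have hset : MeasurableSet[MeasurableSpace.comap R inferInstance] {ω | R ω = k} :=
    ⟨{k}, measurableSet_singleton k, rfl⟩
  rw [integral_indicator (hRk k), ← setIntegral_condExp hRm (hgi k) hset,
    integral_congr_ae (ae_restrict_of_ae hce), setIntegral_const, smul_eq_mul, hR.law k hk]
  ring

/-- A bound on the weighted sum of means turns into a bound on the mean at the random index. -/
lemma integral_randomIndex_le {N : ℕ} (hN : 1 ≤ N) {R : Ω → ℕ} (hR : S.P.RandomIndex μ S.τ N R)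
    {g : ℕ → Ω → ℝ} (hgm : ∀ k, Measurable[S.P.history k] (g k)) (hgi : ∀ k, Integrable (g k) μ)
    {B : ℝ} (hB : ∑ k ∈ Finset.Icc 1 N, S.τ k * ∫ ω, g k ω ∂μ ≤ B) :
    Integrable (fun ω => g (R ω) ω) μ ∧
      ∫ ω, g (R ω) ω ∂μ ≤ 1 / (∑ k ∈ Finset.Icc 1 N, S.τ k) * B := by
  obtain ⟨h1, h2⟩ := S.integral_randomIndex hN hR hgm hgi
  have hτs : 0 ≤ ∑ k ∈ Finset.Icc 1 N, S.τ k :=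
    Finset.sum_nonneg fun k _ => (S.step_mem k).1.le
  refine ⟨h1, ?_⟩
  rw [h2, one_div, ← div_eq_inv_mul]
  gcongr

lemma integrable_stationarity (k : ℕ) :
    Integrable (fun ω => stationarity S.X (objective S.f T) (S.P.x k ω) (S.P.z k ω)) μ := by
  refine (((S.integrable_sq_dir k).const_mul (max 1 (S.β ^ 2))).fun_add
    (S.integrable_sq_gradient_sub_z k)).mono'
    ((S.measurable_stationarity k).mono (S.history_le k) le_rfl).aestronglyMeasurable
    (.of_forall fun ω => ?_)
  rw [Real.norm_of_nonneg (S.stationarity_nonneg k ω)]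
  exact S.stationarity_le k ω

lemma integral_stationarity_le (k : ℕ) :
    ∫ ω, stationarity S.X (objective S.f T) (S.P.x k ω) (S.P.z k ω) ∂μ
      ≤ max 1 (S.β ^ 2) * S.sqDir k + S.track k := by
  refine (integral_mono (S.integrable_stationarity k) (((S.integrable_sq_dir k).const_mul _).fun_add
    (S.integrable_sq_gradient_sub_z k)) (S.stationarity_le k)).trans_eq ?_
  rw [integral_add ((S.integrable_sq_dir k).const_mul _) (S.integrable_sq_gradient_sub_z k),
    integral_const_mul]
  rfl

lemma sum_stationarity_le {B Fstar : ℝ} (hc : ∀ x ∈ S.X, Fstar ≤ objective S.f T x) {N : ℕ}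
    (hB : ∑ k ∈ Finset.Icc 1 N, S.τ k * S.track k ≤ B) :
    ∑ k ∈ Finset.Icc 1 N,
        S.τ k * ∫ ω, stationarity S.X (objective S.f T) (S.P.x k ω) (S.P.z k ω) ∂μ
      ≤ B + max 1 (S.β ^ 2) / S.lam * (S.potential 0 - Fstar
        + sigmaSq T S.Lf S.Lg S.lam S.β S.σG S.σJ * ∑ k ∈ Finset.range (N + 1), S.τ k ^ 2) := by
  have h1 := mul_le_mul_of_nonneg_left (S.sum_Icc_le hc S.sqDir_le_total N)
    (zero_le_one.trans (le_max_left 1 (S.β ^ 2)))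
  calc _ ≤ ∑ k ∈ Finset.Icc 1 N, (max 1 (S.β ^ 2) * (S.τ k * S.sqDir k) + S.τ k * S.track k) := by
        refine Finset.sum_le_sum fun k _ => ?_
        have := mul_le_mul_of_nonneg_left (S.integral_stationarity_le k) (S.step_mem k).1.le
        linarith
    _ = max 1 (S.β ^ 2) * ∑ k ∈ Finset.Icc 1 N, S.τ k * S.sqDir k
          + ∑ k ∈ Finset.Icc 1 N, S.τ k * S.track k := by
        rw [Finset.sum_add_distrib, ← Finset.mul_sum]
    _ ≤ _ := by
        rw [← mul_assoc, mul_one_div] at h1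
        linarith

end Model

/-! ### Constant step sizes -/

lemma sum_Icc_of_eq_inv_sqrt {τ : ℕ → ℝ} {N : ℕ}
    (h : ∀ k ∈ Finset.Icc 1 N, τ k = 1 / Real.sqrt N) :
    ∑ k ∈ Finset.Icc 1 N, τ k = Real.sqrt N := by
  rw [Finset.sum_congr rfl h, Finset.sum_const, Nat.card_Icc, Nat.add_sub_cancel, nsmul_eq_mul,
    mul_one_div, Real.div_sqrt]

lemma sum_range_sq_of_eq_inv_sqrt {τ : ℕ → ℝ} {N : ℕ} (hN : 1 ≤ N) (hτ0 : τ 0 = 1)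
    (h : ∀ k ∈ Finset.Icc 1 N, τ k = 1 / Real.sqrt N) :
    ∑ k ∈ Finset.range (N + 1), τ k ^ 2 = 2 := by
  have hN' : (N : ℝ) ≠ 0 := by positivity
  have e : ∀ k ∈ Finset.range N, τ (k + 1) ^ 2 = 1 / (N : ℝ) := fun k hk => by
    rw [h (k + 1) (by simp at hk ⊢; omega), div_pow, Real.sq_sqrt (Nat.cast_nonneg N), one_pow]
  rw [Finset.sum_range_succ', hτ0, Finset.sum_congr rfl e, Finset.sum_const, Finset.card_range,
    nsmul_eq_mul, mul_one_div, div_self hN']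
  norm_num

end NASA

end

theorem mainTheorem1 {Ω : Type*} [MeasurableSpace Ω] (μ : Measure Ω) [IsProbabilityMeasure μ]
    (d : ℕ → ℕ) (T : ℕ) (hT : 2 ≤ T)
    (X : Set (NASA.LevelSpace d T)) (hX_closed : IsClosed X) (hX_convex : Convex ℝ X)
    (f : ∀ i, NASA.LevelSpace d (i + 1) → NASA.LevelSpace d i) (Lf Lg : ℕ → ℝ≥0)
    (hf_diff : ∀ i < T, Differentiable ℝ (f i))
    (hf_lip : ∀ i < T, LipschitzWith (Lf i) (f i))
    (hf_grad : ∀ i < T, LipschitzWith (Lg i) (fderiv ℝ (f i)))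
    (Fstar : ℝ) (hFstar : ∀ x ∈ X, Fstar ≤ NASA.objective f T x)
    (lam β : ℝ) (hparam : NASA.ParameterRule T Lf Lg lam β)
    (τ : ℕ → ℝ) (hτ : ∀ k, 0 < τ k ∧ τ k ≤ 1) (hτ0 : τ 0 = 1)
    (b : ℕ → ℕ) (hb : ∀ k, b k = ⌈(NASA.maxLfSq T Lf : ℝ) / τ k⌉₊)
    (σG σJ σJhat : ℕ → ℝ)
    (x0 z0 : NASA.LevelSpace d T) (w0 : ∀ i, NASA.LevelSpace d i)
    (hx0 : x0 ∈ X) (hw0 : w0 T = x0) (hz0 : ‖z0‖ ^ 2 ≤ NASA.prodSigmaJ T σJ)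
    (P : NASA.Run d T Ω) (hP : P.GeneratedBy X β τ b x0 z0 w0)
    (hO : P.Oracle μ f b σG σJ σJhat)
    (F : NASA.LevelSpace d T → ℝ) (hF : F = NASA.objective f T)
    (W0 : ℝ) (hW0 : W0 = NASA.merit f T X β Fstar (NASA.gammaWeight T Lf lam) x0 z0 w0)
    (σsq : ℝ) (hσsq : σsq = NASA.sigmaSq T Lf Lg lam β σG σJ)
    (PJ : ℝ) (hPJ : PJ = NASA.prodSigmaJ T σJ) :
    (∀ c : ℝ, 0 < c → NASA.GammaCondition τ c → ∀ N : ℕ, 1 ≤ N →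
      ((∀ k ∈ Finset.Icc 1 N, Integrable (fun ω => ‖gradient F (P.x k ω) - P.z k ω‖ ^ 2) μ) ∧
        ∑ k ∈ Finset.Icc 1 N, τ k * ∫ ω, ‖gradient F (P.x k ω) - P.z k ω‖ ^ 2 ∂μ
          ≤ NASA.boundB1 T Lf Lg lam c W0 σsq PJ τ N) ∧
      (∀ R : Ω → ℕ, P.RandomIndex μ τ N R →
        Integrable (fun ω => NASA.stationarity X F (P.x (R ω) ω) (P.z (R ω) ω)) μ ∧
        ∫ ω, NASA.stationarity X F (P.x (R ω) ω) (P.z (R ω) ω) ∂μ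
          ≤ 1 / (∑ k ∈ Finset.Icc 1 N, τ k)
            * (NASA.boundB1 T Lf Lg lam c W0 σsq PJ τ N
              + max 1 (β ^ 2) / lam * (W0 + σsq * ∑ k ∈ Finset.range (N + 1), τ k ^ 2)))) ∧
    (∀ N : ℕ, 1 ≤ N → (∀ k ∈ Finset.Icc 1 N, τ k = 1 / Real.sqrt N) →
      ∀ R : Ω → ℕ, P.RandomIndex μ τ N R →
        (Integrable (fun ω => ‖gradient F (P.x (R ω) ω) - P.z (R ω) ω‖ ^ 2) μ ∧
          ∫ ω, ‖gradient F (P.x (R ω) ω) - P.z (R ω) ω‖ ^ 2 ∂μ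
            ≤ NASA.boundB2 T Lf Lg lam W0 σsq PJ / Real.sqrt N) ∧
        (Integrable (fun ω => NASA.stationarity X F (P.x (R ω) ω) (P.z (R ω) ω)) μ ∧
          ∫ ω, NASA.stationarity X F (P.x (R ω) ω) (P.z (R ω) ω) ∂μ
            ≤ 1 / Real.sqrt N
              * (NASA.boundB2 T Lf Lg lam W0 σsq PJ
                + max 1 (β ^ 2) / lam * (W0 + 2 * σsq))) ∧
        (∀ i < T,
          Integrable (fun ω => ‖f i (P.w (R ω) (i + 1) ω) - P.w (R ω) i ω‖ ^ 2) μ ∧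
          ∫ ω, ‖f i (P.w (R ω) (i + 1) ω) - P.w (R ω) i ω‖ ^ 2 ∂μ
            ≤ 1 / (lam * Real.sqrt N) * (W0 + 2 * σsq))) := by
  subst hF hW0 hσsq hPJ
  let S : NASA.Model μ d T :=
    { X := X, f := f, Lf := Lf, Lg := Lg, lam := lam, β := β, τ := τ, b := b, σG := σG, σJ := σJ
      σJhat := σJhat, x0 := x0, z0 := z0, w0 := w0, P := P, two_le := hT, closed := hX_closed
      convex := hX_convex, diff := hf_diff, lip := hf_lip, grad := hf_grad, param := hparam
      step_mem := hτ, batch := hb, x0_mem := hx0, w0_top := hw0, z0_le := hz0, gen := hP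
      oracle := hO }
  have hlam : 0 < lam := hparam.lam_pos
  have hT' : (0 : ℝ) ≤ (T : ℝ) - 1 := by
    have : (2 : ℝ) ≤ T := by exact_mod_cast hT
    linarith
  have hσ : 0 ≤ NASA.sigmaSq T Lf Lg lam β σG σJ := S.sigmaSq_nonneg
  have hPJ : 0 ≤ NASA.prodSigmaJ T σJ := NASA.prodSigmaJ_nonneg _ _
  have hpot : S.potential 0 - Fstar
      = NASA.merit f T X β Fstar (NASA.gammaWeight T Lf lam) x0 z0 w0 := S.potential_zero Fstar
  have hpot0 : 0 ≤ S.potential 0 - Fstar := sub_nonneg.2 (S.le_potential hFstar 0)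
  rw [← hpot]
  set W : ℝ := S.potential 0 - Fstar
  set σ2 : ℝ := NASA.sigmaSq T Lf Lg lam β σG σJ
  set PJ : ℝ := NASA.prodSigmaJ T σJ
  set L2 : ℝ := (NASA.constLSq T Lf Lg : ℝ) with hL2
  have hL0 : 0 ≤ L2 := NNReal.coe_nonneg _
  -- `sum_track_le` has half of the constant required here.
  have hdouble : ∀ {c s : ℝ}, 0 ≤ c → 0 ≤ s →
      2 * c * L2 * ((T : ℝ) - 1) / lam * (W + σ2 * s) + c * PJ * s
        ≤ 4 * c * L2 * ((T : ℝ) - 1) / lam * (W + σ2 * s) + c * PJ * s := fun hc hs => by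
    gcongr
    norm_num
  have htrack : ∀ {c : ℝ} {N : ℕ}, 1 - ∏ l ∈ Finset.Ico 1 (N + 1), (1 - τ l) ≤ c → 0 ≤ c →
      ∑ k ∈ Finset.Icc 1 N, τ k * S.track k ≤ NASA.boundB1 T Lf Lg lam c W σ2 PJ τ N :=
    fun hq hc => (S.sum_track_le hFstar hτ0 hq hc).trans
      (hdouble hc (Finset.sum_nonneg fun _ _ => sq_nonneg _))
  refine ⟨fun c hc hΓ N hN => ?_, fun N hN hstep R hR => ?_⟩
  · have h1 := htrack (hΓ.one_sub_prod_le hτ0 hN) hc.le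
    exact ⟨⟨fun k _ => S.integrable_sq_gradient_sub_z k, h1⟩, fun R hR =>
      S.integral_randomIndex_le hN hR S.measurable_stationarity S.integrable_stationarity
        (S.sum_stationarity_le hFstar h1)⟩
  · have hs1 : ∑ k ∈ Finset.Icc 1 N, τ k = Real.sqrt N := NASA.sum_Icc_of_eq_inv_sqrt hstep
    have hs2 : ∑ k ∈ Finset.range (N + 1), τ k ^ 2 = 2 :=
      NASA.sum_range_sq_of_eq_inv_sqrt hN hτ0 hstep
    have hs3 : ∑ k ∈ Finset.range N, τ k ^ 2 ≤ 2 := by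
      rw [← hs2, Finset.sum_range_succ]
      exact le_add_of_nonneg_right (sq_nonneg _)
    -- The telescoping weights are at most `1`, so the bounds hold with `c = 1`.
    have hq : 1 - ∏ l ∈ Finset.Ico 1 (N + 1), (1 - τ l) ≤ 1 :=
      sub_le_self _ (Finset.prod_nonneg fun l _ => sub_nonneg.2 (hτ l).2)
    have h1 : ∑ k ∈ Finset.Icc 1 N, τ k * S.track k
        ≤ NASA.boundB2 T Lf Lg lam W σ2 PJ := by
      refine (htrack hq zero_le_one).trans ?_
      rw [NASA.boundB1, NASA.boundB2, ← hL2]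
      have e1 : 4 * 1 * L2 * ((T : ℝ) - 1) / lam * (W + σ2 * ∑ k ∈ Finset.range N, τ k ^ 2)
          ≤ 4 * 1 * L2 * ((T : ℝ) - 1) / lam * (W + σ2 * 2) := by gcongr
      have e2 : 1 * PJ * ∑ k ∈ Finset.range N, τ k ^ 2 ≤ 1 * PJ * 2 := by gcongr
      refine (add_le_add e1 e2).trans_eq ?_
      ring
    have h2 := S.sum_stationarity_le hFstar h1
    refine ⟨?_, ?_, fun i hi => ?_⟩
    · have h := S.integral_randomIndex_le hN hR S.measurable_sq_gradient_sub_z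
        S.integrable_sq_gradient_sub_z h1
      refine ⟨h.1, h.2.trans_eq ?_⟩
      change 1 / (∑ k ∈ Finset.Icc 1 N, τ k) * _ = _
      rw [hs1, one_div_mul_eq_div]
    · have h := S.integral_randomIndex_le hN hR S.measurable_stationarity
        S.integrable_stationarity h2
      refine ⟨h.1, h.2.trans_eq ?_⟩
      change 1 / (∑ k ∈ Finset.Icc 1 N, τ k) * (_ + max 1 (β ^ 2) / lam
        * (W + σ2 * ∑ k ∈ Finset.range (N + 1), τ k ^ 2)) = _
      rw [hs1, hs2, mul_comm σ2]
    · have h := S.integral_randomIndex_le hN hR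
        (fun k => NASA.measurable_sq_norm (S.measurable_err k hi))
        (fun k => S.integrable_sq_err k hi)
        (S.sum_Icc_le hFstar (fun k => S.sqErr_le_total k hi) N)
      refine ⟨h.1, h.2.trans_eq ?_⟩
      change 1 / (∑ k ∈ Finset.Icc 1 N, τ k)
        * (1 / lam * (W + σ2 * ∑ k ∈ Finset.range (N + 1), τ k ^ 2)) = _
      rw [hs1, hs2, mul_comm σ2, ← mul_assoc, one_div_mul_one_div, mul_comm (Real.sqrt _)]
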